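/- **Notation.** $K$ is a field, $R=K[x_1,\dots,x_n]$, $R'=R[y]$, and $\mathbf F=(f_1,\dots,f_m)$ is a sequence of nonzero polynomials of $R$, not necessarily homogeneous, of total degrees $d_1,\dots,d_m$. $\mathbf F^{\rm top}$ is the sequence of their parts of highest total degree, and $\mathbf F^h$ the sequence of their homogenizations in $R'$ by $y$. $\prec$ is a graded monomial order on $R$ and $\prec^h$ its homogenization (compare total degrees first, then the $x$-parts by $\prec$). $\max.\mathrm{GB.deg}_{\prec^h}(F^h)$ is the maximal degree in the reduced Gröbner basis of $\langle F^h\rangle$ (it is $0$ for the zero ideal). $M_{\le D}(F^h)$ is the degree-$D$ Macaulay matrix: its rows are the coefficient vectors of $t f_i^h$, $t$ a monomial, $\deg t+d_i\le D$, in any order, and its columns are the monomials of $R'$ of degree $\le D$ in $\prec^h$-descending order. For a homogeneous ideal $I$ of a polynomial ring $S$ over $K$, $d_{\rm reg}(I)=\min\{d: I_d=S_d\}$ if $S/I$ is Artinian (i.e. $(S/I)_d=0$ for large $d$) and $\infty$ otherwise; $\tilde d_{\rm reg}(I)$ is the least $d_0$ such that $\dim_K(S/I)_d$ is constant for $d\ge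 d_0$ ($\infty$ if there is none). A sequence $h_1,\dots,h_m$ of homogeneous polynomials is $d$-regular if for all $i$ and all homogeneous $g$ with $\deg(gh_i)<d$ and $gh_i\in\langle h_1,\dots,h_{i-1}\rangle$ one has $g\in\langle h_1,\dots,h_{i-1}\rangle$; with $I=\langle h_1,\dots,h_m\rangle$ it is cryptographic semi-regular (resp. generalized cryptographic semi-regular) if it is $d_{\rm reg}(I)$-regular (resp. $\tilde d_{\rm reg}(I)$-regular). For $P\in\mathbb Z[[z]]$, $[P]$ is $P$ truncated after its last consecutive positive coefficient. Complexity is the number of field operations and zero tests on a longest path of an arithmetic computation tree with constants in $K$. A real $\omega$ is an admissible exponent of matrix multiplication over $K$ if $N\times N$ matrices can be multiplied with $O(N^\omega)$ operations by such trees, correctly over every extension field of $K$. **Statement.** 1. Let $\omega>2$ be an admissible exponent of matrix multiplication over $K$. For every $c\in\mathbb N$ there is a constant $C$, depending only on $K,\omega,c$, such that for all $n,m$, $d_1,\dots,d_m$, all $D\le cn$ and every graded $\prec$ (and every order of the rows) there is an arithmetic computation tree of cost at most $C\,m\binom{n+D}{D}^{\omega}$ which, for every extension field $L$ of $K$ and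 all nonzero $f_1,\dots,f_m\in L[x_1,\dots,x_n]$ of degrees $d_1,\dots,d_m$, computes the reduced row echelon form of $M_{\le D}(F^h)$ from the coefficients of the $f_i$. If moreover $\max.\mathrm{GB.deg}_{\prec^h}(F^h)\le D$ (in particular, if it equals $D$), then the nonzero rows of this form are a Gröbner basis of $\langle F^h\rangle$ with respect to $\prec^h$, and setting $y=1$ in them gives a Gröbner basis of $\langle F\rangle$ with respect to $\prec$. 2. Suppose that all $d_j\ge1$, $m=n$, $R/\langle F^{\rm top}\rangle$ is Artinian and $\mathbf F^{\rm top}$ is cryptographic semi-regular. Then $\tilde d_{\rm reg}(\langle F^h\rangle)=d_{\rm reg}(\langle F^{\rm top}\rangle)-1$ and $d_{\rm reg}(\langle F^{\rm top}\rangle)=\sum_{j=1}^n d_j-n+1$. 3. Suppose that all $d_j\ge1$, $m>n$ and $\mathbf F^h$ is generalized cryptographic semi-regular. Then $$\tilde d_{\rm reg}(\langle F^h\rangle)\le \deg\left(\left[\frac{\prod_{i=1}^m(1-z^{d_i})}{(1-z)^{n+1}}\right]\right)+1 .$$ 4. Suppose that all $d_j\ge1$, $R/\langle F^{\rm top}\rangle$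 is Artinian and $\mathbf F^{\rm top}$ is cryptographic semi-regular. Then $\max.\mathrm{GB.deg}_{\prec^h}(F^h)\le\max\{d_{\rm reg}(\langle F^{\rm top}\rangle),\tilde d_{\rm reg}(\langle F^h\rangle)\}$. If moreover $d_j\le\delta$ for all $j$, and either $m=n$, or $m>n$ and $\mathbf F^h$ is generalized cryptographic semi-regular, then $\max.\mathrm{GB.deg}_{\prec^h}(F^h)\le(n+1)(\delta-1)+1$; so the condition $D=O(n)$ in 1 holds when the degrees are bounded. -/

import Mathlib

open MvPolynomial

universe u v

/-! ## Arithmetic computation trees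

A tree with input registers `ι` and output positions `O`. Every operation stores its result in a new
register, so that the remaining tree has registers `Option ι` (`none` is the new one).
`ifZero a p q` continues with `p` if register `a` holds `0` and with `q` otherwise. -/

inductive ArithTree (K : Type u) (O : Type) : Type → Type (max u 1)
  | ret {ι : Type} (out : O → ι) : ArithTree K O ι
  | const {ι : Type} (c : K) (next : ArithTree K O (Option ι)) : ArithTree K O ι
  | add {ι : Type} (a b : ι) (next : ArithTree K O (Option ι)) : ArithTree K O ι
  | sub {ι : Type} (a b : ι) (next : ArithTree K O (Option ι)) : ArithTree K O ι
  | mul {ι : Type} (a b : ι) (next : ArithTree K O (Option ι)) : ArithTree K O ι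
  | div {ι : Type} (a b : ι) (next : ArithTree K O (Option ι)) : ArithTree K O ι
  | ifZero {ι : Type} (a : ι) (p q : ArithTree K O ι) : ArithTree K O ι

namespace ArithTree

/-- The number of field operations and zero tests on the most expensive path. -/
def cost {K : Type u} {O : Type} : {ι : Type} → ArithTree K O ι → ℕ
  | _, ret _ => 0
  | _, const _ next => next.cost
  | _, add _ _ next => next.cost + 1
  | _, sub _ _ next => next.cost + 1
  | _, mul _ _ next => next.cost + 1
  | _, div _ _ next => next.cost + 1
  | _, ifZero _ p q => max p.cost q.cost + 1

/-- `reg.elim x v`: the registers `v` together with a new register holding `x`. -/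
def push {L : Type u} {ι : Type} (x : L) (v : ι → L) : Option ι → L := fun o => o.elim x v

open Classical in
/-- Running a tree with constants in `K` on inputs from an extension field `L` of `K`. -/
noncomputable def eval {K L : Type u} [Field K] [Field L] [Algebra K L] {O : Type} :
    {ι : Type} → ArithTree K O ι → (ι → L) → O → L
  | _, ret out, v => fun o => v (out o)
  | _, const c next, v => next.eval (push (algebraMap K L c) v)
  | _, add a b next, v => next.eval (push (v a + v b) v)
  | _, sub a b next, v => next.eval (push (v a - v b) v)
  | _, mul a b next, v => next.eval (push (v a * v b) v)
  | _, div a b next, v => next.eval (push (v a / v b) v)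
  | _, ifZero a p q, v => if v a = 0 then p.eval v else q.eval v

end ArithTree

/-- `ω` is an admissible exponent of matrix multiplication over `K`: two `N × N` matrices can be
multiplied with `O(N ^ ω)` operations, by arithmetic computation trees over `K` that are correct
over every extension field of `K`. -/
def MatMulAdmissible (K : Type u) [Field K] (ω : ℝ) : Prop :=
  ∃ C : ℝ, ∀ N : ℕ,
    ∃ P : ArithTree K (Fin N × Fin N) ((Fin N × Fin N) ⊕ (Fin N × Fin N)),
      (P.cost : ℝ) ≤ C * (N : ℝ) ^ ω ∧
      ∀ (L : Type u) [Field L] [Algebra K L] (A B : Matrix (Fin N) (Fin N) L) (i j : Fin N),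
        P.eval (Sum.elim (fun p => A p.1 p.2) (fun p => B p.1 p.2)) (i, j) = (A * B) i j

/-! ## Reduced row echelon forms -/

/-- `A` is in reduced row echelon form, where `left a b` means that column `a` stands strictly to
the left of column `b`: the first `r` rows have pivots `p 0, p 1, …`, the others vanish. -/
def IsRREF {K : Type u} [Field K] {k : ℕ} {κ : Type} (left : κ → κ → Prop)
    (A : Matrix (Fin k) κ K) : Prop :=
  ∃ (r : ℕ) (hr : r ≤ k) (p : Fin r → κ),
    (∀ i j : Fin r, i < j → left (p i) (p j)) ∧
    (∀ i : Fin r, A (Fin.castLE hr i) (p i) = 1) ∧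
    (∀ (i : Fin r) (c : κ), left c (p i) → A (Fin.castLE hr i) c = 0) ∧
    (∀ (i : Fin r) (i' : Fin k), i' ≠ Fin.castLE hr i → A i' (p i) = 0) ∧
    (∀ (i' : Fin k) (c : κ), r ≤ (i' : ℕ) → A i' c = 0)

/-- `A` is the reduced row echelon form of `B`. -/
def IsRREFOf {K : Type u} [Field K] {k : ℕ} {κ : Type} (left : κ → κ → Prop)
    (A B : Matrix (Fin k) κ K) : Prop :=
  IsRREF left A ∧
    Submodule.span K (Set.range fun i => A i) = Submodule.span K (Set.range fun i => B i)

/-! ## Monomial orders and Gröbner bases -/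

/-- The monomial order compares total degrees first. -/
def MonomialOrder.IsGraded {σ : Type} (ord : MonomialOrder.{0, v} σ) : Prop :=
  ∀ a b : σ →₀ ℕ, a.degree < b.degree → ord.toSyn a < ord.toSyn b

/-- `x^α y^a ↦ (a + |α|, x^α)`. The variable `y` is `none`. -/
noncomputable def homogKey {σ : Type} (ord : MonomialOrder.{0, v} σ) :
    (Option σ →₀ ℕ) →+ (ℕ ×ₗ ord.syn) where
  toFun a := toLex (a.degree, ord.toSyn a.some)
  map_zero' := by simp
  map_add' a b := by simp; rfl

theorem homogKey_injective {σ : Type} (ord : MonomialOrder.{0, v} σ) :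
    Function.Injective (homogKey ord) := by
  intro a b h
  have h' : (a.degree, ord.toSyn a.some) = (b.degree, ord.toSyn b.some) := toLex.injective h
  obtain ⟨h1, h2⟩ := Prod.mk.inj h'
  have h3 : a.some = b.some := ord.toSyn.injective h2
  have key : ∀ c : Option σ →₀ ℕ, c.degree = c none + c.some.degree := by
    intro c
    have := Finsupp.sum_option_index c (fun _ n => n) (fun _ => rfl) (fun _ _ _ => rfl)
    simpa [Finsupp.sum, Finsupp.degree_apply] using this
  ext o
  cases o with
  | none =>
    have ha := key a
    have hb := key b
    rw [h3] at ha
    omega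
  | some i => simpa using DFunLike.congr_fun h3 i

/-- The homogenization of a monomial order: compare total degrees first, then the `x`-parts. -/
noncomputable def MonomialOrder.homogenization {σ : Type} (ord : MonomialOrder.{0, v} σ) :
    MonomialOrder.{0, v} (Option σ) where
  syn := AddMonoidHom.mrange (homogKey ord)
  addCommMonoidSyn := inferInstanceAs (AddCommMonoid (AddMonoidHom.mrange (homogKey ord)))
  linearOrderSyn := inferInstanceAs (LinearOrder (AddMonoidHom.mrange (homogKey ord)))
  isOrderedAddMonoid_syn :=
    inferInstanceAs (IsOrderedAddMonoid (AddMonoidHom.mrange (homogKey ord)))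
  toSyn := AddEquiv.ofBijective (homogKey ord).mrangeRestrict
    ⟨fun _ _ h => homogKey_injective ord (congrArg Subtype.val h),
      (homogKey ord).mrangeRestrict_surjective⟩
  toSyn_monotone := by
    intro a b hab
    change toLex (a.degree, ord.toSyn a.some) ≤ toLex (b.degree, ord.toSyn b.some)
    have h1 : a.degree ≤ b.degree := Finsupp.degree_mono hab
    have h2 : ord.toSyn a.some ≤ ord.toSyn b.some := ord.toSyn_monotone fun i => hab (some i)
    exact Prod.Lex.toLex_mono ⟨h1, h2⟩

theorem MonomialOrder.homogenization_lt_iff {σ : Type} (ord : MonomialOrder.{0, v} σ)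
    (a b : Option σ →₀ ℕ) :
    ord.homogenization.toSyn a < ord.homogenization.toSyn b ↔
      a.degree < b.degree ∨ a.degree = b.degree ∧ ord.toSyn a.some < ord.toSyn b.some := by
  change toLex (a.degree, ord.toSyn a.some) < toLex (b.degree, ord.toSyn b.some) ↔ _
  exact Prod.Lex.toLex_lt_toLex

/-- `G` is a (finite) Gröbner basis of the ideal `I`: every leading monomial of `I` is divisible by
the leading monomial of an element of `G`. -/
def IsGroebnerBasis {σ : Type} {K : Type u} [Field K] (ord : MonomialOrder.{0, v} σ)
    (I : Ideal (MvPolynomial σ K)) (G : Set (MvPolynomial σ K)) : Prop :=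
  G.Finite ∧ (∀ g ∈ G, g ∈ I ∧ g ≠ 0) ∧
    ∀ f ∈ I, f ≠ 0 → ∃ g ∈ G, ord.degree g ≤ ord.degree f

/-- `G` is a reduced Gröbner basis: leading coefficients are `1`, and no monomial of an element of
`G` is divisible by the leading monomial of another one. -/
def IsReducedGroebnerBasis {σ : Type} {K : Type u} [Field K] (ord : MonomialOrder.{0, v} σ)
    (I : Ideal (MvPolynomial σ K)) (G : Set (MvPolynomial σ K)) : Prop :=
  IsGroebnerBasis ord I G ∧ (∀ g ∈ G, ord.leadingCoeff g = 1) ∧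
    ∀ g ∈ G, ∀ g' ∈ G, g' ≠ g → ∀ t ∈ g.support, ¬ ord.degree g' ≤ t

/-- The maximal degree of the elements of the reduced Gröbner basis of `I`. -/
noncomputable def maxGBDeg {σ : Type} {K : Type u} [Field K] (ord : MonomialOrder.{0, v} σ)
    (I : Ideal (MvPolynomial σ K)) : ℕ :=
  sSup {d | ∃ G, IsReducedGroebnerBasis ord I G ∧ ∃ g ∈ G, g.totalDegree = d}

/-! ## Top parts and homogenization of polynomials -/

/-- The part of `f` of maximal total degree. -/
noncomputable def topPart {σ : Type} {K : Type u} [Field K] (f : MvPolynomial σ K) :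
    MvPolynomial σ K :=
  homogeneousComponent f.totalDegree f

/-- The homogenization of `f` by the extra variable `y = X none`. -/
noncomputable def homogPoly {σ : Type} {K : Type u} [Field K] (f : MvPolynomial σ K) :
    MvPolynomial (Option σ) K :=
  ∑ t ∈ f.support, monomial (t.optionElim (f.totalDegree - t.degree)) (coeff t f)

/-- Substituting `y = 1`. -/
noncomputable def dehomog {σ : Type} {K : Type u} [Field K] (h : MvPolynomial (Option σ) K) :
    MvPolynomial σ K :=
  aeval (fun o : Option σ => o.elim 1 X) h

/-! ## Hilbert functions and degrees of regularity -/

/-- `dim_K (R/I)_d`, where `(R/I)_d = R_d / (I ∩ R_d)`. -/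
noncomputable def hilbertFn {σ : Type} {K : Type u} [Field K] (I : Ideal (MvPolynomial σ K))
    (d : ℕ) : ℕ :=
  Module.finrank K (homogeneousSubmodule σ K d ⧸
    (I.restrictScalars K).comap (homogeneousSubmodule σ K d).subtype)

/-- `R/I` is Artinian, for a homogeneous ideal `I`: its graded pieces of large degree vanish. -/
def IsArtinianQuotient {σ : Type} {K : Type u} [Field K] (I : Ideal (MvPolynomial σ K)) : Prop :=
  ∃ D : ℕ, ∀ d ≥ D, ∀ f : MvPolynomial σ K, f.IsHomogeneous d → f ∈ I

open Classical in
/-- The degree of regularity of a homogeneous ideal `I`: the least `d` with `R_d = I_d` if `R/I` is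
Artinian, and `∞` otherwise. -/
noncomputable def dReg {σ : Type} {K : Type u} [Field K] (I : Ideal (MvPolynomial σ K)) : ℕ∞ :=
  if IsArtinianQuotient I then
    ((sInf {d : ℕ | ∀ f : MvPolynomial σ K, f.IsHomogeneous d → f ∈ I} : ℕ) : ℕ∞)
  else ⊤

open Classical in
/-- The generalized degree of regularity of a homogeneous ideal: the least degree from which on the
Hilbert function of `R/I` is constant, and `∞` if there is none. -/
noncomputable def genDReg {σ : Type} {K : Type u} [Field K] (I : Ideal (MvPolynomial σ K)) : ℕ∞ :=
  if ∃ d₀ : ℕ, ∀ d ≥ d₀, hilbertFn I d = hilbertFn I d₀ then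
    ((sInf {d₀ : ℕ | ∀ d ≥ d₀, hilbertFn I d = hilbertFn I d₀} : ℕ) : ℕ∞)
  else ⊤

/-- The sequence `f` of homogeneous polynomials is `d`-regular: if `g` is homogeneous,
`g * f i ∈ ⟨f 0, …, f (i - 1)⟩` and `deg (g * f i) < d`, then `g ∈ ⟨f 0, …, f (i - 1)⟩`. -/
def IsDRegular {σ : Type} {K : Type u} [Field K] {m : ℕ} (f : Fin m → MvPolynomial σ K)
    (d : ℕ∞) : Prop :=
  ∀ (i : Fin m) (e : ℕ) (g : MvPolynomial σ K), g.IsHomogeneous e →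
    ((e + (f i).totalDegree : ℕ) : ℕ∞) < d →
    g * f i ∈ Ideal.span (f '' {j | j < i}) → g ∈ Ideal.span (f '' {j | j < i})

/-- Cryptographic semi-regular sequences of homogeneous polynomials. -/
def IsCryptoSemiRegular {σ : Type} {K : Type u} [Field K] {m : ℕ}
    (f : Fin m → MvPolynomial σ K) : Prop :=
  IsDRegular f (dReg (Ideal.span (Set.range f)))

/-- Generalized cryptographic semi-regular sequences of homogeneous polynomials. -/
def IsGenCryptoSemiRegular {σ : Type} {K : Type u} [Field K] {m : ℕ}
    (f : Fin m → MvPolynomial σ K) : Prop :=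
  IsDRegular f (genDReg (Ideal.span (Set.range f)))

/-! ## Power series -/

open Classical in
/-- `[P]`: the power series `P` truncated after its last consecutive positive coefficient. -/
noncomputable def truncPos (P : PowerSeries ℤ) : PowerSeries ℤ :=
  PowerSeries.mk fun d => if ∀ e ≤ d, 0 < PowerSeries.coeff e P then PowerSeries.coeff d P else 0

/-- The degree of a power series: the supremum of the exponents that occur in it. -/
noncomputable def psDegree (P : PowerSeries ℤ) : ℕ∞ :=
  ⨆ d ∈ {d : ℕ | PowerSeries.coeff d P ≠ 0}, (d : ℕ∞)

/-- `∏ (1 - z ^ d i) / (1 - z) ^ N`. -/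
noncomputable def hilbertSeriesQuot {m : ℕ} (d : Fin m → ℕ) (N : ℕ) : PowerSeries ℤ :=
  (∏ i, (1 - PowerSeries.X ^ d i)) * (PowerSeries.invOneSubPow ℤ N : PowerSeries ℤ)

/-! ## Macaulay matrices -/

/-- Rows of the degree-`D` Macaulay matrix of polynomials `h i` of degrees `d i`: the pairs
`(i, t)`, standing for `t * h i`, with `deg t + d i ≤ D`. -/
abbrev MacaulayRow (σ : Type) {m : ℕ} (d : Fin m → ℕ) (D : ℕ) : Type :=
  {p : Fin m × (σ →₀ ℕ) // p.2.degree + d p.1 ≤ D}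

/-- Columns of the degree-`D` Macaulay matrix: the monomials of degree at most `D`. -/
abbrev MacaulayCol (σ : Type) (D : ℕ) : Type :=
  {t : σ →₀ ℕ // t.degree ≤ D}

/-- The degree-`D` Macaulay matrix, with its rows listed in the order `e`. -/
noncomputable def macaulayMatrix {σ : Type} {K : Type u} [Field K] {m k : ℕ}
    (h : Fin m → MvPolynomial σ K) (d : Fin m → ℕ) (D : ℕ) (e : Fin k ≃ MacaulayRow σ d D) :
    Matrix (Fin k) (MacaulayCol σ D) K :=
  fun r t => coeff t.1 (monomial (e r).1.2 1 * h (e r).1.1)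

/-- The columns are in descending order. -/
def colLeft {σ : Type} (ord : MonomialOrder.{0, v} σ) {D : ℕ} (a b : MacaulayCol σ D) : Prop :=
  ord.toSyn b.1 < ord.toSyn a.1

/-- The polynomials given by the nonzero rows of a matrix with columns `MacaulayCol σ D`. -/
def rowPolys {σ : Type} {K : Type u} [Field K] {k D : ℕ}
    (A : Matrix (Fin k) (MacaulayCol σ D) K) : Set (MvPolynomial σ K) :=
  {g | g ≠ 0 ∧ g.totalDegree ≤ D ∧ ∃ r, ∀ t : MacaulayCol σ D, coeff t.1 g = A r t}

/-- Positions of the coefficients of polynomials of degrees `d i`. -/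
abbrev CoeffIdx (σ : Type) {m : ℕ} (d : Fin m → ℕ) : Type :=
  (i : Fin m) × {t : σ →₀ ℕ // t.degree ≤ d i}

/-- The list of all coefficients of the polynomials `f i`. -/
def coeffList {σ : Type} {K : Type u} [Field K] {m : ℕ} (d : Fin m → ℕ)
    (f : Fin m → MvPolynomial σ K) : CoeffIdx σ d → K :=
  fun p => coeff p.2.1 (f p.1)

set_option linter.unusedSectionVars false


/-! ## Hilbert functions of homogeneous ideals -/

section Hilbert

variable {σ : Type} {K : Type u} [Field K]

/-! Regularity. Everything rests on the exact sequence 0 → S/(I : f)(-a) → S/I → S/(I + (f)) → 0 for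
a form f of degree a (`hilbertFn_eq_sup_add_colon`). Along a D-regular sequence it shows that the
Hilbert function equals the coefficients of ∏(1 - z^{d_i})/(1 - z)^N below degree D and is at least
the coefficient in degree D (`IsDRegular.hilbertFn_eq`). For N forms in N variables the series is
∏(1 + ... + z^{d_i - 1}), positive exactly up to s = ∑(d_i - 1). For m = n this pins down
d_reg(F^top) = s + 1. As R'/(F^h, y) ≅ R/(F^top), a squeeze between two nonnegative power series
(`hilbertSeries_eq_of_sup_span_singleton`) forces F^h to have the Hilbert series of a complete
intersection; its Hilbert function then increases strictly up to s and is constant from there on.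
For m > n it suffices that the Hilbert function is positive below the generalized degree of
regularity, because a zero value would persist.

Gröbner degrees. Let s be a minimal leading monomial of ⟨F^h⟩ of degree above both degrees of
regularity (`IsMinimalLead.degree_le`). If y does not divide s, a proper divisor of s is already a
leading monomial, since every monomial of degree d_reg(F^top) lies in ⟨F^h⟩ + (y). If y divides s, a
form with lead s is a multiple y * h, and constancy of the Hilbert function makes multiplication by
y injective there, so h lies in the ideal and its lead s/y contradicts minimality.

Complexity. Elimination is recursive on blocks of size 2^k with four half-size calls and a bounded
number of matrix products per level, so ω > 2 makes the cost O(2^{kω}). A computation is described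
in continuation-passing form (`Doable`): the pivot positions are known on each branch and steer the
later operations. The rows are treated in m batches, one per polynomial; a batch and the pivot rows
so far make at most twice as many rows as there are columns (`doable_rows`).

From rows to bases. The row space contains every form of ⟨F^h⟩ of degree at most D, and the first
nonzero entry of an element of the row space stands in a pivot column, so the rows realize all
minimal leads (`isGroebnerBasis_rowPolys`). Reducedness makes the rows homogeneous, and for forms
setting y = 1 respects leading monomials (`IsGroebnerBasis.dehomog`). -/

theorem homogeneousComponent_mul_of_isHomogeneous {f : MvPolynomial σ K} {a : ℕ}
    (hf : f.IsHomogeneous a) (h : MvPolynomial σ K) (n : ℕ) :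
    homogeneousComponent n (h * f) = if a ≤ n then homogeneousComponent (n - a) h * f else 0 := by
  have key : ∀ i, homogeneousComponent n (homogeneousComponent i h * f) =
      if n = i + a then homogeneousComponent i h * f else 0 := fun i =>
    homogeneousComponent_of_mem ((homogeneousComponent_isHomogeneous i h).mul hf)
  conv_lhs => rw [← sum_homogeneousComponent h, Finset.sum_mul, map_sum]
  simp_rw [key]
  split_ifs with han
  · have : ∀ i, (n = i + a) ↔ (i = n - a) := fun i => by omega
    simp_rw [this, Finset.sum_ite_eq', Finset.mem_range]
    split_ifs with h1
    · rfl
    · rw [homogeneousComponent_eq_zero _ _ (by omega), zero_mul]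
  · exact Finset.sum_eq_zero fun i _ => if_neg (by omega)

/-- An ideal that contains the homogeneous components of its elements. -/
def HasHomogeneousComponents (I : Ideal (MvPolynomial σ K)) : Prop :=
  ∀ f ∈ I, ∀ n, homogeneousComponent n f ∈ I

theorem hasHomogeneousComponents_span {s : Set (MvPolynomial σ K)}
    (hs : ∀ f ∈ s, ∃ a, f.IsHomogeneous a) : HasHomogeneousComponents (Ideal.span s) := by
  intro f hf n
  induction hf using Submodule.span_induction generalizing n with
  | mem x hx =>
    obtain ⟨a, ha⟩ := hs x hx
    rw [homogeneousComponent_of_mem ha]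
    split_ifs
    · exact Ideal.subset_span hx
    · exact zero_mem _
  | zero => simp
  | add x y _ _ hx hy => rw [map_add]; exact add_mem (hx n) (hy n)
  | smul c x _ hx =>
    rw [smul_eq_mul, ← sum_homogeneousComponent c, Finset.sum_mul, map_sum]
    refine Ideal.sum_mem _ fun i _ => ?_
    rw [mul_comm, homogeneousComponent_mul_of_isHomogeneous (homogeneousComponent_isHomogeneous i c)]
    split_ifs
    · exact Ideal.mul_mem_right _ _ (hx _)
    · exact zero_mem _

/-- The part of degree e + a of c * f is the degree-e part of c times f, so the cofactor may be
taken homogeneous. This identifies the kernel in the exact sequence below. -/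
theorem mem_sup_span_singleton_iff {I : Ideal (MvPolynomial σ K)} (hI : HasHomogeneousComponents I)
    {f : MvPolynomial σ K} {a e : ℕ} (hf : f.IsHomogeneous a) {g : MvPolynomial σ K}
    (hg : g.IsHomogeneous (e + a)) :
    g ∈ I ⊔ Ideal.span {f} ↔ ∃ h : MvPolynomial σ K, h.IsHomogeneous e ∧ g - h * f ∈ I := by
  constructor
  · intro h
    obtain ⟨i, hi, j, hj, rfl⟩ := Submodule.mem_sup.1 h
    obtain ⟨c, rfl⟩ := Ideal.mem_span_singleton'.1 hj
    refine ⟨homogeneousComponent e c, homogeneousComponent_isHomogeneous _ _, ?_⟩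
    have h1 := homogeneousComponent_eq_self hg
    rw [map_add, homogeneousComponent_mul_of_isHomogeneous hf, if_pos (by omega),
      Nat.add_sub_cancel] at h1
    rw [← h1, add_sub_cancel_right]
    exact hI _ hi _
  · rintro ⟨h, -, hh⟩
    rw [← sub_add_cancel g (h * f)]
    exact add_mem (Ideal.mem_sup_left hh)
      (Ideal.mem_sup_right (Ideal.mem_span_singleton'.2 ⟨h, rfl⟩))

theorem mem_sup_span_singleton_iff_of_lt {I : Ideal (MvPolynomial σ K)}
    (hI : HasHomogeneousComponents I) {f : MvPolynomial σ K} {a e : ℕ} (hf : f.IsHomogeneous a)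
    (hea : e < a) {g : MvPolynomial σ K} (hg : g.IsHomogeneous e) :
    g ∈ I ⊔ Ideal.span {f} ↔ g ∈ I := by
  refine ⟨fun h => ?_, fun h => Ideal.mem_sup_left h⟩
  obtain ⟨i, hi, j, hj, rfl⟩ := Submodule.mem_sup.1 h
  obtain ⟨c, rfl⟩ := Ideal.mem_span_singleton'.1 hj
  have h1 := homogeneousComponent_eq_self hg
  rw [map_add, homogeneousComponent_mul_of_isHomogeneous hf, if_neg (by omega), add_zero] at h1
  rw [← h1]
  exact hI _ hi _

/-- The degree-`d` part of an ideal, as a subspace of the space of forms of degree `d`. -/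
noncomputable abbrev idealPart (I : Ideal (MvPolynomial σ K)) (d : ℕ) : Submodule K (homogeneousSubmodule σ K d) :=
  (I.restrictScalars K).comap (homogeneousSubmodule σ K d).subtype

theorem hilbertFn_congr {I J : Ideal (MvPolynomial σ K)} {d : ℕ}
    (h : ∀ g : MvPolynomial σ K, g.IsHomogeneous d → (g ∈ I ↔ g ∈ J)) :
    hilbertFn I d = hilbertFn J d := by
  have : idealPart I d = idealPart J d := by
    ext g
    exact h g.1 g.2
  unfold hilbertFn
  rw [show (I.restrictScalars K).comap (homogeneousSubmodule σ K d).subtype = _ from this]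

theorem exists_le_degree_eq (t : σ →₀ ℕ) {d : ℕ} (h : d ≤ t.degree) : ∃ s ≤ t, s.degree = d := by
  obtain ⟨e, he⟩ : ∃ e, t.degree = e := ⟨_, rfl⟩
  rw [he] at h
  induction e, h using Nat.le_induction generalizing t with
  | base => exact ⟨t, le_rfl, he⟩
  | succ e _ ih =>
    have hne : t ≠ 0 := by rintro rfl; simp at he
    obtain ⟨i, hi⟩ := Finsupp.ne_iff.1 hne
    have hle : Finsupp.single i 1 ≤ t := Finsupp.single_le_iff.2 (Nat.pos_of_ne_zero hi)
    obtain ⟨s, hs, hsd⟩ := ih (t - Finsupp.single i 1) (by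
      have := congrArg Finsupp.degree (tsub_add_cancel_of_le hle)
      rw [map_add, Finsupp.degree_single] at this
      omega)
    exact ⟨s, hs.trans tsub_le_self, hsd⟩

/-- On an infinite-dimensional space `Module.finrank` takes the default value 0; this instance makes
the dimension counts meaningful. -/
instance finite_homogeneousSubmodule [Finite σ] (d : ℕ) : Module.Finite K (homogeneousSubmodule σ K d) :=
  Module.Finite.iff_fg.2 (homogeneousSubmodule_fg (σ := σ) (R := K) d)

variable [Finite σ]

theorem hilbertFn_le {I J : Ideal (MvPolynomial σ K)} {d : ℕ}
    (h : ∀ g : MvPolynomial σ K, g.IsHomogeneous d → g ∈ I → g ∈ J) :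
    hilbertFn J d ≤ hilbertFn I d := by
  have hle : idealPart I d ≤ idealPart J d := fun g hg => h g.1 g.2 hg
  exact LinearMap.finrank_le_finrank_of_surjective (f := Submodule.factor hle)
    (Submodule.factor_surjective hle)

theorem mem_of_hilbertFn_eq {I J : Ideal (MvPolynomial σ K)} {d : ℕ}
    (h : ∀ g : MvPolynomial σ K, g.IsHomogeneous d → g ∈ I → g ∈ J)
    (he : hilbertFn I d ≤ hilbertFn J d) {g : MvPolynomial σ K} (hg : g.IsHomogeneous d)
    (hgJ : g ∈ J) : g ∈ I := by
  have hle : idealPart I d ≤ idealPart J d := fun g hg => h g.1 g.2 hg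
  have h1 := Submodule.finrank_quotient_add_finrank (idealPart I d)
  have h2 := Submodule.finrank_quotient_add_finrank (idealPart J d)
  have he' : Module.finrank K (homogeneousSubmodule σ K d ⧸ idealPart I d) ≤
    Module.finrank K (homogeneousSubmodule σ K d ⧸ idealPart J d) := he
  have h3 := Submodule.eq_of_le_of_finrank_le hle (by omega)
  have : (⟨g, hg⟩ : homogeneousSubmodule σ K d) ∈ idealPart J d := hgJ
  rw [← h3] at this
  exact this

theorem hilbertFn_eq_zero_iff {I : Ideal (MvPolynomial σ K)} {d : ℕ} :
    hilbertFn I d = 0 ↔ ∀ g : MvPolynomial σ K, g.IsHomogeneous d → g ∈ I := by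
  have h2 := Submodule.finrank_quotient_add_finrank (idealPart I d)
  constructor
  · intro h g hg
    have h0 : Module.finrank K (homogeneousSubmodule σ K d ⧸ idealPart I d) = 0 := h
    have h3 : idealPart I d = ⊤ := Submodule.eq_top_of_finrank_eq (by omega)
    have : (⟨g, hg⟩ : homogeneousSubmodule σ K d) ∈ idealPart I d := h3 ▸ Submodule.mem_top
    exact this
  · intro h
    have h3 : idealPart I d = ⊤ := by
      ext g
      simpa using! h g.1 g.2
    have : Module.finrank K (homogeneousSubmodule σ K d ⧸ idealPart I d) = 0 := by
      rw [h3, finrank_top] at h2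
      rw [h3]
      omega
    exact this

/-- Multiplication by f maps forms of degree e to S/I with kernel I : f, and its image is the kernel
of S/I → S/(I + (f)); rank-nullity for both maps gives the count. -/
theorem hilbertFn_eq_sup_add_colon {I : Ideal (MvPolynomial σ K)} (hI : HasHomogeneousComponents I)
    {f : MvPolynomial σ K} {a : ℕ} (hf : f.IsHomogeneous a) (e : ℕ) :
    hilbertFn I (e + a) = hilbertFn (I ⊔ Ideal.span {f}) (e + a) + hilbertFn (I.colon {f}) e := by
  have hle : idealPart I (e + a) ≤ idealPart (I ⊔ Ideal.span {f}) (e + a) :=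
    fun g hg => Ideal.mem_sup_left hg
  let g := Submodule.factor hle
  have hg : Function.Surjective g := Submodule.factor_surjective hle
  let μ : homogeneousSubmodule σ K e →ₗ[K] homogeneousSubmodule σ K (e + a) :=
    LinearMap.codRestrict _ ((LinearMap.mulRight K f).comp (homogeneousSubmodule σ K e).subtype)
      fun h => IsHomogeneous.mul h.2 hf
  let φ := (idealPart I (e + a)).mkQ.comp μ
  have hker : LinearMap.ker φ = idealPart (I.colon {f}) e := by
    ext h
    simp only [φ, LinearMap.mem_ker, LinearMap.comp_apply, Submodule.mkQ_apply,
      Submodule.Quotient.mk_eq_zero]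
    change h.1 * f ∈ I ↔ h.1 ∈ I.colon {f}
    rw [Submodule.mem_colon_singleton, smul_eq_mul]
  have hrange : LinearMap.range φ = LinearMap.ker g := by
    ext x
    obtain ⟨x, rfl⟩ := Submodule.Quotient.mk_surjective _ x
    have h1 : Submodule.Quotient.mk x ∈ LinearMap.ker g ↔ x.1 ∈ I ⊔ Ideal.span {f} := by
      rw [LinearMap.mem_ker]
      change Submodule.Quotient.mk x = 0 ↔ _
      rw [Submodule.Quotient.mk_eq_zero]
      rfl
    rw [h1, mem_sup_span_singleton_iff hI hf x.2]
    constructor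
    · rintro ⟨h, hh⟩
      refine ⟨h.1, h.2, ?_⟩
      have := (Submodule.Quotient.eq _).1 hh.symm
      exact this
    · rintro ⟨h, hh, hm⟩
      exact ⟨⟨h, hh⟩, ((Submodule.Quotient.eq (idealPart I (e + a))).2 hm).symm⟩
  have h1 := LinearMap.finrank_range_add_finrank_ker g
  have h2 := (LinearMap.quotKerEquivRange φ).finrank_eq
  rw [LinearMap.range_eq_top.2 hg, finrank_top, ← hrange, ← h2, hker] at h1
  exact h1.symm

theorem hilbertFn_sup_of_lt {I : Ideal (MvPolynomial σ K)} (hI : HasHomogeneousComponents I)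
    {f : MvPolynomial σ K} {a e : ℕ} (hf : f.IsHomogeneous a) (hea : e < a) :
    hilbertFn (I ⊔ Ideal.span {f}) e = hilbertFn I e :=
  hilbertFn_congr fun _ hg => mem_sup_span_singleton_iff_of_lt hI hf hea hg

theorem hilbertFn_colon_le {I : Ideal (MvPolynomial σ K)} (f : MvPolynomial σ K) (e : ℕ) :
    hilbertFn (I.colon {f}) e ≤ hilbertFn I e :=
  hilbertFn_le fun g _ hgI => by
    rw [Submodule.mem_colon_singleton, smul_eq_mul]
    exact Ideal.mul_mem_right _ _ hgI

/-- Each monomial of degree e is a multiple of one of degree d, which already lies in I. -/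
theorem hilbertFn_eq_zero_of_le {I : Ideal (MvPolynomial σ K)} {d e : ℕ} (hde : d ≤ e)
    (h : hilbertFn I d = 0) : hilbertFn I e = 0 := by
  rw [hilbertFn_eq_zero_iff] at h ⊢
  intro g hg
  rw [g.as_sum]
  refine Ideal.sum_mem _ fun t ht => ?_
  have htd : t.degree = e := by
    by_contra hne
    exact (mem_support_iff.1 ht) (hg.coeff_eq_zero hne)
  obtain ⟨s, hs, hsd⟩ := exists_le_degree_eq t (htd ▸ hde)
  have : monomial t (coeff t g) = monomial (t - s) (coeff t g) * monomial s 1 := by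
    rw [monomial_mul, mul_one, tsub_add_cancel_of_le hs]
  rw [this]
  exact Ideal.mul_mem_left _ _ (h _ (isHomogeneous_monomial _ hsd))

end Hilbert

/-! ### Hilbert series of regular and arbitrary sequences of forms -/

section HilbertSeries

variable {σ : Type} {K : Type u} [Field K]

/-- The Hilbert series of the quotient by a homogeneous ideal. -/
noncomputable def hilbertSeries (I : Ideal (MvPolynomial σ K)) : PowerSeries ℤ :=
  PowerSeries.mk fun e => (hilbertFn I e : ℤ)

@[simp]
theorem coeff_hilbertSeries (I : Ideal (MvPolynomial σ K)) (e : ℕ) :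
    PowerSeries.coeff e (hilbertSeries I) = hilbertFn I e :=
  PowerSeries.coeff_mk _ _

theorem hilbertFn_bot [Fintype σ] (e : ℕ) :
    hilbertFn (⊥ : Ideal (MvPolynomial σ K)) e = (Fintype.card σ).multichoose e := by
  classical
  let S := {t : σ →₀ ℕ // t ∈ (Finset.univ : Finset σ).finsuppAntidiag e}
  have hS : ∀ t : σ →₀ ℕ, t ∈ (Finset.univ : Finset σ).finsuppAntidiag e ↔ t.degree = e := by
    intro t
    rw [Finset.mem_finsuppAntidiag, Finsupp.degree_eq_sum]
    simp
  let φ : homogeneousSubmodule σ K e →ₗ[K] (S → K) :=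
    { toFun := fun g t => coeff t.1 g.1
      map_add' := fun _ _ => by ext; simp
      map_smul' := fun _ _ => by ext; simp }
  have hinj : Function.Injective φ := by
    intro g h hgh
    ext t
    by_cases ht : t.degree = e
    · exact congrFun hgh ⟨t, (hS t).2 ht⟩
    · rw [IsHomogeneous.coeff_eq_zero g.2 ht, IsHomogeneous.coeff_eq_zero h.2 ht]
  have hsurj : Function.Surjective φ := by
    intro w
    refine ⟨⟨∑ t : S, monomial t.1 (w t), Submodule.sum_mem _ fun t _ =>
      isHomogeneous_monomial _ ((hS _).1 t.2)⟩, ?_⟩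
    ext t
    change coeff t.1 (∑ t : S, monomial t.1 (w t)) = w t
    simp only [coeff_sum, coeff_monomial, Subtype.ext_iff.symm]
    rw [Finset.sum_eq_single t (fun s _ hs => if_neg hs) (by simp), if_pos rfl]
  have h1 := (LinearEquiv.ofBijective φ ⟨hinj, hsurj⟩).finrank_eq
  have h0 : idealPart (⊥ : Ideal (MvPolynomial σ K)) e = ⊥ := by
    ext g
    change g.1 ∈ (⊥ : Ideal (MvPolynomial σ K)) ↔ _
    simp
  have h2 := Submodule.finrank_quotient_add_finrank (idealPart (⊥ : Ideal (MvPolynomial σ K)) e)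
  have h3 : hilbertFn (⊥ : Ideal (MvPolynomial σ K)) e =
    Module.finrank K (homogeneousSubmodule σ K e ⧸ idealPart ⊥ e) := rfl
  have h4 : Module.finrank K (idealPart (⊥ : Ideal (MvPolynomial σ K)) e) = 0 := by
    rw [h0, finrank_bot]
  rw [Module.finrank_fintype_fun_eq_card, Fintype.card_coe,
    Finset.card_finsuppAntidiag_nat_eq_multichoose, Finset.card_univ] at h1
  omega

theorem hilbertSeries_bot [Fintype σ] :
    hilbertSeries (⊥ : Ideal (MvPolynomial σ K)) =
      (PowerSeries.invOneSubPow ℤ (Fintype.card σ) : PowerSeries ℤ) := by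
  ext e
  rw [coeff_hilbertSeries, hilbertFn_bot]
  cases h : Fintype.card σ with
  | zero =>
    rw [PowerSeries.invOneSubPow_zero]
    cases e <;> simp [PowerSeries.coeff_one]
  | succ k =>
    rw [PowerSeries.invOneSubPow_val_succ_eq_mk_add_choose, PowerSeries.coeff_mk,
      Nat.multichoose_eq, show k + 1 + e - 1 = k + e by omega,
      ← Nat.choose_symm (Nat.le_add_left e k), Nat.add_sub_cancel]

theorem hilbertSeries_eq_sup_add_colon [Finite σ] {I : Ideal (MvPolynomial σ K)}
    (hI : HasHomogeneousComponents I) {f : MvPolynomial σ K} {a : ℕ} (hf : f.IsHomogeneous a) :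
    hilbertSeries I =
      hilbertSeries (I ⊔ Ideal.span {f}) + PowerSeries.X ^ a * hilbertSeries (I.colon {f}) := by
  ext e
  rw [map_add, PowerSeries.coeff_X_pow_mul']
  simp only [coeff_hilbertSeries]
  split_ifs with h
  · obtain ⟨b, rfl⟩ := Nat.exists_eq_add_of_le' h
    rw [hilbertFn_eq_sup_add_colon hI hf, Nat.add_sub_cancel]
    push_cast
    rfl
  · rw [hilbertFn_sup_of_lt hI hf (by omega), add_zero]

theorem coeff_one_sub_X_pow_mul (a e : ℕ) (P : PowerSeries ℤ) :
    PowerSeries.coeff e ((1 - PowerSeries.X ^ a) * P) =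
      PowerSeries.coeff e P - if a ≤ e then PowerSeries.coeff (e - a) P else 0 := by
  rw [sub_mul, one_mul, map_sub, PowerSeries.coeff_X_pow_mul']

theorem span_range_fin_succ {m : ℕ} (f : Fin (m + 1) → MvPolynomial σ K) :
    Ideal.span (Set.range f) =
      Ideal.span (Set.range fun i : Fin m => f i.castSucc) ⊔ Ideal.span {f (Fin.last m)} := by
  rw [← Ideal.span_union]
  congr 1
  ext g
  simp only [Set.mem_range, Set.mem_union, Set.mem_singleton_iff, Fin.exists_fin_succ', eq_comm]

theorem IsDRegular.castLE {m k : ℕ} {f : Fin m → MvPolynomial σ K} {D : ℕ∞} (h : IsDRegular f D)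
    (hk : k ≤ m) : IsDRegular (fun i => f (Fin.castLE hk i)) D := by
  intro i e g hg he
  have : (fun i => f (Fin.castLE hk i)) '' {j | j < i} = f '' {j | j < Fin.castLE hk i} := by
    ext x
    constructor
    · rintro ⟨j, hj, rfl⟩
      exact ⟨Fin.castLE hk j, hj, rfl⟩
    · rintro ⟨j, hj, rfl⟩
      exact ⟨⟨j, lt_trans hj i.2⟩, hj, rfl⟩
  rw [this]
  exact h _ e g hg he

theorem hilbertSeriesQuot_succ {m : ℕ} (d : Fin (m + 1) → ℕ) (N : ℕ) :
    hilbertSeriesQuot d N = (1 - PowerSeries.X ^ d (Fin.last m)) *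
      hilbertSeriesQuot (fun i => d i.castSucc) N := by
  rw [hilbertSeriesQuot, hilbertSeriesQuot, Fin.prod_univ_castSucc]
  ring

/-- Induction on the number of forms. Below degree D, regularity says that I : φ agrees with I in
degree e - a, so the exact sequence becomes multiplication by 1 - z^a. In degree D only H(I : φ) ≤
H(I) remains, which still gives the inequality. -/
theorem IsDRegular.hilbertFn_eq [Fintype σ] {D : ℕ∞} {m : ℕ} {f : Fin m → MvPolynomial σ K}
    (d : Fin m → ℕ) (hf : ∀ i, (f i).IsHomogeneous (d i)) (hne : ∀ i, f i ≠ 0)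
    (hd : ∀ i, 0 < d i) (h : IsDRegular f D) :
    (∀ e : ℕ, (e : ℕ∞) < D → (hilbertFn (Ideal.span (Set.range f)) e : ℤ) =
      PowerSeries.coeff e (hilbertSeriesQuot d (Fintype.card σ))) ∧
    (∀ e : ℕ, (e : ℕ∞) ≤ D → PowerSeries.coeff e (hilbertSeriesQuot d (Fintype.card σ)) ≤
      (hilbertFn (Ideal.span (Set.range f)) e : ℤ)) := by
  induction m with
  | zero =>
    have : (hilbertSeries (Ideal.span (Set.range f))) =
        hilbertSeriesQuot d (Fintype.card σ) := by
      rw [Set.range_eq_empty, Ideal.span_empty, hilbertSeries_bot, hilbertSeriesQuot]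
      simp
    rw [← this]
    simp
  | succ m ih =>
    obtain ⟨ih1, ih2⟩ := ih (fun i => d i.castSucc) (fun i => hf i.castSucc)
      (fun i => hne i.castSucc) (fun i => hd i.castSucc) (h.castLE (Nat.le_succ m))
    set I := Ideal.span (Set.range fun i : Fin m => f i.castSucc) with hIdef
    have hI : HasHomogeneousComponents I :=
      hasHomogeneousComponents_span (by rintro _ ⟨i, rfl⟩; exact ⟨_, hf i.castSucc⟩)
    set a := d (Fin.last m) with ha
    have ha0 : 0 < a := hd _
    set φ := f (Fin.last m)
    have hφ : φ.IsHomogeneous a := hf _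
    have hs := hilbertSeries_eq_sup_add_colon hI hφ
    rw [← span_range_fin_succ] at hs
    have hc : ∀ e, (hilbertFn I e : ℤ) = hilbertFn (Ideal.span (Set.range f)) e +
        if a ≤ e then (hilbertFn (I.colon {φ}) (e - a) : ℤ) else 0 := by
      intro e
      have := congrArg (PowerSeries.coeff e) hs
      rwa [map_add, PowerSeries.coeff_X_pow_mul', coeff_hilbertSeries, coeff_hilbertSeries,
        coeff_hilbertSeries] at this
    have himg : f '' {j | j < Fin.last m} = Set.range fun i : Fin m => f i.castSucc := by
      ext x
      constructor
      · rintro ⟨j, hj, rfl⟩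
        exact ⟨j.castPred hj.ne, by simp⟩
      · rintro ⟨j, rfl⟩
        exact ⟨_, Fin.castSucc_lt_last j, rfl⟩
    constructor
    · intro e he
      rw [hilbertSeriesQuot_succ, coeff_one_sub_X_pow_mul, ← ih1 e he, hc e]
      split_ifs with hae
      · have h1 : ((e - a : ℕ) : ℕ∞) < D := lt_of_le_of_lt (by exact_mod_cast Nat.sub_le e a) he
        rw [← ih1 _ h1]
        have : hilbertFn I (e - a) ≤ hilbertFn (I.colon {φ}) (e - a) := by
          refine hilbertFn_le fun g hg hgc => ?_
          rw [Submodule.mem_colon_singleton, smul_eq_mul] at hgc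
          have := h (Fin.last m) (e - a) g hg
          rw [himg] at this
          refine this ?_ hgc
          rw [(hf (Fin.last m)).totalDegree (hne _), ← ha, Nat.sub_add_cancel hae]
          exact he
        have := le_antisymm this (hilbertFn_colon_le φ (e - a))
        rw [this]
        ring
      · ring
    · intro e he
      have h2 := ih2 e he
      rw [hilbertSeriesQuot_succ, coeff_one_sub_X_pow_mul]
      rw [hc e] at h2
      split_ifs at h2 ⊢ with hae
      · have h1 : ((e - a : ℕ) : ℕ∞) < D := by
          refine lt_of_lt_of_le ?_ he
          exact_mod_cast Nat.sub_lt (by omega) ha0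
        have h3 := hilbertFn_colon_le (I := I) φ (e - a)
        have h4 := ih1 _ h1
        have h3' : (hilbertFn (I.colon {φ}) (e - a) : ℤ) ≤ hilbertFn I (e - a) := by
          exact_mod_cast h3
        linarith
      · linarith

/-- All coefficients are nonnegative. -/
def NonnegCoeffs (P : PowerSeries ℤ) : Prop := ∀ e, 0 ≤ PowerSeries.coeff e P

theorem NonnegCoeffs.add {P Q : PowerSeries ℤ} (hP : NonnegCoeffs P) (hQ : NonnegCoeffs Q) :
    NonnegCoeffs (P + Q) := fun e => by
  rw [map_add]
  exact add_nonneg (hP e) (hQ e)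

theorem NonnegCoeffs.mul {P Q : PowerSeries ℤ} (hP : NonnegCoeffs P) (hQ : NonnegCoeffs Q) :
    NonnegCoeffs (P * Q) := fun e => by
  rw [PowerSeries.coeff_mul]
  exact Finset.sum_nonneg fun _ _ => mul_nonneg (hP _) (hQ _)

theorem nonnegCoeffs_X_pow (a : ℕ) : NonnegCoeffs (PowerSeries.X ^ a) := fun e => by
  rw [PowerSeries.coeff_X_pow]
  split_ifs <;> simp

/-- The power series `1 / (1 - z ^ a)`. -/
def geomPow (a : ℕ) : PowerSeries ℤ := PowerSeries.mk fun e => if a ∣ e then 1 else 0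

theorem nonnegCoeffs_geomPow (a : ℕ) : NonnegCoeffs (geomPow a) := fun e => by
  rw [geomPow, PowerSeries.coeff_mk]
  split_ifs <;> simp

theorem one_sub_X_pow_mul_geomPow {a : ℕ} (ha : 0 < a) :
    (1 - PowerSeries.X ^ a) * geomPow a = 1 := by
  ext e
  rw [coeff_one_sub_X_pow_mul, geomPow, PowerSeries.coeff_mk, PowerSeries.coeff_mk,
    PowerSeries.coeff_one]
  by_cases h : a ≤ e
  · rw [if_pos h, if_neg (by omega : e ≠ 0)]
    have := Nat.dvd_sub_self_right (m := e) (n := a)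
    have h2 : a ∣ e - a ↔ a ∣ e := by
      rw [Nat.dvd_sub_iff_left h (dvd_refl a)]
    simp [h2]
  · rw [if_neg h, sub_zero]
    rcases Nat.eq_zero_or_pos e with rfl | he
    · simp
    · rw [if_neg (fun hd => h (Nat.le_of_dvd he hd)), if_neg he.ne']

theorem nonnegCoeffs_prod_geomPow {m : ℕ} (d : Fin m → ℕ) : NonnegCoeffs (∏ i, geomPow (d i)) := by
  refine Finset.prod_induction _ NonnegCoeffs (fun _ _ => NonnegCoeffs.mul) ?_
    fun _ _ => nonnegCoeffs_geomPow _
  simpa using nonnegCoeffs_X_pow 0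

/-- By the exact sequence the difference equals z^a/(1 - z^a) · (H(I) - H(I : f)), and I ⊆ I : f. -/
theorem nonnegCoeffs_geomPow_mul_hilbertSeries_sup_sub [Finite σ] {I : Ideal (MvPolynomial σ K)}
    (hI : HasHomogeneousComponents I) {f : MvPolynomial σ K} {a : ℕ} (hf : f.IsHomogeneous a)
    (ha : 0 < a) :
    NonnegCoeffs (geomPow a * hilbertSeries (I ⊔ Ideal.span {f}) - hilbertSeries I) := by
  have h1 := hilbertSeries_eq_sup_add_colon hI hf
  have h2 : geomPow a * hilbertSeries (I ⊔ Ideal.span {f}) - hilbertSeries I =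
      geomPow a * (PowerSeries.X ^ a * (hilbertSeries I - hilbertSeries (I.colon {f}))) := by
    linear_combination (-geomPow a) * h1 + hilbertSeries I * one_sub_X_pow_mul_geomPow ha
  rw [h2]
  refine (nonnegCoeffs_geomPow a).mul ((nonnegCoeffs_X_pow a).mul fun e => ?_)
  rw [map_sub, coeff_hilbertSeries, coeff_hilbertSeries, sub_nonneg]
  exact_mod_cast hilbertFn_colon_le f e

/-- Adding the forms one at a time, the previous inequality telescopes after multiplication by the
remaining nonnegative factors. No regularity is needed: a complete intersection is extremal in this
sense. -/
theorem nonnegCoeffs_prod_geomPow_mul_hilbertSeries_sub [Finite σ] {m : ℕ}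
    {f : Fin m → MvPolynomial σ K} (d : Fin m → ℕ) (hf : ∀ i, (f i).IsHomogeneous (d i))
    (hd : ∀ i, 0 < d i) :
    NonnegCoeffs ((∏ i, geomPow (d i)) * hilbertSeries (Ideal.span (Set.range f)) -
      hilbertSeries (⊥ : Ideal (MvPolynomial σ K))) := by
  induction m with
  | zero =>
    rw [Set.range_eq_empty, Ideal.span_empty]
    intro e
    simp
  | succ m ih =>
    have ih' := ih (fun i => d i.castSucc) (fun i => hf i.castSucc) (fun i => hd i.castSucc)
    have hI : HasHomogeneousComponents (Ideal.span (Set.range fun i : Fin m => f i.castSucc)) :=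
      hasHomogeneousComponents_span (by rintro _ ⟨i, rfl⟩; exact ⟨_, hf i.castSucc⟩)
    have h1 := (nonnegCoeffs_prod_geomPow fun i : Fin m => d i.castSucc).mul
      (nonnegCoeffs_geomPow_mul_hilbertSeries_sup_sub hI (hf (Fin.last m)) (hd _))
    have h2 := h1.add ih'
    rw [span_range_fin_succ, Fin.prod_univ_castSucc]
    convert h2 using 1
    ring

/-- If adding one more form to a sequence of forms leads to the Hilbert series of a complete
intersection, then the sequence already has the Hilbert series of a complete intersection. -/
theorem hilbertSeries_eq_of_sup_span_singleton [Finite σ] {m : ℕ}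
    {f : Fin m → MvPolynomial σ K} (d : Fin m → ℕ) (hf : ∀ i, (f i).IsHomogeneous (d i))
    (hd : ∀ i, 0 < d i) {y : MvPolynomial σ K} {a : ℕ} (hy : y.IsHomogeneous a) (ha : 0 < a)
    (h : hilbertSeries (Ideal.span (Set.range f) ⊔ Ideal.span {y}) =
      (1 - PowerSeries.X ^ a) * (∏ i, (1 - PowerSeries.X ^ d i)) * hilbertSeries (⊥ : Ideal (MvPolynomial σ K))) :
    hilbertSeries (Ideal.span (Set.range f)) =
      (∏ i, (1 - PowerSeries.X ^ d i)) * hilbertSeries (⊥ : Ideal (MvPolynomial σ K)) := by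
  have hI : HasHomogeneousComponents (Ideal.span (Set.range f)) :=
    hasHomogeneousComponents_span (by rintro _ ⟨i, rfl⟩; exact ⟨_, hf i⟩)
  have hG : (∏ i, (1 - PowerSeries.X ^ d i)) * (∏ i, geomPow (d i)) = 1 := by
    rw [← Finset.prod_mul_distrib]
    exact Finset.prod_eq_one fun i _ => one_sub_X_pow_mul_geomPow (hd i)
  have h1 := nonnegCoeffs_prod_geomPow_mul_hilbertSeries_sub d hf hd
  have h2 := (nonnegCoeffs_prod_geomPow d).mul
    (nonnegCoeffs_geomPow_mul_hilbertSeries_sup_sub hI hy ha)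
  -- By hypothesis the two factors turn the series of the ideal with y into the series of the whole
  -- ring. Hence the nonnegative series of `h2` is the negative of the nonnegative series of `h1`,
  -- and both vanish.
  have h3 : (∏ i, geomPow (d i)) * (geomPow a *
      hilbertSeries (Ideal.span (Set.range f) ⊔ Ideal.span {y}) -
        hilbertSeries (Ideal.span (Set.range f))) =
      -((∏ i, geomPow (d i)) * hilbertSeries (Ideal.span (Set.range f)) -
      hilbertSeries (⊥ : Ideal (MvPolynomial σ K))) := by
    rw [h]
    linear_combination ((∏ i, (1 - PowerSeries.X ^ d i)) * (∏ i, geomPow (d i)) *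
      hilbertSeries (⊥ : Ideal (MvPolynomial σ K))) * one_sub_X_pow_mul_geomPow ha +
      hilbertSeries (⊥ : Ideal (MvPolynomial σ K)) * hG
  rw [h3] at h2
  have h4 : (∏ i, geomPow (d i)) * hilbertSeries (Ideal.span (Set.range f)) =
      hilbertSeries (⊥ : Ideal (MvPolynomial σ K)) := by
    ext e
    have a1 := h1 e
    have a2 := h2 e
    rw [map_neg] at a2
    rw [map_sub] at a1 a2
    linarith
  linear_combination (∏ i, (1 - PowerSeries.X ^ d i)) * h4 -
    hilbertSeries (Ideal.span (Set.range f)) * hG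

end HilbertSeries

/-! ### Homogenization and the specialization y = 0 -/

section Homogenization

variable {σ : Type} {K : Type u} [Field K]

theorem degree_eq_none_add_degree_some (s : Option σ →₀ ℕ) : s.degree = s none + s.some.degree := by
  have := Finsupp.sum_option_index s (fun _ n => n) (fun _ => rfl) (fun _ _ _ => rfl)
  simpa [Finsupp.sum, Finsupp.degree_apply] using this

theorem degree_optionElim (t : σ →₀ ℕ) (k : ℕ) : (t.optionElim k).degree = k + t.degree := by
  rw [degree_eq_none_add_degree_some, Finsupp.optionElim_apply_none, Finsupp.some_optionElim]

theorem eq_optionElim_iff (s : Option σ →₀ ℕ) (t : σ →₀ ℕ) (k : ℕ) :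
    t.optionElim k = s ↔ k = s none ∧ t = s.some := by
  constructor
  · rintro rfl
    simp
  · rintro ⟨rfl, rfl⟩
    simp

theorem degree_le_totalDegree {f : MvPolynomial σ K} {t : σ →₀ ℕ} (ht : t ∈ f.support) :
    t.degree ≤ f.totalDegree := by
  simpa [Finsupp.sum, Finsupp.degree_apply] using le_totalDegree ht

/-- The exponent of y is determined by the x-part and the total degree; as t has degree at most that
of f, the subtraction in the exponent never truncates. -/
theorem coeff_homogPoly (f : MvPolynomial σ K) (s : Option σ →₀ ℕ) :
    coeff s (homogPoly f) = if s.degree = f.totalDegree then coeff s.some f else 0 := by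
  classical
  rw [homogPoly, coeff_sum]
  simp only [coeff_monomial, eq_optionElim_iff]
  rw [Finset.sum_eq_single s.some]
  · by_cases h0 : coeff s.some f = 0
    · simp [h0]
    · have := degree_le_totalDegree (mem_support_iff.2 h0)
      have h1 := degree_eq_none_add_degree_some s
      refine if_congr ?_ rfl rfl
      constructor
      · rintro ⟨h, -⟩
        omega
      · intro h
        exact ⟨by omega, rfl⟩
  · rintro t - hts
    exact if_neg fun h => hts h.2
  · intro h
    rw [notMem_support_iff.1 h, ite_self]

theorem isHomogeneous_homogPoly (f : MvPolynomial σ K) :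
    (homogPoly f).IsHomogeneous f.totalDegree := by
  intro s hs
  rw [coeff_homogPoly] at hs
  by_contra h
  exact hs (if_neg (by rwa [Finsupp.degree_eq_weight_one]))

theorem topPart_ne_zero {f : MvPolynomial σ K} (hf : f ≠ 0) : topPart f ≠ 0 := by
  obtain ⟨t, ht, htd⟩ := Finset.exists_mem_eq_sup f.support (support_nonempty.2 hf)
    (fun s => s.degree)
  have htd' : t.degree = f.totalDegree := by
    rw [← htd, totalDegree]
    rfl
  intro h
  have := congrArg (coeff t) h
  rw [topPart, coeff_homogeneousComponent, if_pos htd', coeff_zero] at this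
  exact mem_support_iff.1 ht this

/-- Substituting `y = 0`. -/
noncomputable def yToZero : MvPolynomial (Option σ) K →ₐ[K] MvPolynomial σ K :=
  aeval (fun o : Option σ => o.elim 0 X)

theorem yToZero_monomial (s : Option σ →₀ ℕ) (c : K) :
    yToZero (monomial s c) = if s none = 0 then monomial s.some c else 0 := by
  rw [yToZero, aeval_monomial, Finsupp.prod_option_index s _ (fun _ => pow_zero _)
    (fun _ _ _ => pow_add _ _ _)]
  split_ifs with h
  · rw [h, pow_zero, one_mul, monomial_eq (s := s.some)]
    rfl
  · simp [zero_pow h]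

theorem coeff_yToZero (h : MvPolynomial (Option σ) K) (t : σ →₀ ℕ) :
    coeff t (yToZero h) = coeff (t.optionElim 0) h := by
  classical
  induction h using MvPolynomial.induction_on' with
  | monomial s c =>
    rw [yToZero_monomial, coeff_monomial]
    by_cases h : s none = 0
    · rw [if_pos h, coeff_monomial]
      refine if_congr ?_ rfl rfl
      rw [eq_comm (a := s), eq_optionElim_iff, h]
      simp [eq_comm]
    · rw [if_neg h, coeff_zero, if_neg]
      rintro rfl
      simp at h
  | add p q hp hq => rw [map_add, coeff_add, coeff_add, hp, hq]

theorem yToZero_homogPoly (f : MvPolynomial σ K) : yToZero (homogPoly f) = topPart f := by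
  ext t
  rw [coeff_yToZero, coeff_homogPoly, topPart, coeff_homogeneousComponent, degree_optionElim,
    zero_add, Finsupp.some_optionElim]

theorem homogPoly_ne_zero {f : MvPolynomial σ K} (hf : f ≠ 0) : homogPoly f ≠ 0 := by
  intro h
  apply topPart_ne_zero hf
  rw [← yToZero_homogPoly, h, map_zero]

theorem isHomogeneous_topPart (f : MvPolynomial σ K) : (topPart f).IsHomogeneous f.totalDegree :=
  homogeneousComponent_isHomogeneous _ _

theorem yToZero_rename (g : MvPolynomial σ K) : yToZero (rename some g) = g := by
  rw [yToZero, aeval_rename]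
  exact aeval_X_left_apply g

theorem yToZero_surjective :
    Function.Surjective (yToZero : MvPolynomial (Option σ) K →ₐ[K] MvPolynomial σ K) :=
  fun g => ⟨_, yToZero_rename g⟩

theorem isHomogeneous_yToZero {h : MvPolynomial (Option σ) K} {e : ℕ} (hh : h.IsHomogeneous e) :
    (yToZero h).IsHomogeneous e := by
  have := hh.aeval (fun o : Option σ => (o.elim 0 X : MvPolynomial σ K)) (n := 1) (by
    rintro (_ | i)
    · exact isHomogeneous_zero _ _ _
    · exact isHomogeneous_X _ _)
  rwa [one_mul] at this

theorem sub_rename_yToZero_mem (h : MvPolynomial (Option σ) K) :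
    h - rename some (yToZero h) ∈ Ideal.span {(X none : MvPolynomial (Option σ) K)} := by
  classical
  induction h using MvPolynomial.induction_on' with
  | monomial s c =>
    rw [yToZero_monomial]
    split_ifs with h
    · have : Finsupp.mapDomain some s.some = s := by
        ext o
        cases o with
        | none => rw [Finsupp.mapDomain_of_notMem_range _ _ (by simp), h]
        | some i => rw [Finsupp.mapDomain_apply (Option.some_injective σ), Finsupp.some_apply]
      rw [rename_monomial, this, sub_self]
      exact zero_mem _
    · have hle : Finsupp.single none 1 ≤ s :=
        Finsupp.single_le_iff.2 (Nat.one_le_iff_ne_zero.2 h)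
      rw [map_zero, sub_zero, Ideal.mem_span_singleton', X]
      exact ⟨monomial (s - Finsupp.single none 1) c, by
        rw [monomial_mul, mul_one, tsub_add_cancel_of_le hle]⟩
  | add p q hp hq =>
    rw [map_add, map_add, add_sub_add_comm]
    exact add_mem hp hq

theorem comap_yToZero_bot :
    Ideal.comap (yToZero : MvPolynomial (Option σ) K →ₐ[K] MvPolynomial σ K) ⊥ =
      Ideal.span {(X none : MvPolynomial (Option σ) K)} := by
  apply le_antisymm
  · intro h hh
    have h0 : yToZero h = 0 := hh
    have := sub_rename_yToZero_mem h
    rwa [h0, map_zero, sub_zero] at this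
  · rw [Ideal.span_singleton_le_iff_mem, Ideal.mem_comap]
    simp [yToZero]

/-- The map y = 0 is surjective with kernel (y) and sends F^h to F^top. This is the isomorphism
R'/(F^h, y) ≅ R/(F^top) in terms of ideals. -/
theorem comap_yToZero_span_topPart {m : ℕ} (F : Fin m → MvPolynomial σ K) :
    Ideal.comap (yToZero : MvPolynomial (Option σ) K →ₐ[K] MvPolynomial σ K)
        (Ideal.span (Set.range fun i => topPart (F i))) =
      Ideal.span (Set.range fun i => homogPoly (F i)) ⊔ Ideal.span {X none} := by
  rw [← comap_yToZero_bot, ← Ideal.comap_map_of_surjective _ yToZero_surjective, Ideal.map_span,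
    ← Set.range_comp]
  simp only [Function.comp_def, yToZero_homogPoly]

theorem hilbertFn_comap_yToZero [Finite σ] (J : Ideal (MvPolynomial σ K)) (e : ℕ) :
    hilbertFn (Ideal.comap (yToZero : MvPolynomial (Option σ) K →ₐ[K] MvPolynomial σ K) J) e =
      hilbertFn J e := by
  let μ : homogeneousSubmodule (Option σ) K e →ₗ[K] homogeneousSubmodule σ K e :=
    LinearMap.codRestrict _ (yToZero.toLinearMap.comp (homogeneousSubmodule (Option σ) K e).subtype)
      fun h => isHomogeneous_yToZero h.2
  have hμ : Function.Surjective μ := fun g =>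
    ⟨⟨rename some g.1, IsHomogeneous.rename_isHomogeneous g.2⟩, Subtype.ext (yToZero_rename g.1)⟩
  let φ := (idealPart J e).mkQ.comp μ
  have hφ : Function.Surjective φ := (Submodule.mkQ_surjective _).comp hμ
  have hker : LinearMap.ker φ = idealPart (Ideal.comap yToZero J) e := by
    ext h
    simp only [φ, LinearMap.mem_ker, LinearMap.comp_apply, Submodule.mkQ_apply,
      Submodule.Quotient.mk_eq_zero]
    rfl
  have h2 := (φ.quotKerEquivOfSurjective hφ).finrank_eq
  rw [hker] at h2
  exact h2

end Homogenization

/-! ### Degrees of regularity -/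

section Regularity

variable {σ : Type} {K : Type u} [Field K]

theorem exists_dReg_eq [Finite σ] {I : Ideal (MvPolynomial σ K)} (h : IsArtinianQuotient I) :
    ∃ D : ℕ, dReg I = D ∧ hilbertFn I D = 0 ∧ ∀ e, hilbertFn I e = 0 → D ≤ e := by
  have hne : {d : ℕ | ∀ f : MvPolynomial σ K, f.IsHomogeneous d → f ∈ I}.Nonempty :=
    h.imp fun D hD => hD D le_rfl
  refine ⟨_, if_pos h, hilbertFn_eq_zero_iff.2 (Nat.sInf_mem hne), fun e he => Nat.sInf_le ?_⟩
  exact hilbertFn_eq_zero_iff.1 he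

theorem genDReg_le {I : Ideal (MvPolynomial σ K)} {e : ℕ}
    (h : ∀ d ≥ e, hilbertFn I d = hilbertFn I e) : genDReg I ≤ e := by
  rw [genDReg, if_pos ⟨e, h⟩]
  exact_mod_cast Nat.sInf_le (s := {d₀ : ℕ | ∀ d ≥ d₀, hilbertFn I d = hilbertFn I d₀}) h

theorem hilbertFn_eq_of_genDReg_le {I : Ideal (MvPolynomial σ K)} {e d : ℕ}
    (h : genDReg I ≤ e) (hd : e ≤ d) : hilbertFn I d = hilbertFn I e := by
  rw [genDReg] at h
  split_ifs at h with hex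
  · have h1 : ∀ d ≥ sInf {d₀ : ℕ | ∀ d ≥ d₀, hilbertFn I d = hilbertFn I d₀}, hilbertFn I d = _ :=
      Nat.sInf_mem (s := {d₀ : ℕ | ∀ d ≥ d₀, hilbertFn I d = hilbertFn I d₀}) hex
    have h2 : _ ≤ e := Nat.cast_le.1 h
    rw [h1 d (h2.trans hd), h1 e h2]
  · exact absurd (top_le_iff.1 h) (ENat.natCast_ne_top e)

/-- A zero of the Hilbert function persists, so the function would be constant from that degree on.
-/
theorem hilbertFn_pos_of_lt_genDReg [Finite σ] {I : Ideal (MvPolynomial σ K)} {e : ℕ}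
    (h : (e : ℕ∞) < genDReg I) : 0 < hilbertFn I e := by
  by_contra h0
  have h0' : hilbertFn I e = 0 := by omega
  exact h.not_ge (genDReg_le fun d hd => by rw [hilbertFn_eq_zero_of_le hd h0', h0'])

/-- The coefficients are positive up to degree `s` and vanish above it. -/
def PosUpTo (s : ℕ) (P : PowerSeries ℤ) : Prop :=
  (∀ e ≤ s, 0 < PowerSeries.coeff e P) ∧ ∀ e, s < e → PowerSeries.coeff e P = 0

theorem PosUpTo.mul {s t : ℕ} {P Q : PowerSeries ℤ} (hP : PosUpTo s P) (hQ : PosUpTo t Q) :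
    PosUpTo (s + t) (P * Q) := by
  have hP0 : NonnegCoeffs P := fun e => by
    by_cases h : e ≤ s
    · exact (hP.1 e h).le
    · exact (hP.2 e (by omega)).ge
  have hQ0 : NonnegCoeffs Q := fun e => by
    by_cases h : e ≤ t
    · exact (hQ.1 e h).le
    · exact (hQ.2 e (by omega)).ge
  constructor
  · intro e he
    rw [PowerSeries.coeff_mul]
    -- All terms are nonnegative; the witness takes as much of e as possible from the first factor,
    -- and the rest is at most t because e ≤ s + t.
    refine Finset.sum_pos' (fun _ _ => mul_nonneg (hP0 _) (hQ0 _))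
      ⟨(min e s, e - min e s), by simp, ?_⟩
    exact mul_pos (hP.1 _ (min_le_right _ _)) (hQ.1 _ (by omega))
  · intro e he
    rw [PowerSeries.coeff_mul]
    refine Finset.sum_eq_zero fun p hp => ?_
    rw [Finset.HasAntidiagonal.mem_antidiagonal] at hp
    by_cases h : p.1 ≤ s
    · rw [hQ.2 _ (by omega), mul_zero]
    · rw [hP.2 _ (by omega), zero_mul]

theorem posUpTo_geom_sum {d : ℕ} (hd : 0 < d) :
    PosUpTo (d - 1) (∑ i ∈ Finset.range d, PowerSeries.X ^ i) := by
  have : ∀ e, PowerSeries.coeff e (∑ i ∈ Finset.range d, (PowerSeries.X : PowerSeries ℤ) ^ i) =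
      if e < d then 1 else 0 := by
    intro e
    rw [map_sum]
    simp [PowerSeries.coeff_X_pow]
  constructor
  · intro e he
    rw [this, if_pos (by omega)]
    exact one_pos
  · intro e he
    rw [this, if_neg (by omega)]

theorem posUpTo_prod_geom_sum {n : ℕ} (d : Fin n → ℕ) (hd : ∀ i, 0 < d i) :
    PosUpTo (∑ i, (d i - 1)) (∏ i, ∑ j ∈ Finset.range (d i), PowerSeries.X ^ j) := by
  induction n with
  | zero =>
    constructor
    · intro e he
      simp at he
      simp [he]
    · intro e he
      simp at he
      simp [PowerSeries.coeff_one, he.ne']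
  | succ n ih =>
    rw [Fin.sum_univ_castSucc, Fin.prod_univ_castSucc]
    exact (ih _ fun i => hd _).mul (posUpTo_geom_sum (hd _))

theorem one_sub_X_pow_mul_invOneSubPow (n : ℕ) :
    (1 - PowerSeries.X) ^ n * (PowerSeries.invOneSubPow ℤ n : PowerSeries ℤ) = 1 := by
  rw [← PowerSeries.invOneSubPow_inv_eq_one_sub_pow]
  exact (PowerSeries.invOneSubPow ℤ n).inv_val

theorem one_sub_X_mul_invOneSubPow_succ (n : ℕ) :
    (1 - PowerSeries.X) * (PowerSeries.invOneSubPow ℤ (n + 1) : PowerSeries ℤ) =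
      (PowerSeries.invOneSubPow ℤ n : PowerSeries ℤ) := by
  have h1 := one_sub_X_pow_mul_invOneSubPow (n + 1)
  have h2 := one_sub_X_pow_mul_invOneSubPow n
  rw [pow_succ] at h1
  linear_combination (PowerSeries.invOneSubPow ℤ n : PowerSeries ℤ) * h1 -
    (1 - PowerSeries.X) * (PowerSeries.invOneSubPow ℤ (n + 1) : PowerSeries ℤ) * h2

/-- With as many forms as variables each factor 1 - z^d can be divided by one 1 - z, leaving ∏(1 + z
+ ... + z^{d_i - 1}). -/
theorem posUpTo_hilbertSeriesQuot {n : ℕ} (d : Fin n → ℕ) (hd : ∀ i, 0 < d i) :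
    PosUpTo (∑ i, (d i - 1)) (hilbertSeriesQuot d n) := by
  have : hilbertSeriesQuot d n = ∏ i, ∑ j ∈ Finset.range (d i), PowerSeries.X ^ j := by
    have h1 : ∀ i, (1 - PowerSeries.X ^ d i : PowerSeries ℤ) =
        (∑ j ∈ Finset.range (d i), PowerSeries.X ^ j) * (1 - PowerSeries.X) := fun i => by
      rw [geom_sum_mul_neg]
    rw [hilbertSeriesQuot]
    simp_rw [h1]
    rw [Finset.prod_mul_distrib, Finset.prod_const, Finset.card_univ, Fintype.card_fin, mul_assoc,
      one_sub_X_pow_mul_invOneSubPow, mul_one]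
  rw [this]
  exact posUpTo_prod_geom_sum d hd

/-- An initial segment of a D-regular sequence is D-regular. Already the first N forms, N being the
number of variables, give a polynomial series that vanishes above its degree; further forms only
decrease the Hilbert function. -/
theorem hilbertFn_eq_zero_of_isDRegular [Fintype σ] {D : ℕ∞} {m : ℕ} {f : Fin m → MvPolynomial σ K}
    (d : Fin m → ℕ) (hf : ∀ i, (f i).IsHomogeneous (d i)) (hne : ∀ i, f i ≠ 0)
    (hd : ∀ i, 0 < d i) (h : IsDRegular f D) (hm : Fintype.card σ ≤ m) {e : ℕ}
    (he : ∑ i, (d (Fin.castLE hm i) - 1) < e) (heD : (e : ℕ∞) < D) :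
    hilbertFn (Ideal.span (Set.range f)) e = 0 := by
  have h1 := ((h.castLE hm).hilbertFn_eq (fun i => d (Fin.castLE hm i)) (fun i => hf _)
    (fun i => hne _) (fun i => hd _)).1 e heD
  rw [(posUpTo_hilbertSeriesQuot (fun i => d (Fin.castLE hm i)) fun i => hd _).2 e he] at h1
  have h2 : hilbertFn (Ideal.span (Set.range f)) e ≤
      hilbertFn (Ideal.span (Set.range fun i => f (Fin.castLE hm i))) e :=
    hilbertFn_le fun g _ hg => Ideal.span_mono (by rintro _ ⟨i, rfl⟩; exact ⟨_, rfl⟩) hg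
  have h3 : hilbertFn (Ideal.span (Set.range fun i => f (Fin.castLE hm i))) e = 0 := by
    exact_mod_cast h1
  omega

/-- If the degree of regularity were larger, the sequence would be regular enough to force a zero of
the Hilbert function in a degree below the least zero. -/
theorem dReg_le_of_isCryptoSemiRegular [Fintype σ] {m : ℕ} {f : Fin m → MvPolynomial σ K}
    (d : Fin m → ℕ) (hf : ∀ i, (f i).IsHomogeneous (d i)) (hne : ∀ i, f i ≠ 0)
    (hd : ∀ i, 0 < d i) (hA : IsArtinianQuotient (Ideal.span (Set.range f)))
    (h : IsCryptoSemiRegular f) (hm : Fintype.card σ ≤ m) :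
    dReg (Ideal.span (Set.range f)) ≤ ((∑ i, (d (Fin.castLE hm i) - 1) + 1 : ℕ) : ℕ∞) := by
  obtain ⟨D, hD, -, hmin⟩ := exists_dReg_eq hA
  by_contra hlt
  rw [not_le] at hlt
  have := hmin _ (hilbertFn_eq_zero_of_isDRegular d hf hne hd h hm (Nat.lt_succ_self _) hlt)
  rw [hD] at hlt
  exact hlt.not_ge (by exact_mod_cast this)

theorem genDReg_le_of_isGenCryptoSemiRegular [Fintype σ] {m : ℕ} {f : Fin m → MvPolynomial σ K}
    (d : Fin m → ℕ) (hf : ∀ i, (f i).IsHomogeneous (d i)) (hne : ∀ i, f i ≠ 0)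
    (hd : ∀ i, 0 < d i) (h : IsGenCryptoSemiRegular f) (hm : Fintype.card σ ≤ m) :
    genDReg (Ideal.span (Set.range f)) ≤ ((∑ i, (d (Fin.castLE hm i) - 1) + 1 : ℕ) : ℕ∞) := by
  by_contra hlt
  rw [not_le] at hlt
  have := hilbertFn_eq_zero_of_isDRegular d hf hne hd h hm (Nat.lt_succ_self _) hlt
  exact (hilbertFn_pos_of_lt_genDReg hlt).ne' this

/-- Below the generalized degree of regularity the coefficients of the series are values of the
Hilbert function, hence positive, so none of them is cut off by the truncation. -/
theorem genDReg_le_psDegree [Fintype σ] {m : ℕ} {f : Fin m → MvPolynomial σ K}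
    (d : Fin m → ℕ) (hf : ∀ i, (f i).IsHomogeneous (d i)) (hne : ∀ i, f i ≠ 0)
    (hd : ∀ i, 0 < d i) (h : IsGenCryptoSemiRegular f) :
    genDReg (Ideal.span (Set.range f)) ≤
      psDegree (truncPos (hilbertSeriesQuot d (Fintype.card σ))) + 1 := by
  have hpos : ∀ e : ℕ, (e : ℕ∞) < genDReg (Ideal.span (Set.range f)) →
      0 < PowerSeries.coeff e (hilbertSeriesQuot d (Fintype.card σ)) := by
    intro e he
    rw [← (IsDRegular.hilbertFn_eq d hf hne hd h).1 e he]
    exact_mod_cast hilbertFn_pos_of_lt_genDReg he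
  have hle : ∀ e : ℕ, (e : ℕ∞) < genDReg (Ideal.span (Set.range f)) →
      (e : ℕ∞) ≤ psDegree (truncPos (hilbertSeriesQuot d (Fintype.card σ))) := by
    intro e he
    refine le_iSup₂_of_le e ?_ le_rfl
    have h1 : ∀ e' ≤ e, 0 < PowerSeries.coeff e' (hilbertSeriesQuot d (Fintype.card σ)) :=
      fun e' he' => hpos e' (lt_of_le_of_lt (by exact_mod_cast he') he)
    rw [Set.mem_ofPred_eq, truncPos, PowerSeries.coeff_mk, if_pos h1]
    exact (h1 e le_rfl).ne'
  -- Comparing with all natural numbers below also covers an infinite degree of regularity.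
  refine ENat.forall_natCast_le_iff_le.1 fun k hk => ?_
  cases k with
  | zero => simp
  | succ k =>
    have hk' : (k : ℕ∞) < genDReg (Ideal.span (Set.range f)) :=
      lt_of_lt_of_le (by exact_mod_cast Nat.lt_succ_self k) hk
    push_cast
    gcongr
    exact hle k hk'

/-- The degrees of regularity of a square system without solutions at infinity. -/
theorem dReg_and_genDReg_of_card_eq {n : ℕ} {F : Fin n → MvPolynomial (Fin n) K}
    (hd : ∀ i, 0 < (F i).totalDegree)
    (hA : IsArtinianQuotient (Ideal.span (Set.range fun i => topPart (F i))))
    (h : IsCryptoSemiRegular (fun i => topPart (F i))) :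
    dReg (Ideal.span (Set.range fun i => topPart (F i))) =
      ((∑ i, ((F i).totalDegree - 1) + 1 : ℕ) : ℕ∞) ∧
    genDReg (Ideal.span (Set.range fun i => homogPoly (F i))) =
      ((∑ i, ((F i).totalDegree - 1) : ℕ) : ℕ∞) := by
  have hF : ∀ i, F i ≠ 0 := fun i h0 => by
    have := hd i
    rw [h0, totalDegree_zero] at this
    exact lt_irrefl _ this
  have hposU := posUpTo_hilbertSeriesQuot (fun i => (F i).totalDegree) hd
  have hle := dReg_le_of_isCryptoSemiRegular (fun i => (F i).totalDegree)
    (fun i => isHomogeneous_topPart (F i)) (fun i => topPart_ne_zero (hF i)) hd hA h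
    (Fintype.card_fin n).le
  obtain ⟨e1, e2⟩ := IsDRegular.hilbertFn_eq (fun i => (F i).totalDegree)
    (fun i => isHomogeneous_topPart (F i)) (fun i => topPart_ne_zero (hF i)) hd h
  obtain ⟨D, hD, hD0, hmin⟩ := exists_dReg_eq hA
  rw [Fintype.card_fin] at e1 e2
  rw [hD] at hle e1 e2 ⊢
  have hsum : ∑ i, ((F (Fin.castLE (Fintype.card_fin n).le i)).totalDegree - 1) =
      ∑ i, ((F i).totalDegree - 1) :=
    Fintype.sum_equiv (finCongr (Fintype.card_fin n)) _ _ fun i => rfl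
  rw [hsum] at hle
  set s := ∑ i, ((F i).totalDegree - 1) with hs
  have hle' : D ≤ s + 1 := by exact_mod_cast hle
  -- If D ≤ s, the coefficient in degree D would be positive and yet at most the Hilbert function,
  -- which is 0 there.
  have hDs : D = s + 1 := by
    by_contra hne
    have h1 := hposU.1 D (by omega)
    have h2 := e2 D le_rfl
    rw [hD0] at h2
    push_cast at h2
    omega
  refine ⟨by rw [hDs], ?_⟩
  have htop : hilbertSeries (Ideal.span (Set.range fun i => topPart (F i))) =
      hilbertSeriesQuot (fun i => (F i).totalDegree) n := by
    ext e
    rw [coeff_hilbertSeries]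
    by_cases hes : e ≤ s
    · exact e1 e (by exact_mod_cast (by omega : e < D))
    · rw [hilbertFn_eq_zero_of_le (by omega : D ≤ e) hD0, hposU.2 e (by omega)]
      rfl
  have hsup : hilbertSeries (Ideal.span (Set.range fun i => homogPoly (F i)) ⊔
      Ideal.span {(X none : MvPolynomial (Option (Fin n)) K)}) =
      (1 - PowerSeries.X ^ 1) * (∏ i, (1 - PowerSeries.X ^ (F i).totalDegree)) *
        hilbertSeries (⊥ : Ideal (MvPolynomial (Option (Fin n)) K)) := by
    rw [← comap_yToZero_span_topPart, hilbertSeries_bot, Fintype.card_option, Fintype.card_fin,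
      pow_one, mul_comm (1 - PowerSeries.X), mul_assoc, one_sub_X_mul_invOneSubPow_succ]
    change _ = hilbertSeriesQuot (fun i => (F i).totalDegree) n
    rw [← htop]
    ext e
    rw [coeff_hilbertSeries, coeff_hilbertSeries, hilbertFn_comap_yToZero]
  -- The quotient by F^h and y has the Hilbert series of a complete intersection, and this passes to
  -- F^h alone.
  have hser := hilbertSeries_eq_of_sup_span_singleton (fun i => (F i).totalDegree)
    (fun i => isHomogeneous_homogPoly (F i)) hd (isHomogeneous_X K none) one_pos hsup
  have hdiff : (1 - PowerSeries.X ^ 1) *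
      hilbertSeries (Ideal.span (Set.range fun i => homogPoly (F i))) =
      hilbertSeriesQuot (fun i => (F i).totalDegree) n := by
    rw [hser, ← mul_assoc, ← hsup, ← comap_yToZero_span_topPart, ← htop]
    ext e
    rw [coeff_hilbertSeries, coeff_hilbertSeries, hilbertFn_comap_yToZero]
  set I := Ideal.span (Set.range fun i => homogPoly (F i)) with hI
  -- Multiplication by 1 - z takes first differences.
  have hstep : ∀ e, (hilbertFn I (e + 1) : ℤ) - hilbertFn I e =
      PowerSeries.coeff (e + 1) (hilbertSeriesQuot (fun i => (F i).totalDegree) n) := by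
    intro e
    rw [← hdiff, coeff_one_sub_X_pow_mul, if_pos (by omega), coeff_hilbertSeries,
      coeff_hilbertSeries, Nat.add_sub_cancel]
  have hconst : ∀ d ≥ s, hilbertFn I d = hilbertFn I s := by
    intro d hd
    induction d, hd using Nat.le_induction with
    | base => rfl
    | succ d hd ih =>
      have := hstep d
      rw [hposU.2 _ (by omega)] at this
      omega
  apply le_antisymm (genDReg_le hconst)
  -- A smaller value would make the Hilbert function constant from s - 1 on, against its positive
  -- jump from s - 1 to s.
  by_contra hlt
  rw [not_le] at hlt
  have hs0 : 0 < s := by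
    have : (0 : ℕ∞) < s := lt_of_le_of_lt zero_le hlt
    exact_mod_cast this
  have h1 := hstep (s - 1)
  rw [Nat.sub_add_cancel hs0] at h1
  have h2 := hposU.1 s le_rfl
  have h3 : genDReg I ≤ ((s - 1 : ℕ) : ℕ∞) := by
    refine Order.le_of_lt_add_one ?_
    have : ((s - 1 : ℕ) : ℕ∞) + 1 = s := by
      exact_mod_cast Nat.sub_add_cancel hs0
    rwa [this]
  have h4 := hilbertFn_eq_of_genDReg_le h3 (Nat.sub_le s 1)
  omega

end Regularity

/-! ### Minimal leading monomials and degrees of reduced Gröbner bases -/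

section Groebner

variable {σ : Type} {K : Type u} [Field K]

/-- `s` is a minimal leading monomial of `I` with respect to divisibility. -/
def IsMinimalLead (ord : MonomialOrder.{0, v} σ) (I : Ideal (MvPolynomial σ K)) (s : σ →₀ ℕ) :
    Prop :=
  (∃ f ∈ I, f ≠ 0 ∧ ord.degree f = s) ∧ ∀ g ∈ I, g ≠ 0 → ord.degree g ≤ s → ord.degree g = s

theorem MonomialOrder.degree_eq_of_forall_le {ord : MonomialOrder.{0, v} σ}
    {f : MvPolynomial σ K} {s : σ →₀ ℕ} (hs : s ∈ f.support)
    (h : ∀ t ∈ f.support, ord.toSyn t ≤ ord.toSyn s) : ord.degree f = s :=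
  ord.toSyn.injective (le_antisymm (ord.degree_le_iff.2 h) (ord.le_degree hs))

theorem exists_isMinimalLead_le [Finite σ] (ord : MonomialOrder.{0, v} σ)
    {I : Ideal (MvPolynomial σ K)} {f : MvPolynomial σ K} (hf : f ∈ I) (h0 : f ≠ 0) :
    ∃ s, IsMinimalLead ord I s ∧ s ≤ ord.degree f := by
  let S : Set (σ →₀ ℕ) := {s | s ≤ ord.degree f ∧ ∃ g ∈ I, g ≠ 0 ∧ ord.degree g = s}
  have hne : S.Nonempty := ⟨ord.degree f, le_rfl, f, hf, h0, rfl⟩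
  obtain ⟨s, hs, hmin⟩ := (wellFounded_lt (α := σ →₀ ℕ)).has_min S hne
  refine ⟨s, ⟨hs.2, fun g hg hg0 hgs => ?_⟩, hs.1⟩
  by_contra hne
  exact hmin _ ⟨hgs.trans hs.1, g, hg, hg0, rfl⟩ (lt_of_le_of_ne hgs hne)

/-- Dickson's lemma: minimal leads form an antichain for divisibility. -/
theorem finite_isMinimalLead [Finite σ] (ord : MonomialOrder.{0, v} σ)
    (I : Ideal (MvPolynomial σ K)) : {s | IsMinimalLead ord I s}.Finite := by
  refine WellQuasiOrderedLE.finite_of_isAntichain ?_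
  intro s hs t ht hst hle
  obtain ⟨f, hf, hf0, rfl⟩ := hs.1
  exact hst (ht.2 f hf hf0 hle)

/-- If a lead of I divides that of g, then so does the lead of some basis element, which must be g
itself by reducedness. -/
theorem IsReducedGroebnerBasis.isMinimalLead {ord : MonomialOrder.{0, v} σ}
    {I : Ideal (MvPolynomial σ K)} {G : Set (MvPolynomial σ K)}
    (hG : IsReducedGroebnerBasis ord I G) {g : MvPolynomial σ K} (hg : g ∈ G) :
    IsMinimalLead ord I (ord.degree g) := by
  obtain ⟨⟨-, hGI, hGB⟩, -, hred⟩ := hG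
  refine ⟨⟨g, (hGI g hg).1, (hGI g hg).2, rfl⟩, fun f hf hf0 hle => le_antisymm hle ?_⟩
  obtain ⟨g', hg', hle'⟩ := hGB f hf hf0
  by_cases h : g' = g
  · rwa [← h]
  · exact absurd (hle'.trans hle)
      (hred g hg g' hg' h _ (ord.degree_mem_support (hGI g hg).2))

/-- A minimal leading monomial is the leading monomial of a fully reduced element. -/
theorem IsMinimalLead.exists_reduced {ord : MonomialOrder.{0, v} σ}
    {I : Ideal (MvPolynomial σ K)} {s : σ →₀ ℕ} (hs : IsMinimalLead ord I s) :
    ∃ g ∈ I, g ≠ 0 ∧ ord.degree g = s ∧ ord.leadingCoeff g = 1 ∧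
      ∀ t ∈ g.support, t ≠ s → ∀ f ∈ I, f ≠ 0 → ¬ ord.degree f ≤ t := by
  classical
  -- The monomial s is divided by all nonzero elements of I. No monomial of the remainder r is
  -- divisible by a lead of I, so s - r is the fully reduced element sought.
  obtain ⟨q, r, heq, -, hr⟩ := ord.div_set (B := {b | b ∈ I ∧ b ≠ 0})
    (fun b hb => (ord.leadingCoeff_ne_zero_iff.2 hb.2).isUnit) (monomial s (1 : K))
  have hgI : monomial s (1 : K) - r ∈ I := by
    rw [heq, add_sub_cancel_right, Finsupp.linearCombination_apply]
    exact Ideal.sum_mem _ fun b _ => I.mul_mem_left _ b.2.1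
  obtain ⟨⟨f, hf, hf0, hfs⟩, -⟩ := hs
  have hsr : coeff s r = 0 := by
    by_contra h
    exact hr s (mem_support_iff.2 h) f ⟨hf, hf0⟩ hfs.le
  have hcoeff : coeff s (monomial s (1 : K) - r) = 1 := by
    rw [coeff_sub, hsr, coeff_monomial, if_pos rfl, sub_zero]
  have h0 : monomial s (1 : K) - r ≠ 0 := by
    intro h
    rw [h, coeff_zero] at hcoeff
    exact zero_ne_one hcoeff
  have hsupp : ∀ t ∈ (monomial s (1 : K) - r).support, t ≠ s → t ∈ r.support := by
    intro t ht hts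
    rw [mem_support_iff, coeff_sub, coeff_monomial, if_neg (Ne.symm hts), zero_sub] at ht
    exact mem_support_iff.2 fun h => ht (by rw [h, neg_zero])
  have hdeg : ord.degree (monomial s (1 : K) - r) = s := by
    by_contra hne
    exact hr _ (hsupp _ (ord.degree_mem_support h0) hne) _ ⟨hgI, h0⟩ le_rfl
  refine ⟨_, hgI, h0, hdeg, ?_, fun t ht hts f' hf' hf0' => hr t (hsupp t ht hts) f' ⟨hf', hf0'⟩⟩
  rw [MonomialOrder.leadingCoeff, hdeg, hcoeff]

/-- One fully reduced element for each minimal lead forms a reduced Gröbner basis. Its existence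
ensures that every minimal lead is counted by `maxGBDeg`. -/
theorem IsMinimalLead.exists_isReducedGroebnerBasis [Finite σ] {ord : MonomialOrder.{0, v} σ}
    {I : Ideal (MvPolynomial σ K)} {s : σ →₀ ℕ} (hs : IsMinimalLead ord I s) :
    ∃ G, IsReducedGroebnerBasis ord I G ∧ ∃ g ∈ G, ord.degree g = s := by
  choose g hgI hg0 hgs hg1 hgr using
    fun t : {t // IsMinimalLead ord I t} => t.2.exists_reduced
  refine ⟨Set.range g, ⟨⟨?_, ?_, ?_⟩, ?_, ?_⟩, g ⟨s, hs⟩, ⟨_, rfl⟩, hgs _⟩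
  · have : Finite {t // IsMinimalLead ord I t} := finite_isMinimalLead ord I
    exact Set.finite_range g
  · rintro _ ⟨t, rfl⟩
    exact ⟨hgI t, hg0 t⟩
  · intro f hf hf0
    obtain ⟨t, ht, hle⟩ := exists_isMinimalLead_le ord hf hf0
    exact ⟨g ⟨t, ht⟩, ⟨_, rfl⟩, by rwa [hgs]⟩
  · rintro _ ⟨t, rfl⟩
    exact hg1 t
  · rintro _ ⟨t, rfl⟩ _ ⟨t', rfl⟩ hne u hu hle
    by_cases hut : u = t
    · rw [hut] at hle
      have := t.2.2 _ (hgI t') (hg0 t') hle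
      rw [hgs] at this
      exact hne (congrArg g (Subtype.ext this))
    · exact hgr t u hu hut _ (hgI t') (hg0 t') hle

theorem MonomialOrder.IsGraded.degree_degree {ord : MonomialOrder.{0, v} σ} (hord : ord.IsGraded)
    {f : MvPolynomial σ K} (hf : f ≠ 0) : (ord.degree f).degree = f.totalDegree := by
  apply le_antisymm (degree_le_totalDegree (ord.degree_mem_support hf))
  rw [totalDegree, Finset.sup_le_iff]
  intro t ht
  by_contra hlt
  rw [not_le] at hlt
  exact (hord _ _ hlt).not_ge (ord.le_degree ht)

theorem MonomialOrder.isGraded_homogenization (ord : MonomialOrder.{0, v} σ) :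
    ord.homogenization.IsGraded :=
  fun a b h => (ord.homogenization_lt_iff a b).2 (Or.inl h)

theorem maxGBDeg_le {ord : MonomialOrder.{0, v} σ} (hord : ord.IsGraded)
    {I : Ideal (MvPolynomial σ K)} {b : ℕ} (h : ∀ s, IsMinimalLead ord I s → s.degree ≤ b) :
    maxGBDeg ord I ≤ b := by
  refine csSup_le' ?_
  rintro _ ⟨G, hG, g, hg, rfl⟩
  rw [← hord.degree_degree (hG.1.2.1 g hg).2]
  exact h _ (hG.isMinimalLead hg)

theorem IsMinimalLead.degree_le_maxGBDeg [Finite σ] {ord : MonomialOrder.{0, v} σ}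
    (hord : ord.IsGraded) {I : Ideal (MvPolynomial σ K)} {s : σ →₀ ℕ}
    (hs : IsMinimalLead ord I s) : s.degree ≤ maxGBDeg ord I := by
  -- An unbounded set of natural numbers has supremum 0 by convention; boundedness comes from the
  -- finiteness of the set of minimal leads.
  refine le_csSup ?_ ?_
  · refine (((finite_isMinimalLead ord I).image Finsupp.degree).subset ?_).bddAbove
    rintro _ ⟨G, hG, g, hg, rfl⟩
    exact ⟨_, hG.isMinimalLead hg, hord.degree_degree (hG.1.2.1 g hg).2⟩
  · obtain ⟨G, hG, g, hg, rfl⟩ := hs.exists_isReducedGroebnerBasis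
    exact ⟨G, hG, g, hg, (hord.degree_degree (hG.1.2.1 g hg).2).symm⟩

/-- Leading monomials of an ideal with homogeneous components are leading monomials of forms. -/
theorem HasHomogeneousComponents.exists_isHomogeneous {ord : MonomialOrder.{0, v} σ}
    {I : Ideal (MvPolynomial σ K)} (hI : HasHomogeneousComponents I) {f : MvPolynomial σ K}
    (hf : f ∈ I) (h0 : f ≠ 0) :
    ∃ g ∈ I, g ≠ 0 ∧ g.IsHomogeneous (ord.degree f).degree ∧ ord.degree g = ord.degree f := by
  have hmem : ord.degree f ∈ (homogeneousComponent (ord.degree f).degree f).support := by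
    rw [mem_support_iff, coeff_homogeneousComponent, if_pos rfl]
    exact ord.coeff_degree_ne_zero_iff.2 h0
  refine ⟨homogeneousComponent (ord.degree f).degree f, hI f hf _,
    support_nonempty.1 ⟨_, hmem⟩, homogeneousComponent_isHomogeneous _ _,
    MonomialOrder.degree_eq_of_forall_le hmem fun t ht => ord.le_degree ?_⟩
  rw [support_homogeneousComponent, Finset.mem_filter] at ht
  exact ht.1

/-- Within one total degree a smaller exponent of y means an x-part of larger degree, hence a larger
monomial, because the order on the x-parts is graded. -/
theorem some_degree_le_of_le_homogenization {ord : MonomialOrder.{0, v} σ} (hord : ord.IsGraded)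
    {s t : Option σ →₀ ℕ} (hst : s.degree = t.degree)
    (h : ord.homogenization.toSyn t ≤ ord.homogenization.toSyn s) : s none ≤ t none := by
  by_contra hlt
  have h1 := degree_eq_none_add_degree_some s
  have h2 := degree_eq_none_add_degree_some t
  refine h.not_gt ((ord.homogenization_lt_iff s t).2 (Or.inr ⟨hst, hord _ _ (by omega)⟩))

variable [Finite σ]

/-- A minimal lead of larger degree would be a proper multiple of another lead: a y-free one by
vanishing of R/(F^top) in degree D, one divisible by y by injectivity of multiplication by y from
degree g on. -/
theorem IsMinimalLead.degree_le {m : ℕ} {F : Fin m → MvPolynomial σ K}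
    {ord : MonomialOrder.{0, v} σ} (hord : ord.IsGraded) {D g : ℕ}
    (hD : hilbertFn (Ideal.span (Set.range fun i => topPart (F i))) D = 0)
    (hg : ∀ d ≥ g, hilbertFn (Ideal.span (Set.range fun i => homogPoly (F i))) d =
      hilbertFn (Ideal.span (Set.range fun i => homogPoly (F i))) g)
    {s : Option σ →₀ ℕ}
    (hs : IsMinimalLead ord.homogenization (Ideal.span (Set.range fun i => homogPoly (F i))) s) :
    s.degree ≤ max D g := by
  classical
  by_contra hlt
  rw [not_le, max_lt_iff] at hlt
  obtain ⟨hsD, hsg⟩ := hlt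
  set I := Ideal.span (Set.range fun i => homogPoly (F i)) with hIdef
  have hI : HasHomogeneousComponents I :=
    hasHomogeneousComponents_span (by rintro _ ⟨i, rfl⟩; exact ⟨_, isHomogeneous_homogPoly _⟩)
  have hsup : ∀ d, D ≤ d → hilbertFn (I ⊔ Ideal.span {X none}) d = 0 := fun d hd => by
    rw [← comap_yToZero_span_topPart, hilbertFn_comap_yToZero]
    exact hilbertFn_eq_zero_of_le hd hD
  obtain ⟨⟨f₀, hf₀, hf₀0, hf₀s⟩, hmin⟩ := hs
  by_cases hy : s none = 0
  · have hsd : s.some.degree = s.degree := by rw [degree_eq_none_add_degree_some s, hy, zero_add]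
    -- The y-free monomial u of degree D is congruent modulo y to an element i of I. In degree D,
    -- all other monomials of i involve y and are therefore smaller than u.
    obtain ⟨u, hus, hud⟩ := exists_le_degree_eq s.some (hsd ▸ hsD.le)
    have hud' : (u.optionElim 0).degree = D := by rw [degree_optionElim, zero_add, hud]
    have hmem := hilbertFn_eq_zero_iff.1 (hsup D le_rfl) (monomial (u.optionElim 0) 1)
      (isHomogeneous_monomial _ hud')
    obtain ⟨i, hi, j, hj, hij⟩ := Submodule.mem_sup.1 hmem
    obtain ⟨c, rfl⟩ := Ideal.mem_span_singleton'.1 hj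
    have hcoeff : ∀ t : Option σ →₀ ℕ, t none = 0 →
        coeff t i = if u.optionElim 0 = t then 1 else 0 := by
      intro t ht
      rw [← coeff_monomial, ← hij, coeff_add, coeff_mul_X', if_neg, add_zero]
      simpa using ht
    have hcu : u.optionElim 0 ∈ (homogeneousComponent D i).support := by
      rw [mem_support_iff, coeff_homogeneousComponent, if_pos hud', hcoeff _ (by simp), if_pos rfl]
      exact one_ne_zero
    have hdeg : ord.homogenization.degree (homogeneousComponent D i) = u.optionElim 0 := by
      refine MonomialOrder.degree_eq_of_forall_le hcu fun t ht => ?_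
      rw [support_homogeneousComponent, Finset.mem_filter] at ht
      by_cases htn : t none = 0
      · have h1 := mem_support_iff.1 ht.1
        rw [hcoeff t htn] at h1
        rw [show u.optionElim 0 = t by by_contra h; exact h1 (if_neg h)]
      · refine ((ord.homogenization_lt_iff _ _).2 (Or.inr ⟨ht.2.trans hud'.symm, hord _ _ ?_⟩)).le
        rw [Finsupp.some_optionElim]
        have := degree_eq_none_add_degree_some t
        omega
    have hle : u.optionElim 0 ≤ s := by
      intro o
      cases o with
      | none => simp
      | some x => simpa using hus x
    have := hmin _ (hI i hi D) (support_nonempty.1 ⟨_, hcu⟩) (hdeg ▸ hle)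
    rw [← this, hdeg, hud'] at hsD
    exact lt_irrefl _ hsD
  · obtain ⟨f, hf, hf0, hfh, hfs⟩ := hI.exists_isHomogeneous (ord := ord.homogenization) hf₀ hf₀0
    rw [hf₀s] at hfh hfs
    -- The lead has the least exponent of y in the form f, so y divides all of f.
    have hf_y : yToZero f = 0 := by
      ext t
      rw [coeff_yToZero, coeff_zero]
      by_contra hne
      have hts := ord.homogenization.le_degree (mem_support_iff.2 hne)
      rw [hfs] at hts
      have hdeg : (t.optionElim 0).degree = s.degree := by
        by_contra h
        exact hne (hfh.coeff_eq_zero h)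
      have := some_degree_le_of_le_homogenization hord hdeg.symm hts
      rw [Finsupp.optionElim_apply_none] at this
      omega
    have hfy := sub_rename_yToZero_mem f
    rw [hf_y, map_zero, sub_zero] at hfy
    obtain ⟨c, hc⟩ := Ideal.mem_span_singleton'.1 hfy
    obtain ⟨e, he⟩ : ∃ e, s.degree = e + 1 := Nat.exists_eq_add_one.2 (by omega)
    rw [he] at hfh
    have hc' : homogeneousComponent e c * X none = f := by
      rw [← homogeneousComponent_eq_self hfh, ← hc,
        homogeneousComponent_mul_of_isHomogeneous (isHomogeneous_X K none), if_pos (by omega),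
        Nat.add_sub_cancel]
    set h := homogeneousComponent e c
    have hh : h.IsHomogeneous e := homogeneousComponent_isHomogeneous _ _
    -- The quotient by I and y vanishes in degree e + 1 and the Hilbert function of I is equal in
    -- degrees e and e + 1, so I : y and I have the same part in degree e. Here e ≥ max D g, as the
    -- degree of s is e + 1.
    have hhI : h ∈ I := by
      have h1 := hilbertFn_eq_sup_add_colon hI (isHomogeneous_X K (none : Option σ)) e
      rw [hsup (e + 1) (by omega), zero_add, hg (e + 1) (by omega), ← hg e (by omega)] at h1
      refine mem_of_hilbertFn_eq (J := I.colon {X none}) ?_ h1.le hh ?_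
      · intro g _ hg
        rw [Submodule.mem_colon_singleton, smul_eq_mul]
        exact I.mul_mem_right _ hg
      · rw [Submodule.mem_colon_singleton, smul_eq_mul, hc']
        exact hf
    have hh0 : h ≠ 0 := by
      intro h0
      rw [h0, zero_mul] at hc'
      exact hf0 hc'.symm
    have hdeg : ord.homogenization.degree f = ord.homogenization.degree h + Finsupp.single none 1 := by
      rw [← hc', ord.homogenization.degree_mul hh0 (X_ne_zero _), MonomialOrder.degree_X]
    rw [hfs] at hdeg
    have := hmin h hhI hh0 (by rw [hdeg]; exact le_self_add)
    rw [this] at hdeg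
    have := DFunLike.congr_fun hdeg none
    simp at this

theorem maxGBDeg_homogenization_le {m : ℕ} {F : Fin m → MvPolynomial σ K}
    {ord : MonomialOrder.{0, v} σ} (hord : ord.IsGraded)
    (hA : IsArtinianQuotient (Ideal.span (Set.range fun i => topPart (F i)))) :
    (maxGBDeg ord.homogenization (Ideal.span (Set.range fun i => homogPoly (F i))) : ℕ∞) ≤
      max (dReg (Ideal.span (Set.range fun i => topPart (F i))))
        (genDReg (Ideal.span (Set.range fun i => homogPoly (F i)))) := by
  obtain ⟨D, hD, hD0, -⟩ := exists_dReg_eq hA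
  rw [hD]
  cases hg : genDReg (Ideal.span (Set.range fun i => homogPoly (F i))) with
  | top => simp
  | coe g =>
    have hconst := fun d hd => hilbertFn_eq_of_genDReg_le hg.le (d := d) hd
    have := maxGBDeg_le (ord.isGraded_homogenization) fun s hs => hs.degree_le hord hD0 hconst
    rw [le_max_iff] at this ⊢
    exact this.imp Nat.cast_le.2 Nat.cast_le.2

end Groebner

/-! ### The bounds in terms of the degrees of the polynomials -/

section DegreeBounds

variable {K : Type u} [Field K]

theorem sum_sub_one_le {n : ℕ} {d : Fin n → ℕ} {δ : ℕ} (h : ∀ i, d i ≤ δ) :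
    ∑ i, (d i - 1) ≤ n * (δ - 1) := by
  refine (Finset.sum_le_card_nsmul Finset.univ _ (δ - 1) fun i _ =>
    Nat.sub_le_sub_right (h i) 1).trans ?_
  simp

theorem ne_zero_of_totalDegree_pos {σ : Type} {f : MvPolynomial σ K} (h : 0 < f.totalDegree) :
    f ≠ 0 := by
  rintro rfl
  simp at h

theorem dReg_genDReg_of_square (n : ℕ) (F : Fin n → MvPolynomial (Fin n) K)
    (hd : ∀ i, 0 < (F i).totalDegree)
    (hA : IsArtinianQuotient (Ideal.span (Set.range fun i => topPart (F i))))
    (h : IsCryptoSemiRegular (fun i => topPart (F i))) :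
    genDReg (Ideal.span (Set.range fun i => homogPoly (F i))) + 1 =
        dReg (Ideal.span (Set.range fun i => topPart (F i))) ∧
      dReg (Ideal.span (Set.range fun i => topPart (F i))) + n =
        ((∑ i, (F i).totalDegree + 1 : ℕ) : ℕ∞) := by
  obtain ⟨h1, h2⟩ := dReg_and_genDReg_of_card_eq hd hA h
  rw [h1, h2]
  refine ⟨by push_cast; rfl, ?_⟩
  have : ∑ i, ((F i).totalDegree - 1) + n = ∑ i, (F i).totalDegree := by
    have h3 : ∑ i, ((F i).totalDegree - 1 + 1) = ∑ i, (F i).totalDegree :=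
      Finset.sum_congr rfl fun i _ => Nat.sub_add_cancel (hd i)
    rw [Finset.sum_add_distrib] at h3
    simpa using h3
  exact_mod_cast (by omega : ∑ i, ((F i).totalDegree - 1) + 1 + n = ∑ i, (F i).totalDegree + 1)

theorem genDReg_homogPoly_le_psDegree (n m : ℕ) (F : Fin m → MvPolynomial (Fin n) K)
    (hd : ∀ i, 0 < (F i).totalDegree) (h : IsGenCryptoSemiRegular (fun i => homogPoly (F i))) :
    genDReg (Ideal.span (Set.range fun i => homogPoly (F i))) ≤
      psDegree (truncPos (hilbertSeriesQuot (fun i => (F i).totalDegree) (n + 1))) + 1 := by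
  have := genDReg_le_psDegree (fun i => (F i).totalDegree) (fun i => isHomogeneous_homogPoly (F i))
    (fun i => homogPoly_ne_zero (ne_zero_of_totalDegree_pos (hd i))) hd h
  rwa [Fintype.card_option, Fintype.card_fin] at this

theorem maxGBDeg_homogenization_le_of_le (n m : ℕ) (F : Fin m → MvPolynomial (Fin n) K)
    (ord : MonomialOrder.{0, v} (Fin n)) (hord : ord.IsGraded) (hd : ∀ i, 0 < (F i).totalDegree)
    (hA : IsArtinianQuotient (Ideal.span (Set.range fun i => topPart (F i))))
    (h : IsCryptoSemiRegular (fun i => topPart (F i))) (δ : ℕ) (hδ : ∀ i, (F i).totalDegree ≤ δ)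
    (hm : m = n ∨ n < m ∧ IsGenCryptoSemiRegular (fun i => homogPoly (F i))) :
    maxGBDeg ord.homogenization (Ideal.span (Set.range fun i => homogPoly (F i))) ≤
      (n + 1) * (δ - 1) + 1 := by
  have hnm : Fintype.card (Fin n) ≤ m := by rw [Fintype.card_fin]; omega
  have hle := maxGBDeg_homogenization_le hord hA
  have hD := dReg_le_of_isCryptoSemiRegular (fun i => (F i).totalDegree)
    (fun i => isHomogeneous_topPart (F i))
    (fun i => topPart_ne_zero (ne_zero_of_totalDegree_pos (hd i))) hd hA h hnm
  have hg : genDReg (Ideal.span (Set.range fun i => homogPoly (F i))) ≤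
      (((n + 1) * (δ - 1) + 1 : ℕ) : ℕ∞) := by
    rcases hm with rfl | ⟨hlt, hgen⟩
    · rw [(dReg_and_genDReg_of_card_eq hd hA h).2]
      refine Nat.cast_le.2 ((sum_sub_one_le hδ).trans ?_)
      rw [add_mul]
      omega
    -- The ring of F^h has n + 1 variables, and m > n supplies the n + 1 forms needed; their degrees
    -- give the factor n + 1.
    · have hcard : Fintype.card (Option (Fin n)) = n + 1 := by
        rw [Fintype.card_option, Fintype.card_fin]
      refine (genDReg_le_of_isGenCryptoSemiRegular (fun i => (F i).totalDegree)
        (fun i => isHomogeneous_homogPoly (F i))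
        (fun i => homogPoly_ne_zero (ne_zero_of_totalDegree_pos (hd i))) hd hgen
        (hcard.le.trans hlt)).trans (Nat.cast_le.2 (Nat.add_le_add_right ?_ 1))
      refine (sum_sub_one_le fun i => hδ _).trans ?_
      rw [hcard]
  have hD' : dReg (Ideal.span (Set.range fun i => topPart (F i))) ≤
      (((n + 1) * (δ - 1) + 1 : ℕ) : ℕ∞) := by
    refine hD.trans (Nat.cast_le.2 (Nat.add_le_add_right ?_ 1))
    refine (sum_sub_one_le fun i => hδ _).trans ?_
    rw [Fintype.card_fin, add_mul]
    omega
  exact Nat.cast_le.1 (hle.trans (max_le hD' hg))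

end DegreeBounds

/-! ## Building arithmetic computation trees -/

namespace ArithTree

/-- Renaming the registers of a tree. -/
def rename {K : Type u} {O : Type} : {ι κ : Type} → (ι → κ) → ArithTree K O ι → ArithTree K O κ
  | _, _, f, ret out => ret fun o => f (out o)
  | _, _, f, const c next => const c (next.rename (Option.map f))
  | _, _, f, add a b next => add (f a) (f b) (next.rename (Option.map f))
  | _, _, f, sub a b next => sub (f a) (f b) (next.rename (Option.map f))
  | _, _, f, mul a b next => mul (f a) (f b) (next.rename (Option.map f))
  | _, _, f, div a b next => div (f a) (f b) (next.rename (Option.map f))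
  | _, _, f, ifZero a p q => ifZero (f a) (p.rename f) (q.rename f)

theorem cost_rename {K : Type u} {O ι κ : Type} (f : ι → κ) (T : ArithTree K O ι) :
    (T.rename f).cost = T.cost := by
  induction T generalizing κ <;> simp_all [rename, cost]

theorem push_comp_map {L : Type u} {ι κ : Type} (f : ι → κ) (x : L) (v : κ → L) :
    push x v ∘ Option.map f = push x (v ∘ f) := by
  funext o
  cases o <;> rfl

theorem eval_rename {K L : Type u} [Field K] [Field L] [Algebra K L] {O ι κ : Type} (f : ι → κ)
    (T : ArithTree K O ι) (v : κ → L) : (T.rename f).eval v = T.eval (v ∘ f) := by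
  induction T generalizing κ with
  | ret out => rfl
  | const c next ih => simp [rename, eval, ih, push_comp_map]
  | add a b next ih => simp [rename, eval, ih, push_comp_map]
  | sub a b next ih => simp [rename, eval, ih, push_comp_map]
  | mul a b next ih => simp [rename, eval, ih, push_comp_map]
  | div a b next ih => simp [rename, eval, ih, push_comp_map]
  | ifZero a p q ihp ihq => simp [rename, eval, ihp, ihq]

/-- `S L v a w`: on input `v`, the outcome with branching information `a` and values `w` is
acceptable. -/
abbrev Spec (K : Type u) [Field K] (ι α β : Type) : Type (u + 1) :=
  ∀ (L : Type u) [Field L] [Algebra K L], (ι → L) → α → (β → L) → Prop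

/-- With `c` operations one can reach a state that is acceptable for `S`, whatever the continuation
and whatever the other registers. The inputs stand in the registers `f`. -/
def Doable (K : Type u) [Field K] {ι α β : Type} (c : ℕ) (S : Spec K ι α β) : Prop :=
  ∀ (O κ : Type) (f : ι → κ) (C : ℕ) (k : α → ArithTree K O (β ⊕ κ)), (∀ a, (k a).cost ≤ C) →
    ∃ T : ArithTree K O κ, T.cost ≤ c + C ∧
      ∀ (L : Type u) [Field L] [Algebra K L] (v : κ → L), ∃ (a : α) (w : β → L),
        S L (v ∘ f) a w ∧ T.eval v = (k a).eval (Sum.elim w v)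

section

variable {K : Type u} [Field K] {ι ι' α α' β β' : Type}

theorem Doable.comap {c : ℕ} {S : Spec K ι α β} (h : Doable K c S) (g : ι → ι') :
    Doable K c (fun L _ _ (v : ι' → L) a w => S L (v ∘ g) a w) :=
  fun O κ f C k hk => h O κ (f ∘ g) C k hk

theorem Doable.mono {c c' : ℕ} {S S' : Spec K ι α β} (h : Doable K c S) (hc : c ≤ c')
    (hS : ∀ (L : Type u) [Field L] [Algebra K L] (v : ι → L) (a : α) (w : β → L),
      S L v a w → S' L v a w) : Doable K c' S' := by
  intro O κ f C k hk
  obtain ⟨T, hT, hTv⟩ := h O κ f C k hk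
  refine ⟨T, hT.trans (Nat.add_le_add_right hc C), fun L _ _ v => ?_⟩
  obtain ⟨a, w, h1, h2⟩ := hTv L v
  exact ⟨a, w, hS L _ a w h1, h2⟩

/-- On a path of the first tree the outcome `a` is fixed, so the second computation may be chosen
depending on it and is grafted there as the continuation. Its cost bound has to be uniform in `a`,
since the most expensive path counts. -/
theorem Doable.bind {c c' : ℕ} {S : Spec K ι α β} {S₂ : α → Spec K (β ⊕ ι) α' β'}
    (h : Doable K c S) (h₂ : ∀ a, Doable K c' (S₂ a)) :
    Doable K (c + c') (fun L _ _ v a' w' => ∃ a w, S L v a w ∧ S₂ a L (Sum.elim w v) a' w') := by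
  intro O κ f C k hk
  have hk' : ∀ (_ : α) (a' : α'), ((k a').rename (Sum.map id Sum.inr : β' ⊕ κ → β' ⊕ (β ⊕ κ))).cost ≤ C :=
    fun _ a' => by rw [cost_rename]; exact hk a'
  choose k₁ hk₁ hk₁v using fun a => h₂ a O (β ⊕ κ) (Sum.map id f) C _ (hk' a)
  obtain ⟨T, hT, hTv⟩ := h O κ f (c' + C) k₁ hk₁
  refine ⟨T, by omega, fun L _ _ v => ?_⟩
  obtain ⟨a, w, h1, h2⟩ := hTv L v
  obtain ⟨a', w', h3, h4⟩ := hk₁v a L (Sum.elim w v)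
  refine ⟨a', w', ⟨a, w, h1, ?_⟩, ?_⟩
  · rwa [Sum.elim_comp_map, Function.comp_id] at h3
  · rw [h2, h4, eval_rename, Sum.elim_comp_map, Function.comp_id]
    rfl

theorem Doable.pure {S : Spec K ι α β} (a : α) (out : β → ι)
    (h : ∀ (L : Type u) [Field L] [Algebra K L] (v : ι → L), S L v a (v ∘ out)) :
    Doable K 0 S := by
  intro O κ f C k hk
  refine ⟨(k a).rename (Sum.elim (f ∘ out) id), by rw [cost_rename, zero_add]; exact hk a,
    fun L _ _ v => ⟨a, v ∘ f ∘ out, h L _, ?_⟩⟩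
  rw [eval_rename, Sum.comp_elim, Function.comp_id]

theorem Doable.ifZero {c : ℕ} {S S' : Spec K ι α β} (r : ι) (h : Doable K c S)
    (h' : Doable K c S') :
    Doable K (c + 1) (fun L _ _ v a w => (v r = 0 → S L v a w) ∧ (v r ≠ 0 → S' L v a w)) := by
  intro O κ f C k hk
  obtain ⟨T, hT, hTv⟩ := h O κ f C k hk
  obtain ⟨T', hT', hTv'⟩ := h' O κ f C k hk
  refine ⟨.ifZero (f r) T T', by rw [cost]; omega, fun L _ _ v => ?_⟩
  by_cases hz : v (f r) = 0
  · obtain ⟨a, w, h1, h2⟩ := hTv L v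
    exact ⟨a, w, ⟨fun _ => h1, fun h => absurd hz h⟩, by rw [eval, if_pos hz, h2]⟩
  · obtain ⟨a, w, h1, h2⟩ := hTv' L v
    exact ⟨a, w, ⟨fun h => absurd h hz, fun _ => h1⟩, by rw [eval, if_neg hz, h2]⟩

/-- A function of the registers. -/
abbrev Fn (K : Type u) [Field K] (ι β : Type) : Type (u + 1) :=
  ∀ (L : Type u) [Field L] [Algebra K L], (ι → L) → β → L

/-- The function `g` of the registers can be computed with `c` operations. -/
def Computes (K : Type u) [Field K] {ι β : Type} (c : ℕ) (g : Fn K ι β) : Prop :=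
  Doable (α := Unit) K c (fun L _ _ v _ w => w = g L v)

theorem Computes.select (out : β → ι) : Computes K 0 (fun _ _ _ v => v ∘ out) :=
  Doable.pure () out fun _ _ _ _ => rfl

theorem Computes.mono {c c' : ℕ} {g g' : Fn K ι β} (h : Computes K c g) (hc : c ≤ c')
    (hg : ∀ (L : Type u) [Field L] [Algebra K L] (v : ι → L), g L v = g' L v) : Computes K c' g' :=
  Doable.mono h hc fun L _ _ v _ w hw => by rw [hw, hg]

theorem Computes.comap {c : ℕ} {g : Fn K ι β} (h : Computes K c g) (f : ι → ι') :
    Computes K c (fun L _ _ (v : ι' → L) => g L (v ∘ f)) :=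
  Doable.comap h f

theorem Computes.bind {c c' : ℕ} {g : Fn K ι β} {S : Spec K (β ⊕ ι) α' β'} (h : Computes K c g)
    (h₂ : Doable K c' S) : Doable K (c + c') (fun L _ _ v a w => S L (Sum.elim (g L v) v) a w) :=
  (Doable.bind h fun _ => h₂).mono le_rfl fun L _ _ v a w ⟨_, w', h1, h2⟩ => by
    rwa [h1] at h2

theorem Computes.comp {c c' : ℕ} {g : Fn K ι β} {g' : Fn K β β'} (h : Computes K c g)
    (h' : Computes K c' g') : Computes K (c + c') (fun L _ _ v => g' L (g L v)) :=
  h.bind (h'.comap (Sum.inl : β → β ⊕ ι))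

theorem Computes.sumElim {c c' : ℕ} {g : Fn K ι β} {g' : Fn K ι β'} (h : Computes K c g)
    (h' : Computes K c' g') : Computes K (c + c') (fun L _ _ v => Sum.elim (g L v) (g' L v)) := by
  have h1 : Computes K (c' + 0) (fun L _ _ (v : β ⊕ ι → L) =>
      Sum.elim (v ∘ Sum.inl) (g' L (v ∘ Sum.inr))) :=
    ((h'.comap (Sum.inr : ι → β ⊕ ι)).bind (Computes.select
      (Sum.elim (fun b => Sum.inr (Sum.inl b)) Sum.inl :
        β ⊕ β' → β' ⊕ (β ⊕ ι)))).mono le_rfl fun L _ _ v _ w hw => by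
          rw [hw]
          funext o
          cases o <;> rfl
  exact h.bind h1

/-- An operation that puts one value into a new register. -/
theorem Computes.of_op {c : ℕ} {g : Fn K ι Unit}
    (op : ∀ {O κ : Type}, (ι → κ) → ArithTree K O (Option κ) → ArithTree K O κ)
    (hc : ∀ {O κ : Type} (f : ι → κ) (T : ArithTree K O (Option κ)), (op f T).cost ≤ c + T.cost)
    (hop : ∀ {O κ : Type} (f : ι → κ) (T : ArithTree K O (Option κ)) (L : Type u) [Field L]
      [Algebra K L] (v : κ → L), (op f T).eval v = T.eval (push (g L (v ∘ f) ()) v)) :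
    Computes K c g := by
  intro O κ f C k hk
  refine ⟨op f ((k ()).rename (Sum.elim (fun _ => none) some)), ?_, fun L _ _ v =>
    ⟨(), g L (v ∘ f), rfl, ?_⟩⟩
  · refine (hc f _).trans ?_
    rw [cost_rename]
    exact Nat.add_le_add_left (hk ()) c
  · rw [hop, eval_rename]
    congr 1
    funext o
    cases o <;> rfl

theorem Computes.const (x : K) : Computes (ι := ι) (β := Unit) K 0
    (fun L _ _ _ _ => algebraMap K L x) :=
  Computes.of_op (fun _ T => .const x T) (fun _ T => by simp [cost])
    fun f T L _ _ v => by rw [eval]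

theorem Computes.sub (a b : ι) : Computes (β := Unit) K 1 (fun _ _ _ v _ => v a - v b) :=
  Computes.of_op (fun f T => .sub (f a) (f b) T) (fun _ T => by rw [cost]; omega)
    fun f T L _ _ v => by rw [eval]; rfl

theorem Computes.div (a b : ι) : Computes (β := Unit) K 1 (fun _ _ _ v _ => v a / v b) :=
  Computes.of_op (fun f T => .div (f a) (f b) T) (fun _ T => by rw [cost]; omega)
    fun f T L _ _ v => by rw [eval]; rfl

theorem Computes.zero : Computes (ι := ι) (β := Unit) K 0 (fun _ _ _ _ _ => 0) :=
  (Computes.const 0).mono le_rfl fun L _ _ _ => by simp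

theorem Computes.one : Computes (ι := ι) (β := Unit) K 0 (fun _ _ _ _ _ => 1) :=
  (Computes.const 1).mono le_rfl fun L _ _ _ => by simp

theorem Computes.read (r : ι) : Computes (β := Unit) K 0 (fun _ _ _ v _ => v r) :=
  Computes.select fun _ => r

theorem Computes.neg (r : ι) : Computes (β := Unit) K 1 (fun _ _ _ v _ => -v r) :=
  ((Computes.zero (K := K) (ι := ι)).bind
    (Computes.sub (Sum.inl () : Unit ⊕ ι) (Sum.inr r))).mono le_rfl
    fun L _ _ v _ w hw => by rw [hw]; funext; simp

theorem Computes.inv (r : ι) : Computes (β := Unit) K 1 (fun _ _ _ v _ => (v r)⁻¹) :=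
  ((Computes.one (K := K) (ι := ι)).bind
    (Computes.div (Sum.inl () : Unit ⊕ ι) (Sum.inr r))).mono le_rfl
    fun L _ _ v _ w hw => by rw [hw]; funext; simp

theorem Computes.pi [Fintype β] (c : β → ℕ) (g : Fn K ι β)
    (h : ∀ b, Computes (β := Unit) K (c b) (fun L _ _ v _ => g L v b)) :
    Computes K (∑ b, c b) g := by
  classical
  have key : ∀ s : Finset β, Computes (β := {b // b ∈ s}) K (∑ b ∈ s, c b)
      (fun L _ _ v b => g L v b.1) := by
    intro s
    induction s using Finset.induction_on with
    | empty =>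
      exact (Computes.select (fun b : {b // b ∈ (∅ : Finset β)} =>
        absurd b.2 (Finset.notMem_empty _))).mono le_rfl fun L _ _ v => by
          funext b
          exact absurd b.2 (Finset.notMem_empty _)
    | insert b s hb ih =>
      rw [Finset.sum_insert hb]
      refine (((h b).sumElim ih).comp (Computes.select (fun x : {x // x ∈ insert b s} =>
        if hx : x.1 ∈ s then Sum.inr ⟨x.1, hx⟩ else Sum.inl ()))).mono (by omega) ?_
      intro L _ _ v
      funext x
      simp only [Function.comp_apply]
      split_ifs with hx
      · rfl
      · have : x.1 = b := (Finset.mem_insert.1 x.2).resolve_right hx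
        rw [this]
        rfl
  exact ((key Finset.univ).comp (Computes.select fun b => ⟨b, Finset.mem_univ b⟩)).mono
    (by omega) fun L _ _ v => rfl

/-- The continuation is grafted onto every leaf, so the costs of the longest paths add. -/
theorem Computes.of_tree (P : ArithTree K β ι) : Computes K P.cost (fun _ _ _ v => P.eval v) := by
  -- `f` locates the inputs of the tree and `f'` the registers kept for the continuation. Both must
  -- vary in the induction, because every operation enlarges the set of registers.
  have key : ∀ {ι : Type} (P : ArithTree K β ι) (O κ κ' : Type) (f : ι → κ') (f' : κ → κ')
      (k : ArithTree K O (β ⊕ κ)), ∃ T : ArithTree K O κ', T.cost ≤ P.cost + k.cost ∧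
      ∀ (L : Type u) [Field L] [Algebra K L] (v : κ' → L),
        T.eval v = k.eval (Sum.elim (P.eval (v ∘ f)) (v ∘ f')) := by
    intro ι P
    have hpush : ∀ {L : Type u} {ι κ' : Type} (x : L) (f : ι → κ') (v : κ' → L),
        push x v ∘ (fun o : Option ι => o.elim none (some ∘ f)) = push x (v ∘ f) := by
      intro L ι κ' x f v
      funext o
      cases o <;> rfl
    induction P with
    | ret out =>
      intro O κ κ' f f' k
      refine ⟨k.rename (Sum.elim (f ∘ out) f'), by rw [cost_rename]; simp [cost], ?_⟩
      intro L _ _ v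
      rw [eval_rename, Sum.comp_elim]
      rfl
    | const c next ih =>
      intro O κ κ' f f' k
      obtain ⟨T, hT, hv⟩ := ih O κ (Option κ') (fun o => o.elim none (some ∘ f)) (some ∘ f') k
      exact ⟨.const c T, by simp only [cost]; omega, fun L _ _ v => by
        simp only [eval]
        rw [hv, hpush]
        rfl⟩
    | add a b next ih =>
      intro O κ κ' f f' k
      obtain ⟨T, hT, hv⟩ := ih O κ (Option κ') (fun o => o.elim none (some ∘ f)) (some ∘ f') k
      exact ⟨.add (f a) (f b) T, by simp only [cost]; omega, fun L _ _ v => by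
        simp only [eval]
        rw [hv, hpush]
        rfl⟩
    | sub a b next ih =>
      intro O κ κ' f f' k
      obtain ⟨T, hT, hv⟩ := ih O κ (Option κ') (fun o => o.elim none (some ∘ f)) (some ∘ f') k
      exact ⟨.sub (f a) (f b) T, by simp only [cost]; omega, fun L _ _ v => by
        simp only [eval]
        rw [hv, hpush]
        rfl⟩
    | mul a b next ih =>
      intro O κ κ' f f' k
      obtain ⟨T, hT, hv⟩ := ih O κ (Option κ') (fun o => o.elim none (some ∘ f)) (some ∘ f') k
      exact ⟨.mul (f a) (f b) T, by simp only [cost]; omega, fun L _ _ v => by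
        simp only [eval]
        rw [hv, hpush]
        rfl⟩
    | div a b next ih =>
      intro O κ κ' f f' k
      obtain ⟨T, hT, hv⟩ := ih O κ (Option κ') (fun o => o.elim none (some ∘ f)) (some ∘ f') k
      exact ⟨.div (f a) (f b) T, by simp only [cost]; omega, fun L _ _ v => by
        simp only [eval]
        rw [hv, hpush]
        rfl⟩
    | ifZero a p q ihp ihq =>
      intro O κ κ' f f' k
      obtain ⟨T, hT, hv⟩ := ihp O κ κ' f f' k
      obtain ⟨T', hT', hv'⟩ := ihq O κ κ' f f' k
      refine ⟨.ifZero (f a) T T', by simp only [cost]; omega, fun L _ _ v => ?_⟩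
      by_cases h : v (f a) = 0
      · simp [eval, h, hv]
      · simp [eval, h, hv']
  intro O κ f C k hk
  obtain ⟨T, hT, hv⟩ := key P O κ κ f id (k ())
  exact ⟨T, hT.trans (Nat.add_le_add_left (hk ()) _), fun L _ _ v =>
    ⟨(), P.eval (v ∘ f), rfl, hv L v⟩⟩

theorem Doable.exists_tree {c : ℕ} {S : Spec K ι Unit β} (h : Doable K c S) :
    ∃ T : ArithTree K β ι, T.cost ≤ c ∧
      ∀ (L : Type u) [Field L] [Algebra K L] (v : ι → L), S L v () (T.eval v) := by
  obtain ⟨T, hT, hv⟩ := h β ι id 0 (fun _ => .ret Sum.inl) (fun _ => by simp [cost])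
  refine ⟨T, hT, fun L _ _ v => ?_⟩
  obtain ⟨⟨⟩, w, h1, h2⟩ := hv L v
  rw [h2]
  exact h1

end

end ArithTree

/-! ## Gaussian elimination by blocks -/

section Elimination

variable {I J : Type} [Fintype I] [DecidableEq I] [LinearOrder J] {L : Type u} [Field L]

/-- The matrix is the identity outside the block `S × S`. -/
def IdOff (S : Finset I) (X : Matrix I I L) : Prop :=
  ∀ i j, (i ∉ S ∨ j ∉ S) → X i j = (1 : Matrix I I L) i j

theorem IdOff.mono {S S' : Finset I} {X : Matrix I I L} (h : IdOff S X) (hS : S ⊆ S') :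
    IdOff S' X :=
  fun i j hij => h i j (hij.imp (fun h h' => h (hS h')) (fun h h' => h (hS h')))

theorem IdOff.mul_apply_of_notMem {S : Finset I} {X : Matrix I I L} (h : IdOff S X)
    {κ : Type} (Y : Matrix I κ L) {i : I} (hi : i ∉ S) (c : κ) : (X * Y) i c = Y i c := by
  rw [Matrix.mul_apply]
  simp_rw [h i _ (Or.inl hi)]
  rw [← Matrix.mul_apply, Matrix.one_mul]

theorem IdOff.mul_apply_of_mem {S : Finset I} {X : Matrix I I L} (h : IdOff S X)
    {κ : Type} (Y : Matrix I κ L) {i : I} (hi : i ∈ S) (c : κ) :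
    (X * Y) i c = ∑ j ∈ S, X i j * Y j c := by
  rw [Matrix.mul_apply]
  refine (Finset.sum_subset (Finset.subset_univ S) fun j _ hj => ?_).symm
  rw [h i j (Or.inr hj), Matrix.one_apply_ne (by rintro rfl; exact hj hi), zero_mul]

theorem IdOff.mul {S : Finset I} {X Y : Matrix I I L} (hX : IdOff S X) (hY : IdOff S Y) :
    IdOff S (X * Y) := by
  intro i j hij
  by_cases hi : i ∈ S
  · have hj : j ∉ S := hij.resolve_left fun h => h hi
    rw [Matrix.mul_apply]
    simp_rw [hY _ j (Or.inr hj)]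
    rw [← Matrix.mul_apply, Matrix.mul_one, hX i j hij]
  · rw [hX.mul_apply_of_notMem Y hi, hY i j hij]

/-- The row operations `U` on the rows in `S` bring the columns `dn i` of the rows `i ∈ S` of `A`
into reduced echelon form up to the order of the rows. Row `i` has its pivot in column `piv i`, or
has become zero if `piv i = none`. -/
structure IsElim (S : Finset I) (dn : I → Finset J) (A : Matrix I J L) (piv : I → Option J)
    (U : Matrix I I L) : Prop where
  exists_inv : ∃ V : Matrix I I L, V * U = 1
  idOff : IdOff S U
  mem : ∀ i p, piv i = some p → i ∈ S ∧ p ∈ dn i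
  one : ∀ i p, piv i = some p → (U * A) i p = 1
  zero : ∀ i p, piv i = some p → ∀ i' ∈ S, i' ≠ i → (U * A) i' p = 0
  left : ∀ i p, piv i = some p → ∀ c ∈ dn i, c < p → (U * A) i c = 0
  noPivot : ∀ i ∈ S, piv i = none → ∀ c ∈ dn i, (U * A) i c = 0

/-- To the right of its pivot a row has no condition of its own to satisfy, so such columns may be
declared treated for free. -/
theorem IsElim.congr_dn {S : Finset I} {dn dn' : I → Finset J} {A : Matrix I J L}
    {piv : I → Option J} {U : Matrix I I L} (h : IsElim S dn A piv U)
    (hp : ∀ i p, piv i = some p → p ∈ dn' i)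
    (hdn : ∀ i ∈ S, ∀ c ∈ dn' i, c ∈ dn i ∨ ∃ p, piv i = some p ∧ p < c) :
    IsElim S dn' A piv U where
  exists_inv := h.exists_inv
  idOff := h.idOff
  mem i p hip := ⟨(h.mem i p hip).1, hp i p hip⟩
  one := h.one
  zero := h.zero
  left i p hip c hc hcp := by
    rcases hdn i (h.mem i p hip).1 c hc with hc' | ⟨q, hq, hqc⟩
    · exact h.left i p hip c hc' hcp
    · rw [hip, Option.some_inj] at hq
      exact absurd hcp (hq ▸ hqc).not_gt
  noPivot i hi hip c hc := by
    rcases hdn i hi c hc with hc' | ⟨q, hq, -⟩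
    · exact h.noPivot i hi hip c hc'
    · rw [hip] at hq
      cases hq

/-- The conditions read only the entries in the block of rows `S` and columns `T`, so a matrix
computed on that block alone is good enough. -/
theorem IsElim.congr_matrix {S : Finset I} {T : Finset J} {A A' : Matrix I J L}
    {piv : I → Option J} {U : Matrix I I L} (h : IsElim S (fun _ => T) A piv U)
    (hA : ∀ i ∈ S, ∀ c ∈ T, A i c = A' i c) : IsElim S (fun _ => T) A' piv U := by
  have key : ∀ i ∈ S, ∀ c ∈ T, (U * A') i c = (U * A) i c := by
    intro i hi c hc
    rw [h.idOff.mul_apply_of_mem _ hi, h.idOff.mul_apply_of_mem _ hi]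
    exact Finset.sum_congr rfl fun j hj => by rw [hA j hj c hc]
  exact
    { exists_inv := h.exists_inv
      idOff := h.idOff
      mem := h.mem
      one := fun i p hip => by rw [key i (h.mem i p hip).1 p (h.mem i p hip).2, h.one i p hip]
      zero := fun i p hip i' hi' hne => by
        rw [key i' hi' p (h.mem i p hip).2, h.zero i p hip i' hi' hne]
      left := fun i p hip c hc hcp => by
        rw [key i (h.mem i p hip).1 c hc, h.left i p hip c hc hcp]
      noPivot := fun i hi hip c hc => by rw [key i hi c hc, h.noPivot i hi hip c hc] }

theorem isElim_empty (S : Finset I) (A : Matrix I J L) :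
    IsElim S (fun _ => ∅) A (fun _ => none) (1 : Matrix I I L) where
  exists_inv := ⟨1, Matrix.mul_one 1⟩
  idOff _ _ _ := rfl
  mem _ _ h := by cases h
  one _ _ h := by cases h
  zero _ _ h := by cases h
  left _ _ h := by cases h
  noPivot _ _ _ c hc := absurd hc (Finset.notMem_empty c)

/-- The row operations that clear the pivot columns of the rows in `B` from the other rows
in `S`. -/
def clearMatrix (S B : Finset I) (piv : I → Option J) (P : Matrix I J L) : Matrix I I L :=
  fun i j => if i ∈ S ∧ i ∉ B ∧ j ∈ B then (piv j).elim 0 fun p => -P i p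
    else if i = j then 1 else 0

theorem clearMatrix_mul_apply_of_notMem {S B : Finset I} (piv : I → Option J) (P : Matrix I J L)
    {κ : Type} (Q : Matrix I κ L) {i : I} (hi : i ∉ S ∨ i ∈ B) (c : κ) :
    (clearMatrix S B piv P * Q) i c = Q i c := by
  have : ∀ j, clearMatrix S B piv P i j = (1 : Matrix I I L) i j := fun j => by
    rw [clearMatrix, if_neg (by tauto), Matrix.one_apply]
  rw [Matrix.mul_apply]
  simp_rw [this]
  rw [← Matrix.mul_apply, Matrix.one_mul]

theorem clearMatrix_mul_apply_of_mem {S B : Finset I} (piv : I → Option J) (P : Matrix I J L)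
    {κ : Type} (Q : Matrix I κ L) {i : I} (hi : i ∈ S) (hiB : i ∉ B) (c : κ) :
    (clearMatrix S B piv P * Q) i c =
      Q i c - ∑ j ∈ B, (piv j).elim 0 (fun p => P i p) * Q j c := by
  have : ∀ j, clearMatrix S B piv P i j =
      (1 : Matrix I I L) i j - if j ∈ B then (piv j).elim 0 (fun p => P i p) else 0 := fun j => by
    rw [clearMatrix, Matrix.one_apply]
    by_cases hj : j ∈ B
    · have hij : i ≠ j := by rintro rfl; exact hiB hj
      rw [if_pos ⟨hi, hiB, hj⟩, if_neg hij, if_pos hj]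
      cases piv j <;> simp
    · rw [if_neg (by tauto), if_neg hj, sub_zero]
  rw [Matrix.mul_apply]
  simp_rw [this, sub_mul]
  rw [Finset.sum_sub_distrib, ← Matrix.mul_apply, Matrix.one_mul]
  simp_rw [ite_mul, zero_mul]
  rw [Finset.sum_ite_mem, Finset.univ_inter]

theorem idOff_clearMatrix {S B : Finset I} (hB : B ⊆ S) (piv : I → Option J) (P : Matrix I J L) :
    IdOff S (clearMatrix S B piv P) := by
  intro i j hij
  rw [clearMatrix, if_neg, Matrix.one_apply]
  rintro ⟨hi, -, hj⟩
  rcases hij with h | h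
  · exact h hi
  · exact h (hB hj)

/-- The rows in `B` stay unchanged, so the multiples subtracted from the other rows can be added
back. The inverse only witnesses that the row space is preserved; it is never computed. -/
theorem exists_inv_clearMatrix (S B : Finset I) (piv : I → Option J) (P : Matrix I J L) :
    ∃ V, V * clearMatrix S B piv P = 1 := by
  refine ⟨clearMatrix S B piv (-P), ?_⟩
  ext i c
  by_cases h : i ∉ S ∨ i ∈ B
  · rw [clearMatrix_mul_apply_of_notMem _ _ _ h, clearMatrix, if_neg (by tauto), Matrix.one_apply]
  · rw [not_or, not_not] at h
    have hrow : ∀ j ∈ B, clearMatrix S B piv P j c = (1 : Matrix I I L) j c := fun j hj => by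
      rw [clearMatrix, if_neg (by tauto), Matrix.one_apply]
    rw [clearMatrix_mul_apply_of_mem _ _ _ h.1 h.2, Finset.sum_congr rfl fun j hj => by
      rw [hrow j hj]]
    have h1 := clearMatrix_mul_apply_of_mem piv P (1 : Matrix I I L) h.1 h.2 c
    rw [Matrix.mul_one] at h1
    rw [h1, sub_sub, ← Finset.sum_add_distrib, Finset.sum_eq_zero, sub_zero]
    intro j _
    cases piv j <;> simp

/-- One stage of the elimination: the unfinished rows `B` are treated in the columns `T`, and the
new pivot columns are cleared in the other rows. -/
theorem IsElim.stage {S B : Finset I} {T : Finset J} {dn : I → Finset J} {A : Matrix I J L}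
    {piv piv' : I → Option J} {U U' : Matrix I I L} (h : IsElim S dn A piv U) (hB : B ⊆ S)
    (hBp : ∀ i ∈ B, piv i = none) (hBdn : ∀ i ∈ B, ∀ j ∈ B, dn i = dn j)
    (hdn : ∀ i ∈ S, i ∉ B → ∀ c ∈ dn i, ∀ q ∈ T, q ∈ dn i ∨ c < q)
    (hdnB : ∀ i ∈ S, i ∉ B → ∀ j ∈ B, dn i ⊆ dn j ∪ T)
    (h' : IsElim B (fun _ => T) (U * A) piv' U') :
    IsElim S (fun i => if i ∈ B then dn i ∪ T else dn i) A
      (fun i => if i ∈ B then piv' i else piv i)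
      (clearMatrix S B piv' (U' * (U * A)) * (U' * U)) := by
  set R := U * A with hR
  set P := U' * R with hP
  set E := clearMatrix S B piv' P with hE
  have hQ : E * (U' * U) * A = E * P := by rw [Matrix.mul_assoc, Matrix.mul_assoc]
  have hPR : ∀ i, i ∉ B → ∀ c, P i c = R i c := fun i hi c => h'.idOff.mul_apply_of_notMem R hi c
  -- Row operations inside `B` keep a column zero on `B`; this protects the columns treated earlier
  -- and the old pivot columns.
  have hP0 : ∀ i ∈ B, ∀ c, (∀ j ∈ B, R j c = 0) → P i c = 0 := by
    intro i hi c hc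
    rw [hP, h'.idOff.mul_apply_of_mem R hi]
    exact Finset.sum_eq_zero fun j hj => by rw [hc j hj, mul_zero]
  have hR0 : ∀ i ∈ B, ∀ c ∈ dn i, ∀ j ∈ B, R j c = 0 := fun i hi c hc j hj =>
    h.noPivot j (hB hj) (hBp j hj) c (hBdn i hi j hj ▸ hc)
  have hleft : ∀ j ∈ B, ∀ q, piv' j = some q → ∀ c ∈ dn j ∪ T, c < q → P j c = 0 := by
    intro j hj q hq c hc hcq
    rcases Finset.mem_union.1 hc with hc | hc
    · exact hP0 j hj c (hR0 j hj c hc)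
    · exact h'.left j q hq c hc hcq
  have hQB : ∀ i, i ∉ S ∨ i ∈ B → ∀ c, (E * P) i c = P i c := fun i hi c =>
    clearMatrix_mul_apply_of_notMem _ _ _ hi c
  have hQS : ∀ i ∈ S, i ∉ B → ∀ c, (E * P) i c =
      R i c - ∑ j ∈ B, (piv' j).elim 0 (fun p => R i p) * P j c := fun i hi hiB c => by
    rw [hE, clearMatrix_mul_apply_of_mem _ _ _ hi hiB, hPR i hiB]
    simp_rw [hPR i hiB]
  -- Clearing alters row i in column c only through a new pivot q for which both R i q and P j c are
  -- nonzero.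
  have hQ0 : ∀ i ∈ S, i ∉ B → ∀ c, (∀ j ∈ B, ∀ q, piv' j = some q → R i q = 0 ∨ P j c = 0) →
      (E * P) i c = R i c := by
    intro i hi hiB c hc
    rw [hQS i hi hiB, Finset.sum_eq_zero, sub_zero]
    intro j hj
    cases hq : piv' j with
    | none => simp
    | some q =>
      rcases hc j hj q hq with h0 | h0 <;> simp [h0]
  have hold : ∀ i p, i ∉ B → piv i = some p → ∀ j ∈ B, P j p = 0 := fun i p hiB hip j hj =>
    hP0 j hj p fun j' hj' => h.zero i p hip j' (hB hj') (by rintro rfl; exact hiB hj')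
  constructor
  · obtain ⟨V, hV⟩ := h.exists_inv
    obtain ⟨V', hV'⟩ := h'.exists_inv
    obtain ⟨W, hW⟩ := exists_inv_clearMatrix S B piv' P
    refine ⟨V * V' * W, ?_⟩
    calc V * V' * W * (E * (U' * U)) = V * (V' * (W * E) * U') * U := by
          simp only [Matrix.mul_assoc]
      _ = 1 := by rw [hE, hW, Matrix.mul_one, hV', Matrix.mul_one, hV]
  · exact (idOff_clearMatrix hB _ _).mul ((h'.idOff.mono hB).mul h.idOff)
  · intro i p hip
    by_cases hi : i ∈ B
    · simp only [if_pos hi] at hip ⊢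
      exact ⟨hB hi, Finset.mem_union_right _ (h'.mem i p hip).2⟩
    · simp only [if_neg hi] at hip ⊢
      exact h.mem i p hip
  · intro i p hip
    rw [hQ]
    by_cases hi : i ∈ B
    · rw [if_pos hi] at hip
      rw [hQB i (Or.inr hi)]
      exact h'.one i p hip
    · rw [if_neg hi] at hip
      rw [hQ0 i (h.mem i p hip).1 hi p fun j hj _ _ => Or.inr (hold i p hi hip j hj)]
      exact h.one i p hip
  · intro i p hip i' hi' hne
    rw [hQ]
    by_cases hi : i ∈ B
    · rw [if_pos hi] at hip
      by_cases hi'B : i' ∈ B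
      · rw [hQB i' (Or.inr hi'B)]
        exact h'.zero i p hip i' hi'B hne
      · have h1 : P i p = 1 := h'.one i p hip
        have h0 : ∀ j ∈ B, j ≠ i → P j p = 0 := h'.zero i p hip
        rw [hQS i' hi' hi'B, Finset.sum_eq_single i, hip, h1, mul_one]
        · exact sub_self _
        · intro j hj hji
          rw [h0 j hj hji, mul_zero]
        · exact fun h => absurd hi h
    · rw [if_neg hi] at hip
      by_cases hi'B : i' ∈ B
      · rw [hQB i' (Or.inr hi'B), hold i p hi hip i' hi'B]
      · rw [hQ0 i' hi' hi'B p fun j hj _ _ => Or.inr (hold i p hi hip j hj)]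
        exact h.zero i p hip i' hi' hne
  · intro i p hip c hc hcp
    rw [hQ]
    by_cases hi : i ∈ B
    · simp only [if_pos hi] at hip hc
      rw [hQB i (Or.inr hi), hleft i hi p hip c hc hcp]
    · simp only [if_neg hi] at hip hc
      have hiS := (h.mem i p hip).1
      rw [hQ0 i hiS hi c]
      · exact h.left i p hip c hc hcp
      -- If c is left of the new pivot q, the new pivot row vanishes at c. Otherwise q ≤ c < p, and
      -- q is a treated column of row i left of its pivot p, so nothing is subtracted.
      intro j hj q hq
      by_cases hcq : c < q
      · exact Or.inr (hleft j hj q hq c (hdnB i hiS hi j hj hc) hcq)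
      · have hqd := (hdn i hiS hi c hc q (h'.mem j q hq).2).resolve_right hcq
        exact Or.inl (h.left i p hip q hqd (lt_of_le_of_lt (not_lt.1 hcq) hcp))
  · intro i hiS hip c hc
    rw [hQ]
    by_cases hi : i ∈ B
    · simp only [if_pos hi] at hip hc
      rw [hQB i (Or.inr hi)]
      rcases Finset.mem_union.1 hc with hc | hc
      · exact hP0 i hi c (hR0 i hi c hc)
      · exact h'.noPivot i hi hip c hc
    · simp only [if_neg hi] at hip hc
      rw [hQ0 i hiS hi c]
      · exact h.noPivot i hiS hip c hc
      intro j hj q hq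
      rcases hdn i hiS hi c hc q (h'.mem j q hq).2 with hqd | hcq
      · exact Or.inl (h.noPivot i hiS hip q hqd)
      · exact Or.inr (hleft j hj q hq c (hdnB i hiS hi j hj hc) hcq)

/-- The leftmost columns. Splitting the columns this way puts all pivots of the second half to the
right of the columns treated first, as a stage requires. -/
theorem exists_initial_subset (T : Finset J) {a : ℕ} (ha : a ≤ T.card) :
    ∃ T₁ ⊆ T, T₁.card = a ∧ ∀ x ∈ T₁, ∀ y ∈ T \ T₁, x < y := by
  induction a with
  | zero => exact ⟨∅, Finset.empty_subset _, rfl, by simp⟩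
  | succ a ih =>
    obtain ⟨T₁, hT₁, hcard, hlt⟩ := ih (by omega)
    have hne : (T \ T₁).Nonempty := by
      rw [← Finset.card_pos, Finset.card_sdiff_of_subset hT₁]
      omega
    have hmin := Finset.min'_mem _ hne
    set x := (T \ T₁).min' hne
    have hx := Finset.mem_sdiff.1 hmin
    refine ⟨insert x T₁, Finset.insert_subset hx.1 hT₁, by
      rw [Finset.card_insert_of_notMem hx.2, hcard], ?_⟩
    intro z hz y hy
    rw [Finset.mem_sdiff, Finset.mem_insert, not_or] at hy
    have hy' : y ∈ T \ T₁ := Finset.mem_sdiff.2 ⟨hy.1, hy.2.2⟩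
    rcases Finset.mem_insert.1 hz with rfl | hz
    · exact lt_of_le_of_ne (Finset.min'_le _ y hy') (Ne.symm hy.2.1)
    · exact hlt z hz y hy'

end Elimination

/-! ### Block elimination as a computation tree -/

namespace ArithTree

section

variable {K : Type u} [Field K] {I J : Type} [Fintype I] [DecidableEq I] [LinearOrder J]

/-- `N × N` matrices can be multiplied with at most `c` operations. -/
def MatMulCost (K : Type u) [Field K] (N c : ℕ) : Prop :=
  ∃ P : ArithTree K (Fin N × Fin N) ((Fin N × Fin N) ⊕ (Fin N × Fin N)), P.cost ≤ c ∧
    ∀ (L : Type u) [Field L] [Algebra K L] (A B : Matrix (Fin N) (Fin N) L) (i j : Fin N),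
      P.eval (Sum.elim (fun p => A p.1 p.2) (fun p => B p.1 p.2)) (i, j) = (A * B) i j

/-- The matrix whose entries are the given values. -/
def toMatrix {L : Type u} {I J : Type} (v : I × J → L) : Matrix I J L := fun i j => v (i, j)

/-- The product of an `I × I` matrix and an `I × J` matrix, computed on the block `S × T`. -/
def blockMul (K : Type u) [Field K] {J : Type} [DecidableEq J] (S : Finset I) (T : Finset J) :
    Fn K ((I × I) ⊕ (I × J)) (I × J) := fun _ _ _ v p =>
  if p.1 ∈ S ∧ p.2 ∈ T then ∑ j ∈ S, v (Sum.inl (p.1, j)) * v (Sum.inr (j, p.2))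
  else v (Sum.inr p)

theorem blockMul_apply {L : Type u} [Field L] [Algebra K L] {S : Finset I} {T : Finset J}
    {x : I × I → L} {y : I × J → L} (hx : IdOff S (toMatrix x)) (i : I) {c : J} (hc : c ∈ T) :
    blockMul K S T L (Sum.elim x y) (i, c) = (toMatrix x * toMatrix y) i c := by
  by_cases hi : i ∈ S
  · rw [hx.mul_apply_of_mem _ hi, blockMul, if_pos ⟨hi, hc⟩]
    rfl
  · rw [hx.mul_apply_of_notMem _ hi, blockMul, if_neg fun h => hi h.1]
    rfl

theorem toMatrix_blockMul {L : Type u} [Field L] [Algebra K L] {S : Finset I}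
    {x y : I × I → L} (hx : IdOff S (toMatrix x)) (hy : IdOff S (toMatrix y)) :
    toMatrix (blockMul K S S L (Sum.elim x y)) = toMatrix x * toMatrix y := by
  ext i c
  by_cases h : i ∈ S ∧ c ∈ S
  · rw [hx.mul_apply_of_mem _ h.1, toMatrix, blockMul, if_pos h]
    rfl
  · rw [toMatrix, blockMul, if_neg h]
    exact (hy i c (by tauto)).trans ((hx.mul hy) i c (by tauto)).symm

theorem toMatrix_blockMul_univ {L : Type u} [Field L] [Algebra K L] [Fintype J] {S : Finset I}
    {x : I × I → L} {y : I × J → L} (hx : IdOff S (toMatrix x)) :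
    toMatrix (blockMul K S Finset.univ L (Sum.elim x y)) = toMatrix x * toMatrix y := by
  ext i c
  exact blockMul_apply hx i (Finset.mem_univ c)

/-- Both blocks are padded with zeros to N × N, which costs nothing, and multiplied by one run of
the given tree. Entries outside the target block are copied. -/
theorem computes_blockMul {J : Type} [DecidableEq J] [Fintype J] {N c : ℕ} (hP : MatMulCost K N c)
    {S : Finset I} {T : Finset J} (hS : S.card ≤ N) (hT : T.card ≤ N) :
    Computes K c (blockMul K S T) := by
  obtain ⟨P, hPc, hPv⟩ := hP
  obtain ⟨eS⟩ : Nonempty (S ↪ Fin N) := Function.Embedding.nonempty_of_card_le (by simpa)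
  obtain ⟨eT⟩ : Nonempty (T ↪ Fin N) := Function.Embedding.nonempty_of_card_le (by simpa)
  let fS := Function.partialInv eS
  let fT := Function.partialInv eT
  have hfS : ∀ i, fS (eS i) = some i := Function.partialInv_left eS.injective
  have hfT : ∀ i, fT (eT i) = some i := Function.partialInv_left eT.injective
  let X : ∀ (L : Type u) [Field L] [Algebra K L], ((I × I) ⊕ (I × J) → L) →
      Matrix (Fin N) (Fin N) L := fun L _ _ v p q =>
    (fS p).elim 0 fun i => (fS q).elim 0 fun j => v (Sum.inl (i.1, j.1))
  let Y : ∀ (L : Type u) [Field L] [Algebra K L], ((I × I) ⊕ (I × J) → L) →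
      Matrix (Fin N) (Fin N) L := fun L _ _ v p q =>
    (fS p).elim 0 fun i => (fT q).elim 0 fun j => v (Sum.inr (i.1, j.1))
  have hX : Computes K 0 (fun L _ _ v (p : Fin N × Fin N) => X L v p.1 p.2) := by
    refine (Computes.pi (fun _ => 0) _ fun p => ?_).mono (by simp) fun _ _ _ _ => rfl
    simp only [X]
    cases fS p.1 with
    | none => exact Computes.zero
    | some i =>
      cases fS p.2 with
      | none => exact Computes.zero
      | some j => exact Computes.read _
  have hY : Computes K 0 (fun L _ _ v (p : Fin N × Fin N) => Y L v p.1 p.2) := by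
    refine (Computes.pi (fun _ => 0) _ fun p => ?_).mono (by simp) fun _ _ _ _ => rfl
    simp only [Y]
    cases fS p.1 with
    | none => exact Computes.zero
    | some i =>
      cases fT p.2 with
      | none => exact Computes.zero
      | some j => exact Computes.read _
  have h1 := ((hX.sumElim hY).comp (Computes.of_tree P)).sumElim
    (Computes.select (K := K) (id : (I × I) ⊕ (I × J) → (I × I) ⊕ (I × J)))
  refine (h1.comp (Computes.select fun p : I × J =>
    if h : p.1 ∈ S ∧ p.2 ∈ T then Sum.inl (eS ⟨p.1, h.1⟩, eT ⟨p.2, h.2⟩)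
    else Sum.inr (Sum.inr p))).mono (by omega) fun L _ _ v => ?_
  funext p
  rw [blockMul, Function.comp_apply]
  split_ifs with h
  · rw [Sum.elim_inl, hPv, Matrix.mul_apply]
    rw [← Finset.sum_coe_sort S (fun j => v (Sum.inl (p.1, j)) * v (Sum.inr (j, p.2)))]
    refine (Fintype.sum_of_injective eS eS.injective _ _ (fun q hq => ?_) fun j => ?_).symm
    · have : fS q = none := dif_neg fun ⟨i, hi⟩ => hq ⟨i, hi⟩
      simp [X, Y, this]
    · simp [X, Y, hfS, hfT]
  · rfl

/-- The matrix of the row operations that clear the pivot columns, as a function of the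
registers. -/
def clearFn (K : Type u) [Field K] (S B : Finset I) (piv : I → Option J) :
    Fn K (I × J) (I × I) :=
  fun _ _ _ v p => clearMatrix S B piv (toMatrix v) p.1 p.2

/-- Off `S × S` the entries are constants; inside, each costs at most one negation. -/
theorem computes_clearFn [Fintype J] {S B : Finset I} (hB : B ⊆ S) (piv : I → Option J) :
    Computes K (S.card * S.card) (clearFn K S B piv) := by
  refine (Computes.pi (fun p : I × I => if p ∈ S ×ˢ S then 1 else 0) _ fun p => ?_).mono
    (by rw [Finset.sum_ite_mem, Finset.univ_inter, Finset.sum_const, Finset.card_product,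
      smul_eq_mul, mul_one]) fun _ _ _ _ => rfl
  simp only [clearFn, clearMatrix]
  by_cases h : p.1 ∈ S ∧ p.1 ∉ B ∧ p.2 ∈ B
  · have hp : p ∈ S ×ˢ S := Finset.mem_product.2 ⟨h.1, hB h.2.2⟩
    simp only [if_pos h, if_pos hp]
    cases piv p.2 with
    | none => exact Computes.zero.mono zero_le fun _ _ _ _ => rfl
    | some q => exact Computes.neg _
  · simp only [if_neg h]
    by_cases h' : p.1 = p.2
    · simp only [if_pos h']
      exact Computes.one.mono zero_le fun _ _ _ _ => rfl
    · simp only [if_neg h']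
      exact Computes.zero.mono zero_le fun _ _ _ _ => rfl

/-- The specification of elimination on the block `S × T`. -/
def elimSpec (K : Type u) [Field K] (S : Finset I) (T : Finset J) :
    Spec K (I × J) (I → Option J) (I × I) :=
  fun _ _ _ v piv w => IsElim S (fun _ => T) (toMatrix v) piv (toMatrix w)

theorem Computes.withStatic {ι α β : Type} {c : ℕ} {g : Fn K ι β} (h : Computes K c g) (a : α) :
    Doable K c (fun L _ _ v a' w => a' = a ∧ w = g L v) :=
  (Doable.bind h fun _ => Doable.pure (S := fun L _ _ v a' w => a' = a ∧ w = v ∘ Sum.inl) a Sum.inl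
    fun _ _ _ _ => ⟨rfl, rfl⟩).mono le_rfl fun L _ _ v a' w ⟨_, w', h1, h2, h3⟩ =>
      ⟨h2, by rw [h3, Sum.elim_comp_inl, h1]⟩

/-- One stage of the elimination, see `IsElim.stage`. The registers hold the row operations found so
far and the original matrix. -/
theorem doable_stage [Fintype J] {N c e : ℕ} (hP : MatMulCost K N c) {S B : Finset I}
    {T T' : Finset J} (hS : S.card ≤ N) (hT : T.card ≤ N) (hB : B ⊆ S) (hT' : T' ⊆ T)
    (hE : Doable K e (elimSpec K B T')) (piv : I → Option J) :
    Doable K (e + 5 * c + N * N) (fun L _ _ (v : (I × I) ⊕ (I × J) → L) piv' w =>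
      ∀ dn : I → Finset J, (∀ i ∈ B, piv i = none) → (∀ i ∈ B, ∀ j ∈ B, dn i = dn j) →
        (∀ i ∈ S, i ∉ B → ∀ c ∈ dn i, ∀ q ∈ T', q ∈ dn i ∨ c < q) →
        (∀ i ∈ S, i ∉ B → ∀ j ∈ B, dn i ⊆ dn j ∪ T') →
        IsElim S dn (toMatrix (v ∘ Sum.inr)) piv (toMatrix (v ∘ Sum.inl)) →
        IsElim S (fun i => if i ∈ B then dn i ∪ T' else dn i) (toMatrix (v ∘ Sum.inr)) piv'
          (toMatrix w) ∧ ∀ i, i ∉ B → piv' i = piv i) := by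
  have hR := computes_blockMul hP hS hT
  have hE' := hR.bind (hE.comap (Sum.inl : I × J → (I × J) ⊕ ((I × I) ⊕ (I × J))))
  -- Five products in all: U * A in `hE'`, and here U * A once more, U' * (U * A), U' * U, and the
  -- product with the clearing matrix.
  have hfin : ∀ piv₁ : I → Option J, Computes K (4 * c + N * N)
      (fun L _ _ (v : (I × I) ⊕ ((I × I) ⊕ (I × J)) → L) =>
        blockMul K S S L (Sum.elim
          (clearFn K S B piv₁ L (blockMul K S T L (Sum.elim (v ∘ Sum.inl)
            (blockMul K S T L (v ∘ Sum.inr)))))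
          (blockMul K S S L (Sum.elim (v ∘ Sum.inl) (v ∘ Sum.inr ∘ Sum.inl))))) := by
    intro piv₁
    have h1 := ((Computes.select (K := K)
      (Sum.inl : I × I → (I × I) ⊕ ((I × I) ⊕ (I × J)))).sumElim (hR.comap Sum.inr)).comp hR
    have h2 := h1.comp (computes_clearFn hB piv₁)
    have hSS := computes_blockMul hP hS hS
    have h3 := ((Computes.select (K := K)
      (Sum.inl : I × I → (I × I) ⊕ ((I × I) ⊕ (I × J)))).sumElim
        (Computes.select (Sum.inr ∘ Sum.inl))).comp hSS
    have hcard := Nat.mul_le_mul hS hS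
    exact ((h2.sumElim h3).comp hSS).mono (by omega) fun _ _ _ _ => rfl
  refine (Doable.bind hE' fun piv₁ =>
    (hfin piv₁).withStatic fun i => if i ∈ B then piv₁ i else piv i).mono (by omega) ?_
  rintro L _ _ v piv' w ⟨piv₁, w₁, hw₁, rfl, rfl⟩ dn hBp hBdn hdn hdnB h
  refine ⟨?_, fun i hi => if_neg hi⟩
  have hv : v = Sum.elim (v ∘ Sum.inl) (v ∘ Sum.inr) := (Sum.elim_comp_inl_inr v).symm
  set u := v ∘ Sum.inl
  set a := v ∘ Sum.inr
  have hw₁' : IsElim B (fun _ => T') (toMatrix u * toMatrix a) piv₁ (toMatrix w₁) := by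
    refine IsElim.congr_matrix hw₁ fun i _ c hc => ?_
    rw [Sum.elim_comp_inl, hv]
    exact blockMul_apply h.idOff i (hT' hc)
  have hw₁S := hw₁'.idOff.mono hB
  convert h.stage hB hBp hBdn hdn hdnB hw₁' using 1
  rw [Sum.elim_comp_inl, Sum.elim_comp_inr, ← Function.comp_assoc, Sum.elim_comp_inr]
  have hclear : toMatrix (clearFn K S B piv₁ L (blockMul K S T L
      (Sum.elim w₁ (blockMul K S T L v)))) =
      clearMatrix S B piv₁ (toMatrix w₁ * (toMatrix u * toMatrix a)) := by
    -- The products are only computed in the columns `T`. This suffices, as the clearing matrix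
    -- reads only pivot columns, which lie in `T'`.
    have hPP : ∀ i, ∀ c ∈ T, blockMul K S T L (Sum.elim w₁ (blockMul K S T L v)) (i, c) =
        (toMatrix w₁ * (toMatrix u * toMatrix a)) i c := by
      intro i c hc
      rw [blockMul_apply hw₁S i hc, Matrix.mul_apply, Matrix.mul_apply]
      refine Finset.sum_congr rfl fun j _ => ?_
      rw [← blockMul_apply (K := K) h.idOff j hc, ← hv]
      rfl
    ext i j
    change clearMatrix S B piv₁ (toMatrix (blockMul K S T L
      (Sum.elim w₁ (blockMul K S T L v)))) i j = _
    unfold clearMatrix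
    by_cases hij : i ∈ S ∧ i ∉ B ∧ j ∈ B
    · rw [if_pos hij, if_pos hij]
      cases hq : piv₁ j with
      | none => rfl
      | some q => exact congrArg Neg.neg (hPP i q (hT' (hw₁'.mem j q hq).2))
    · rw [if_neg hij, if_neg hij]
  rw [toMatrix_blockMul, toMatrix_blockMul hw₁S h.idOff, hclear]
  · rw [hclear]
    exact idOff_clearMatrix hB _ _
  · rw [toMatrix_blockMul hw₁S h.idOff]
    exact hw₁S.mul h.idOff

end

end ArithTree

section

variable {I J : Type} [Fintype I] [DecidableEq I] [LinearOrder J] {L : Type u} [Field L]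

theorem isElim_one_of_forall_eq_zero {S : Finset I} {T : Finset J} {A : Matrix I J L}
    (h : ∀ i ∈ S, ∀ c ∈ T, A i c = 0) :
    IsElim S (fun _ => T) A (fun _ => none) (1 : Matrix I I L) where
  exists_inv := ⟨1, Matrix.mul_one 1⟩
  idOff _ _ _ := rfl
  mem _ _ h := by cases h
  one _ _ h := by cases h
  zero _ _ h := by cases h
  left _ _ h := by cases h
  noPivot i hi _ c hc := by rw [Matrix.one_mul, h i hi c hc]

theorem isElim_singleton {i₀ : I} {p₀ : J} {A : Matrix I J L} (h : A i₀ p₀ ≠ 0) :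
    IsElim {i₀} (fun _ => {p₀}) A (fun i => if i = i₀ then some p₀ else none)
      (fun i j => if i = i₀ ∧ j = i₀ then (A i₀ p₀)⁻¹ else (1 : Matrix I I L) i j) := by
  have hid : IdOff {i₀}
      (fun i j => if i = i₀ ∧ j = i₀ then (A i₀ p₀)⁻¹ else (1 : Matrix I I L) i j) := by
    intro i j hij
    rw [Finset.mem_singleton, Finset.mem_singleton] at hij
    exact if_neg (by tauto)
  have hpiv : ∀ i p, (if i = i₀ then some p₀ else none) = some p → i = i₀ ∧ p = p₀ := by
    intro i p hip
    split_ifs at hip with hi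
    exact ⟨hi, (Option.some_inj.1 hip).symm⟩
  refine ⟨⟨fun i j => if i = i₀ ∧ j = i₀ then A i₀ p₀ else (1 : Matrix I I L) i j, ?_⟩, hid, ?_, ?_,
    ?_, ?_, ?_⟩
  · have hid' : IdOff {i₀}
        (fun i j => if i = i₀ ∧ j = i₀ then A i₀ p₀ else (1 : Matrix I I L) i j) := by
      intro i j hij
      rw [Finset.mem_singleton, Finset.mem_singleton] at hij
      exact if_neg (by tauto)
    ext i j
    by_cases hij : i = i₀ ∧ j = i₀
    · obtain ⟨rfl, rfl⟩ := hij
      refine (hid'.mul_apply_of_mem _ (Finset.mem_singleton_self _) _).trans ?_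
      simp [h]
    · exact (hid'.mul hid) i j (by rw [Finset.mem_singleton, Finset.mem_singleton]; tauto)
  · intro i p hip
    simp [hpiv i p hip]
  · intro i p hip
    obtain ⟨rfl, rfl⟩ := hpiv i p hip
    rw [hid.mul_apply_of_mem _ (Finset.mem_singleton_self _)]
    simp [h]
  · intro i p hip i' hi' hne
    exact absurd ((Finset.mem_singleton.1 hi').trans (hpiv i p hip).1.symm) hne
  · intro i p hip c hc hcp
    rw [(hpiv i p hip).2, Finset.mem_singleton.1 hc] at hcp
    exact absurd hcp (lt_irrefl _)
  · intro i hi hip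
    simp [Finset.mem_singleton.1 hi] at hip

end

namespace ArithTree

section

variable {K : Type u} [Field K] {I J : Type} [Fintype I] [DecidableEq I] [LinearOrder J]

theorem computes_one_matrix {ι : Type} :
    Computes (K := K) (ι := ι) 0 (fun L _ _ _ (p : I × I) => (1 : Matrix I I L) p.1 p.2) := by
  refine (Computes.pi (fun _ => 0) _ fun p => ?_).mono (by simp) fun _ _ _ _ => rfl
  simp only [Matrix.one_apply]
  split_ifs
  · exact Computes.one
  · exact Computes.zero

/-- One zero test and one inversion settle a single entry; an empty block needs nothing. -/
theorem doable_elim_of_card_le_one {S : Finset I} {T : Finset J} (hS : S.card ≤ 1)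
    (hT : T.card ≤ 1) : Doable K 2 (elimSpec K S T) := by
  have htriv : Doable K 1 (fun L _ _ (v : I × J → L) piv w =>
      (∀ i ∈ S, ∀ c ∈ T, v (i, c) = 0) → elimSpec K S T L v piv w) :=
    ((computes_one_matrix (K := K) (I := I) (ι := I × J)).withStatic
      (fun _ : I => (none : Option J))).mono zero_le fun L _ _ v piv w hw h => by
        rw [hw.1, hw.2]
        exact isElim_one_of_forall_eq_zero h
  by_cases h : ∃ i₀ p₀, S = {i₀} ∧ T = {p₀}
  · obtain ⟨i₀, p₀, rfl, rfl⟩ := h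
    have hpiv : Computes K 1 (fun L _ _ (v : I × J → L) (p : I × I) =>
        if p.1 = i₀ ∧ p.2 = i₀ then (v (i₀, p₀))⁻¹ else (1 : Matrix I I L) p.1 p.2) := by
      refine (Computes.pi (fun p : I × I => if p ∈ {(i₀, i₀)} then 1 else 0) _ fun p => ?_).mono
        (c := ∑ p : I × I, if p ∈ ({(i₀, i₀)} : Finset (I × I)) then 1 else 0)
        (by rw [Finset.sum_ite_mem]; simp) fun _ _ _ _ => rfl
      by_cases hp : p = (i₀, i₀)
      · subst hp
        simp only [true_and, if_true, Finset.mem_singleton]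
        exact Computes.inv _
      · have hp' : ¬ (p.1 = i₀ ∧ p.2 = i₀) := fun h => hp (Prod.ext h.1 h.2)
        simp only [if_neg hp', Matrix.one_apply]
        by_cases h : p.1 = p.2
        · simp only [if_pos h]
          exact Computes.one.mono zero_le fun _ _ _ _ => rfl
        · simp only [if_neg h]
          exact Computes.zero.mono zero_le fun _ _ _ _ => rfl
    refine (Doable.ifZero (i₀, p₀) htriv
      (hpiv.withStatic fun i => if i = i₀ then some p₀ else none)).mono le_rfl ?_
    rintro L _ _ v piv w ⟨h1, h2⟩
    by_cases hz : v (i₀, p₀) = 0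
    · exact h1 hz (by simpa using hz)
    · obtain ⟨rfl, rfl⟩ := h2 hz
      exact isElim_singleton (A := toMatrix v) hz
  · refine htriv.mono (by omega) fun L _ _ v piv w hw => hw ?_
    intro i hi c hc
    refine absurd ⟨i, c, ?_, ?_⟩ h
    · exact Finset.eq_singleton_iff_unique_mem.2 ⟨hi, fun x hx => Finset.card_le_one.1 hS x hx i hi⟩
    · exact Finset.eq_singleton_iff_unique_mem.2 ⟨hc, fun x hx => Finset.card_le_one.1 hT x hx c hc⟩

/-- Four stages with one half-size call each: the left columns for both halves of the rows, then the
right columns for both halves of the rows still without pivot. The clearing in each stage keeps all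
rows reduced. -/
theorem doable_elim_succ [Fintype J] {k c e : ℕ} (hP : MatMulCost K (2 ^ (k + 1)) c)
    (hE : ∀ (S : Finset I) (T : Finset J), S.card ≤ 2 ^ k → T.card ≤ 2 ^ k →
      Doable K e (elimSpec K S T)) {S : Finset I} {T : Finset J} (hS : S.card ≤ 2 ^ (k + 1))
    (hT : T.card ≤ 2 ^ (k + 1)) :
    Doable K (4 * (e + 5 * c + 2 ^ (k + 1) * 2 ^ (k + 1))) (elimSpec K S T) := by
  have hpow : 2 ^ (k + 1) = 2 ^ k + 2 ^ k := by ring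
  have hsplit : ∀ S' : Finset I, S'.card ≤ 2 ^ (k + 1) →
      ∃ S₁ ⊆ S', S₁.card ≤ 2 ^ k ∧ (S' \ S₁).card ≤ 2 ^ k := by
    intro S' hS'
    obtain ⟨S₁, h1, h2⟩ := Finset.exists_subset_card_eq (min_le_left S'.card (2 ^ k))
    refine ⟨S₁, h1, h2.le.trans (min_le_right _ _), ?_⟩
    rw [Finset.card_sdiff_of_subset h1]
    omega
  obtain ⟨S₁, hS₁, hS₁c, hS₂c⟩ := hsplit S hS
  obtain ⟨T₁, hT₁, hT₁c, hlt⟩ := exists_initial_subset T (min_le_left T.card (2 ^ k))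
  have hT₁c' : T₁.card ≤ 2 ^ k := hT₁c.le.trans (min_le_right _ _)
  have hT₂c : (T \ T₁).card ≤ 2 ^ k := by
    rw [Finset.card_sdiff_of_subset hT₁]
    omega
  have hstage := fun {B : Finset I} {T' : Finset J} (hB : B ⊆ S) (hT' : T' ⊆ T)
    (hBc : B.card ≤ 2 ^ k) (hT'c : T'.card ≤ 2 ^ k) (piv : I → Option J) =>
    doable_stage hP hS hT hB hT' (hE B T' hBc hT'c) piv
  set cs := e + 5 * c + 2 ^ (k + 1) * 2 ^ (k + 1) with hcs
  have d0 := (computes_one_matrix (K := K) (I := I) (ι := I × J)).withStatic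
    (fun _ : I => (none : Option J))
  -- the left half of the columns
  have d1 := Doable.bind d0 (hstage hS₁ hT₁ hS₁c hT₁c')
  have d2 : Doable K (cs + cs) (fun L _ _ (v : I × J → L) piv w =>
      IsElim S (fun _ => T₁) (toMatrix v) piv (toMatrix w)) := by
    refine (Doable.bind d1 (hstage Finset.sdiff_subset hT₁ hS₂c hT₁c')).mono (by omega) ?_
    rintro L _ _ v piv₂ w₂ ⟨piv₁, w₁, ⟨piv₀, w₀, ⟨rfl, rfl⟩, h1⟩, h2⟩
    simp only [Sum.elim_comp_inl, Sum.elim_comp_inr] at h1 h2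
    obtain ⟨h1', h1p⟩ := h1 (fun _ => ∅) (fun _ _ => trivial) (fun _ _ _ _ => rfl)
      (fun _ _ _ c hc => absurd hc (Finset.notMem_empty c))
      (fun _ _ _ _ _ => Finset.empty_subset _) (isElim_empty S _)
    obtain ⟨h2', -⟩ := h2 _ (fun i hi => h1p i (Finset.mem_sdiff.1 hi).2)
      (fun i hi j hj => by
        rw [if_neg (Finset.mem_sdiff.1 hi).2, if_neg (Finset.mem_sdiff.1 hj).2])
      (fun i hi hiB c hc q hq => by
        have hi1 : i ∈ S₁ := by_contra fun h => hiB (Finset.mem_sdiff.2 ⟨hi, h⟩)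
        left
        rw [if_pos hi1]
        exact Finset.mem_union_right _ hq)
      (fun i hi hiB j hj => by
        have hi1 : i ∈ S₁ := by_contra fun h => hiB (Finset.mem_sdiff.2 ⟨hi, h⟩)
        rw [if_pos hi1, if_neg (Finset.mem_sdiff.1 hj).2]) h1'
    have hdn : ∀ i ∈ S, (if i ∈ S \ S₁ then (if i ∈ S₁ then (∅ : Finset J) ∪ T₁ else ∅) ∪ T₁ else
        (if i ∈ S₁ then ∅ ∪ T₁ else ∅)) = T₁ := by
      intro i hi
      by_cases hi1 : i ∈ S₁ <;> simp [hi, hi1]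
    refine h2'.congr_dn (fun i p hip => ?_) (fun i hi c hc => Or.inl ?_)
    · have := h2'.mem i p hip
      exact hdn i this.1 ▸ this.2
    · exact (hdn i hi).symm ▸ hc
  -- the right half of the columns, for the rows without pivot
  have d3 : ∀ piv : I → Option J, Doable K (cs + cs)
      (fun L _ _ (v : (I × I) ⊕ (I × J) → L) piv' w =>
        IsElim S (fun _ => T₁) (toMatrix (v ∘ Sum.inr)) piv (toMatrix (v ∘ Sum.inl)) →
        IsElim S (fun _ => T) (toMatrix (v ∘ Sum.inr)) piv' (toMatrix w)) := by
    intro piv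
    -- All 2^(k+1) rows may still lack a pivot, so they are split again, depending on the pivots
    -- found.
    obtain ⟨B, hB, hBc, hB'c⟩ := hsplit {i ∈ S | piv i = none}
      ((Finset.card_le_card (Finset.filter_subset _ _)).trans hS)
    set S' := {i ∈ S | piv i = none}
    have hS' : S' ⊆ S := Finset.filter_subset _ _
    refine (Doable.bind (hstage (hB.trans hS') Finset.sdiff_subset hBc hT₂c piv) fun piv₃ =>
      (hstage (Finset.sdiff_subset.trans hS') Finset.sdiff_subset hB'c hT₂c piv₃).comap
        (Sum.map id Sum.inr : (I × I) ⊕ (I × J) → (I × I) ⊕ ((I × I) ⊕ (I × J)))).mono le_rfl ?_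
    rintro L _ _ v piv₄ w₄ ⟨piv₃, w₃, h3, h4⟩ h
    simp only [Sum.elim_comp_map, Sum.elim_comp_inl, Sum.elim_comp_inr, Function.comp_id] at h4
    have hnone : ∀ i ∈ S', piv i = none := fun i hi => (Finset.mem_filter.1 hi).2
    obtain ⟨h3', h3p⟩ := h3 (fun _ => T₁) (fun i hi => hnone i (hB hi)) (fun _ _ _ _ => rfl)
      (fun i _ _ c hc q hq => Or.inr (hlt c hc q hq))
      (fun _ _ _ _ _ => Finset.subset_union_left) h
    obtain ⟨h4', h4p⟩ := h4 _
      (fun i hi => (h3p i (Finset.mem_sdiff.1 hi).2).trans (hnone i (Finset.mem_sdiff.1 hi).1))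
      (fun i hi j hj => by
        rw [if_neg (Finset.mem_sdiff.1 hi).2, if_neg (Finset.mem_sdiff.1 hj).2])
      (fun i hi hiB c hc q hq => by
        by_cases hi1 : i ∈ B
        · left
          rw [if_pos hi1]
          exact Finset.mem_union_right _ hq
        · right
          rw [if_neg hi1] at hc
          exact hlt c hc q hq)
      (fun i hi hiB j hj => by
        rw [if_neg (Finset.mem_sdiff.1 hj).2]
        split_ifs
        · exact subset_rfl
        · exact Finset.subset_union_left) h3'
    -- Rows with a pivot among the left columns were not treated in the right ones, but those lie to
    -- the right of their pivot.
    refine h4'.congr_dn (fun i p hip => ?_) (fun i hi c hc => ?_)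
    · have := (h4'.mem i p hip).2
      have hsub : ∀ i, (if i ∈ S' \ B then (if i ∈ B then T₁ ∪ T \ T₁ else T₁) ∪ T \ T₁ else
          (if i ∈ B then T₁ ∪ T \ T₁ else T₁)) ⊆ T := by
        intro i
        split_ifs <;> simp [Finset.union_subset_iff, hT₁]
      exact hsub i this
    · by_cases hiS' : i ∈ S'
      · left
        by_cases hi1 : i ∈ B
        · simp [hi1, hc]
        · simp [hi1, hiS', hc]
      · have hi1 : i ∉ B := fun h => hiS' (hB h)
        have hi2 : i ∉ S' \ B := fun h => hiS' (Finset.mem_sdiff.1 h).1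
        rw [if_neg hi2, if_neg hi1]
        by_cases hc1 : c ∈ T₁
        · exact Or.inl hc1
        · right
          have hpi : piv i ≠ none := fun h => hiS' (Finset.mem_filter.2 ⟨hi, h⟩)
          obtain ⟨p, hp⟩ := Option.ne_none_iff_exists'.1 hpi
          refine ⟨p, by rw [h4p i hi2, h3p i hi1, hp], ?_⟩
          exact hlt p (h.mem i p hp).2 c (Finset.mem_sdiff.2 ⟨hc, hc1⟩)
  refine (Doable.bind d2 d3).mono (by omega) ?_
  rintro L _ _ v piv w ⟨piv₁, w₁, h1, h2⟩
  simp only [Sum.elim_comp_inl, Sum.elim_comp_inr] at h2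
  exact h2 h1

/-- An upper bound for the cost of elimination on blocks of size `2 ^ k`, when multiplication of
matrices of size `2 ^ j` costs `c j`. -/
def elimCost (c : ℕ → ℕ) : ℕ → ℕ
  | 0 => 2
  | k + 1 => 4 * (elimCost c k + 5 * c (k + 1) + 2 ^ (k + 1) * 2 ^ (k + 1))

theorem doable_elim [Fintype J] {c : ℕ → ℕ} (hP : ∀ k, MatMulCost K (2 ^ k) (c k)) (k : ℕ)
    (S : Finset I) (T : Finset J) (hS : S.card ≤ 2 ^ k) (hT : T.card ≤ 2 ^ k) :
    Doable K (elimCost c k) (elimSpec K S T) := by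
  induction k generalizing S T with
  | zero => exact doable_elim_of_card_le_one hS hT
  | succ k ih => exact doable_elim_succ (hP (k + 1)) ih hS hT

end

end ArithTree

/-! ### Elimination by batches of rows and sorting into echelon form -/

section

variable {I J : Type} [Fintype I] [DecidableEq I] [LinearOrder J] {L : Type u} [Field L]

/-- The rows in `S` are in reduced echelon form up to their order. -/
structure IsReducedRows (S : Finset I) (R : Matrix I J L) (piv : I → Option J) : Prop where
  mem : ∀ i p, piv i = some p → i ∈ S
  one : ∀ i p, piv i = some p → R i p = 1
  zero : ∀ i p, piv i = some p → ∀ i' ∈ S, i' ≠ i → R i' p = 0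
  left : ∀ i p, piv i = some p → ∀ c < p, R i c = 0
  noPivot : ∀ i ∈ S, piv i = none → ∀ c, R i c = 0

theorem IsReducedRows.injective {S : Finset I} {R : Matrix I J L} {piv : I → Option J}
    (h : IsReducedRows S R piv) {i i' : I} {p : J} (hi : piv i = some p) (hi' : piv i' = some p) :
    i = i' := by
  by_contra hne
  have h1 := h.zero i p hi i' (h.mem i' p hi') (Ne.symm hne)
  rw [h.one i' p hi'] at h1
  exact one_ne_zero h1

/-- Distinct rows have distinct pivot columns. This bounds the pivot rows that the next elimination
has to carry along. -/
theorem IsReducedRows.card_le [Fintype J] {S : Finset I} {R : Matrix I J L} {piv : I → Option J}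
    (h : IsReducedRows S R piv) :
    (Finset.univ.filter fun i => piv i ≠ none).card ≤ Fintype.card J := by
  have hsome : ∀ i : {i // i ∈ Finset.univ.filter fun i => piv i ≠ none}, ∃ p, piv i = some p :=
    fun i => Option.ne_none_iff_exists'.1 (Finset.mem_filter.1 i.2).2
  choose p hp using hsome
  rw [← Fintype.card_coe]
  refine Fintype.card_le_of_injective p fun i i' hii => Subtype.ext ?_
  exact h.injective (hp i) (hii ▸ hp i')

theorem span_rows_mul_le {κ : Type} [Fintype κ] (X : Matrix I κ L) (Y : Matrix κ J L) :
    Submodule.span L (Set.range fun i => (X * Y) i) ≤ Submodule.span L (Set.range fun i => Y i) := by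
  rw [Submodule.span_le]
  rintro _ ⟨i, rfl⟩
  have : (X * Y) i = ∑ j, X i j • Y j := by
    funext c
    rw [Matrix.mul_apply, Finset.sum_apply]
    rfl
  change (X * Y) i ∈ _
  rw [this]
  exact Submodule.sum_mem _ fun j _ => Submodule.smul_mem _ _ (Submodule.subset_span ⟨j, rfl⟩)

theorem span_rows_mul_eq {U V : Matrix I I L} (h : V * U = 1) (R : Matrix I J L) :
    Submodule.span L (Set.range fun i => (U * R) i) = Submodule.span L (Set.range fun i => R i) := by
  apply le_antisymm (span_rows_mul_le U R)
  have := span_rows_mul_le V (U * R)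
  rwa [← Matrix.mul_assoc, h, Matrix.one_mul] at this

/-- Eliminating with the pivot rows found so far and a block of new rows. -/
theorem IsReducedRows.extend [Fintype J] {S B : Finset I} {R : Matrix I J L}
    {piv piv' : I → Option J} {U : Matrix I I L} (h : IsReducedRows S R piv)
    (h' : IsElim ((Finset.univ.filter fun i => piv i ≠ none) ∪ B) (fun _ => Finset.univ) R piv' U) :
    IsReducedRows (S ∪ B) (U * R) piv' := by
  set S' := (Finset.univ.filter fun i => piv i ≠ none) ∪ B with hS'
  have hsub : S' ⊆ S ∪ B := by
    refine Finset.union_subset_union (fun i hi => ?_) subset_rfl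
    obtain ⟨p, hp⟩ := Option.ne_none_iff_exists'.1 (Finset.mem_filter.1 hi).2
    exact h.mem i p hp
  -- The earlier rows left out of the elimination have no pivot, so they are zero and stay zero.
  have hzero : ∀ i ∈ S ∪ B, i ∉ S' → ∀ c, (U * R) i c = 0 := by
    intro i hi hiS' c
    rw [h'.idOff.mul_apply_of_notMem R hiS']
    have hiB : i ∉ B := fun hb => hiS' (Finset.mem_union_right _ hb)
    refine h.noPivot i ((Finset.mem_union.1 hi).resolve_right hiB) ?_ c
    by_contra hne
    exact hiS' (Finset.mem_union_left _ (Finset.mem_filter.2 ⟨Finset.mem_univ i, hne⟩))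
  constructor
  · exact fun i p hip => hsub (h'.mem i p hip).1
  · exact h'.one
  · intro i p hip i' hi' hne
    by_cases hiS' : i' ∈ S'
    · exact h'.zero i p hip i' hiS' hne
    · exact hzero i' hi' hiS' p
  · exact fun i p hip c hcp => h'.left i p hip c (Finset.mem_univ c) hcp
  · intro i hi hip c
    by_cases hiS' : i ∈ S'
    · exact h'.noPivot i hiS' hip c (Finset.mem_univ c)
    · exact hzero i hi hiS' c

theorem lt_card_filter_iff {k : ℕ} {P : Fin k → Prop} [DecidablePred P]
    (hP : ∀ i j, i ≤ j → P j → P i) (i : Fin k) :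
    (i : ℕ) < (Finset.univ.filter P).card ↔ P i := by
  constructor
  · intro h
    by_contra hi
    have hsub : Finset.univ.filter P ⊆ Finset.Iio i := by
      intro j hj
      rw [Finset.mem_Iio]
      by_contra hle
      exact hi (hP i j (not_lt.1 hle) (Finset.mem_filter.1 hj).2)
    have := Finset.card_le_card hsub
    rw [Fin.card_Iio] at this
    omega
  · intro h
    have hsub : Finset.Iic i ⊆ Finset.univ.filter P := by
      intro j hj
      exact Finset.mem_filter.2 ⟨Finset.mem_univ j, hP j i (Finset.mem_Iic.1 hj) h⟩
    have := Finset.card_le_card hsub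
    rw [Fin.card_Iic] at this
    omega

/-- The pivots as elements of a linear order in which rows without pivot come last. -/
def pivKey {k : ℕ} (piv : Fin k → Option J) (i : Fin k) : WithTop J := piv i

/-- Only the order of the rows is missing. Sorting by pivot column, with ⊤ for rows without pivot,
moves the zero rows to the end. -/
theorem IsReducedRows.isRREF {k : ℕ} {R : Matrix (Fin k) J L} {piv : Fin k → Option J}
    (h : IsReducedRows Finset.univ R piv) :
    IsRREF (· < ·) (fun i => R (Tuple.sort (pivKey piv) i)) := by
  classical
  set τ := Tuple.sort (pivKey piv)
  have hmono : Monotone (pivKey piv ∘ τ) := Tuple.monotone_sort (pivKey piv)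
  have hlow : ∀ i j, i ≤ j → piv (τ j) ≠ none → piv (τ i) ≠ none := by
    intro i j hij hj hi
    have h1 : pivKey piv (τ i) ≤ pivKey piv (τ j) := hmono hij
    rw [show pivKey piv (τ i) = ⊤ from hi, top_le_iff] at h1
    exact hj h1
  set r := (Finset.univ.filter fun i => piv (τ i) ≠ none).card with hr
  have hiff : ∀ i : Fin k, (i : ℕ) < r ↔ piv (τ i) ≠ none := lt_card_filter_iff hlow
  have hrk : r ≤ k := (Finset.card_filter_le _ _).trans (by simp)
  have hsome : ∀ i : Fin r, ∃ p, piv (τ (Fin.castLE hrk i)) = some p := fun i =>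
    Option.ne_none_iff_exists'.1 ((hiff _).1 i.2)
  choose p hp using hsome
  refine ⟨r, hrk, p, fun i j hij => ?_, fun i => h.one _ _ (hp i),
    fun i c hc => h.left _ _ (hp i) c hc, fun i i' hne => ?_, fun i' c hi' => ?_⟩
  · have hkey : ∀ i, pivKey piv (τ (Fin.castLE hrk i)) = (p i : WithTop J) := hp
    have h1 : (p i : WithTop J) ≤ p j := by
      rw [← hkey, ← hkey]
      exact hmono (show Fin.castLE hrk i ≤ Fin.castLE hrk j from hij.le)
    refine lt_of_le_of_ne (WithTop.coe_le_coe.1 h1) fun heq => ?_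
    have := τ.injective (h.injective (hp i) (heq ▸ hp j))
    exact hij.ne (Fin.castLE_injective hrk this)
  · exact h.zero _ _ (hp i) _ (Finset.mem_univ _) fun h => hne (τ.injective h)
  · refine h.noPivot _ (Finset.mem_univ _) ?_ c
    by_contra hne
    exact absurd ((hiff i').2 hne) (not_lt.2 hi')

end

namespace ArithTree

section

variable {K : Type u} [Field K] {I J : Type} [Fintype I] [DecidableEq I] [LinearOrder J] [Fintype J]

/-- The specification of the elimination on the rows in `S`. -/
def rowsSpec (K : Type u) [Field K] (S : Finset I) : Spec K (I × J) (I → Option J) (I × J) :=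
  fun L _ _ v piv w => IsReducedRows S (toMatrix w) piv ∧
    Submodule.span L (Set.range fun i => toMatrix w i) =
      Submodule.span L (Set.range fun i => toMatrix v i)

theorem doable_rows_empty : Doable K 0 (rowsSpec K (I := I) (J := J) ∅) :=
  Doable.pure (fun _ => none) id fun _ _ _ _ =>
    ⟨⟨nofun, nofun, nofun, nofun, fun i hi => absurd hi (Finset.notMem_empty i)⟩, rfl⟩

theorem doable_rows_union {c : ℕ → ℕ} (hP : ∀ k, MatMulCost K (2 ^ k) (c k)) {k : ℕ}
    (hk : 2 * Fintype.card J ≤ 2 ^ k) {S B : Finset I} (hB : B.card ≤ Fintype.card J) {x : ℕ}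
    (h : Doable K x (rowsSpec K (J := J) S)) :
    Doable K (x + (elimCost c k + c k)) (rowsSpec K (J := J) (S ∪ B)) := by
  have hstep : ∀ piv : I → Option J, Doable K (elimCost c k + c k)
      (fun L _ _ (v : (I × J) ⊕ (I × J) → L) piv' w =>
        IsReducedRows S (toMatrix (v ∘ Sum.inl)) piv →
          IsReducedRows (S ∪ B) (toMatrix w) piv' ∧
          Submodule.span L (Set.range fun i => toMatrix w i) =
            Submodule.span L (Set.range fun i => toMatrix (v ∘ Sum.inl) i)) := by
    intro piv
    -- A list of pivots longer than the number of columns never arises from reduced rows, so on such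
    -- a branch any tree will do.
    by_cases hcard : (Finset.univ.filter fun i => piv i ≠ none).card ≤ Fintype.card J
    · set S' := (Finset.univ.filter fun i => piv i ≠ none) ∪ B
      have hS' : S'.card ≤ 2 ^ k := (Finset.card_union_le _ _).trans (by omega)
      have hT : (Finset.univ : Finset J).card ≤ 2 ^ k := by rw [Finset.card_univ]; omega
      refine (Doable.bind ((doable_elim hP k S' Finset.univ hS' hT).comap
        (Sum.inl : I × J → (I × J) ⊕ (I × J))) fun piv' =>
        ((computes_blockMul (hP k) hS' hT).comap
          (Sum.map id Sum.inl : (I × I) ⊕ (I × J) → (I × I) ⊕ ((I × J) ⊕ (I × J)))).withStatic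
          piv').mono le_rfl ?_
      rintro L _ _ v piv' w ⟨piv₁, u, hu, rfl, rfl⟩ hred
      rw [Sum.elim_comp_map, Function.comp_id]
      have hu' : IsElim S' (fun _ => Finset.univ) (toMatrix (v ∘ Sum.inl)) piv' (toMatrix u) := hu
      rw [toMatrix_blockMul_univ hu'.idOff]
      obtain ⟨V, hV⟩ := hu'.exists_inv
      exact ⟨hred.extend hu', span_rows_mul_eq hV _⟩
    · refine (Doable.pure (S := fun L _ _ (v : (I × J) ⊕ (I × J) → L) _ _ =>
        ¬ IsReducedRows S (toMatrix (v ∘ Sum.inl)) piv) piv Sum.inl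
        fun L _ _ v hred => hcard hred.card_le).mono zero_le fun L _ _ v _ w hw hred =>
          absurd hred hw
  refine (Doable.bind h hstep).mono le_rfl ?_
  rintro L _ _ v piv' w' ⟨piv, w, ⟨h1, h2⟩, h3⟩
  rw [Sum.elim_comp_inl] at h3
  obtain ⟨h4, h5⟩ := h3 h1
  exact ⟨h4, h5.trans h2⟩

/-- Each batch is eliminated together with at most as many old pivot rows as there are columns. The
size of the blocks thus does not depend on m, and the cost is linear in m. -/
theorem doable_rows {c : ℕ → ℕ} (hP : ∀ k, MatMulCost K (2 ^ k) (c k)) {k : ℕ}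
    (hk : 2 * Fintype.card J ≤ 2 ^ k) {m : ℕ} (blk : I → Fin m)
    (hblk : ∀ j, (Finset.univ.filter fun i => blk i = j).card ≤ Fintype.card J) :
    Doable K (m * (elimCost c k + c k)) (rowsSpec K (I := I) (J := J) Finset.univ) := by
  have key : ∀ s : Finset (Fin m), Doable K (s.card * (elimCost c k + c k))
      (rowsSpec K (J := J) (Finset.univ.filter fun i => blk i ∈ s)) := by
    intro s
    induction s using Finset.induction_on with
    | empty => simpa using doable_rows_empty
    | insert j s hj ih =>
      rw [Finset.card_insert_of_notMem hj, add_mul, one_mul]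
      have := doable_rows_union hP hk (hblk j) ih
      rwa [← Finset.filter_or, Finset.filter_congr (q := fun i => blk i ∈ insert j s)
        fun i _ => by rw [Finset.mem_insert, or_comm]] at this
  simpa using key Finset.univ

theorem doable_rref {c : ℕ → ℕ} (hP : ∀ k, MatMulCost K (2 ^ k) (c k)) {k : ℕ}
    (hk : 2 * Fintype.card J ≤ 2 ^ k) {m l : ℕ} (blk : Fin l → Fin m)
    (hblk : ∀ j, (Finset.univ.filter fun i => blk i = j).card ≤ Fintype.card J) :
    Doable (α := Unit) K (m * (elimCost c k + c k)) (fun L _ _ (v : Fin l × J → L) _ w =>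
      IsRREFOf (· < ·) (toMatrix w) (toMatrix v)) := by
  refine (Doable.bind (doable_rows hP hk blk hblk) fun piv =>
    Computes.select (fun p : Fin l × J =>
      Sum.inl (Tuple.sort (pivKey piv) p.1, p.2))).mono le_rfl ?_
  rintro L _ _ v _ w' ⟨piv, w, ⟨h1, h2⟩, rfl⟩
  refine ⟨h1.isRREF, ?_⟩
  rw [← h2]
  congr 1
  exact (Tuple.sort (pivKey piv)).surjective.range_comp (fun i => toMatrix w i)

end

end ArithTree

/-! ### Counting the columns of the Macaulay matrix -/

section MacaulayIndices

variable {σ : Type} [Fintype σ]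

/-- An additional variable fills up a monomial of degree at most D to degree exactly D. -/
theorem macaulayCol_finite_and_card_le (σ : Type) [Fintype σ] (D : ℕ) :
    Finite (MacaulayCol σ D) ∧
      Nat.card (MacaulayCol σ D) ≤ (Fintype.card σ + D).choose D := by
  classical
  let f : MacaulayCol σ D → {t // t ∈ (Finset.univ : Finset (Option σ)).finsuppAntidiag D} :=
    fun t => ⟨t.1.optionElim (D - t.1.degree), by
      rw [Finset.mem_finsuppAntidiag]
      refine ⟨?_, Finset.subset_univ _⟩
      rw [← Finsupp.degree_eq_sum, degree_optionElim, Nat.sub_add_cancel t.2]⟩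
  have hf : Function.Injective f := by
    intro s t hst
    have := congrArg (fun x => x.1.some) hst
    simpa [f, Subtype.ext_iff] using this
  refine ⟨Finite.of_injective f hf, (Nat.card_le_card_of_injective f hf).trans ?_⟩
  rw [Nat.card_eq_fintype_card, Fintype.card_coe, Finset.card_finsuppAntidiag_nat_eq_choose,
    Finset.card_univ, Fintype.card_option]
  refine le_of_eq ?_
  congr 1
  omega

instance (D : ℕ) : Finite (MacaulayCol σ D) := (macaulayCol_finite_and_card_le σ D).1

theorem card_macaulayCol_le (σ : Type) [Fintype σ] (D : ℕ) :
    Nat.card (MacaulayCol σ D) ≤ (Fintype.card σ + D).choose D :=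
  (macaulayCol_finite_and_card_le σ D).2

/-- The quotient of the two binomials is (n + 1 + D)/(n + 1), at most c + 1 for D ≤ c n. The
variable y therefore costs only a constant factor. -/
theorem choose_succ_le {n D c : ℕ} (h : D ≤ c * n) :
    (n + 1 + D).choose D ≤ (c + 1) * (n + D).choose D := by
  have h1 := Nat.choose_mul_succ_eq (n + D) D
  rw [show n + D + 1 - D = n + 1 by omega, show n + D + 1 = n + 1 + D by omega] at h1
  refine Nat.le_of_mul_le_mul_right (h1.symm.le.trans ?_) n.succ_pos
  rw [mul_comm (c + 1), mul_assoc]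
  refine Nat.mul_le_mul_left _ ?_
  nlinarith

/-- The columns of a Macaulay matrix from left to right. -/
noncomputable abbrev macaulayColOrder (ord : MonomialOrder.{0, v} σ) (D : ℕ) :
    LinearOrder (MacaulayCol σ D) :=
  LinearOrder.lift' (fun t : MacaulayCol σ D => OrderDual.toDual (ord.toSyn t.1))
    fun _ _ h => Subtype.ext (ord.toSyn.injective (OrderDual.toDual.injective h))

end MacaulayIndices

/-! ### The computation tree for the Macaulay matrix -/

section MacaulayEntries

variable {σ : Type} {K : Type u} [Field K]

open Classical in
theorem coeff_monomial_mul_homogPoly {L : Type u} [Field L] (s t : Option σ →₀ ℕ)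
    {f : MvPolynomial σ L} {d : ℕ} (hf : f.totalDegree = d) :
    coeff t (monomial s 1 * homogPoly f) =
      if s ≤ t ∧ (t - s).degree = d then coeff (t - s).some f else 0 := by
  rw [coeff_monomial_mul', one_mul, coeff_homogPoly, hf, ite_and]

theorem degree_some_le (s : Option σ →₀ ℕ) : s.some.degree ≤ s.degree := by
  have := degree_eq_none_add_degree_some s
  omega

/-- The Macaulay matrix is built from the coefficients without any operation. -/
theorem ArithTree.computes_macaulay [Fintype σ] {m l D : ℕ} (d : Fin m → ℕ)
    (e : Fin l ≃ MacaulayRow (Option σ) d D) :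
    ∃ g : Fn K (CoeffIdx σ d) (Fin l × MacaulayCol (Option σ) D), Computes K 0 g ∧
      ∀ (L : Type u) [Field L] [Algebra K L] (F : Fin m → MvPolynomial σ L),
        (∀ i, (F i).totalDegree = d i) →
        toMatrix (g L (coeffList d F)) = macaulayMatrix (fun i => homogPoly (F i)) d D e := by
  classical
  have := Fintype.ofFinite (MacaulayCol (Option σ) D)
  refine ⟨fun L _ _ v p =>
    if h : (e p.1).1.2 ≤ p.2.1 ∧ (p.2.1 - (e p.1).1.2).degree = d (e p.1).1.1 then
      v ⟨(e p.1).1.1, (p.2.1 - (e p.1).1.2).some, (degree_some_le _).trans h.2.le⟩ else 0, ?_, ?_⟩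
  · refine (Computes.pi (fun _ => 0) _ fun p => ?_).mono (by simp) fun _ _ _ _ => rfl
    by_cases h : (e p.1).1.2 ≤ p.2.1 ∧ (p.2.1 - (e p.1).1.2).degree = d (e p.1).1.1
    · simpa only [dif_pos h] using Computes.read _
    · simpa only [dif_neg h] using Computes.zero
  · intro L _ _ F hF
    funext r t
    rw [macaulayMatrix, coeff_monomial_mul_homogPoly _ _ (hF _)]
    simp only [toMatrix, coeffList, dite_eq_ite]

/-- For a fixed polynomial a row is given by its multiplier, a monomial of degree at most D like
those indexing the columns. -/
theorem card_macaulayRow_le {m l D : ℕ} [Fintype (MacaulayCol (Option σ) D)]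
    (d : Fin m → ℕ) (e : Fin l ≃ MacaulayRow (Option σ) d D) (j : Fin m) :
    (Finset.univ.filter fun r => (e r).1.1 = j).card ≤
      Fintype.card (MacaulayCol (Option σ) D) := by
  rw [← Fintype.card_coe]
  refine Fintype.card_le_of_injective
    (fun r => ⟨(e r.1).1.2, (Nat.le_add_right _ _).trans (e r.1).2⟩) ?_
  intro r r' h
  have hr := (Finset.mem_filter.1 r.2).2
  have hr' := (Finset.mem_filter.1 r'.2).2
  refine Subtype.ext (e.injective (Subtype.ext (Prod.ext (hr.trans hr'.symm) ?_)))
  exact congrArg Subtype.val h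

theorem ArithTree.exists_tree_macaulay [Fintype σ] {c : ℕ → ℕ}
    (hP : ∀ k, MatMulCost K (2 ^ k) (c k)) {m l D k : ℕ} (d : Fin m → ℕ)
    (ord : MonomialOrder.{0, v} (Option σ)) (e : Fin l ≃ MacaulayRow (Option σ) d D)
    (hk : 2 * Nat.card (MacaulayCol (Option σ) D) ≤ 2 ^ k) :
    ∃ P : ArithTree K (Fin l × MacaulayCol (Option σ) D) (CoeffIdx σ d),
      P.cost ≤ m * (elimCost c k + c k) ∧
      ∀ (L : Type u) [Field L] [Algebra K L] (F : Fin m → MvPolynomial σ L),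
        (∀ i, (F i).totalDegree = d i) →
        IsRREFOf (colLeft ord) (toMatrix (P.eval (coeffList d F)))
          (macaulayMatrix (fun i => homogPoly (F i)) d D e) := by
  have := Fintype.ofFinite (MacaulayCol (Option σ) D)
  let _ := macaulayColOrder ord D
  rw [Nat.card_eq_fintype_card] at hk
  obtain ⟨g, hg, hgv⟩ := computes_macaulay (K := K) d e
  obtain ⟨P, hPc, hPv⟩ := (hg.bind ((doable_rref hP hk (fun r => (e r).1.1)
    (card_macaulayRow_le d e)).comap
      (Sum.inl : _ → (Fin l × MacaulayCol (Option σ) D) ⊕ CoeffIdx σ d))).exists_tree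
  refine ⟨P, hPc.trans (zero_add _).le, fun L _ _ F hF => ?_⟩
  have h := hPv L (coeffList d F)
  rw [Sum.elim_comp_inl, hgv L F hF] at h
  exact h

end MacaulayEntries

/-! ### The cost estimate -/

section Cost

/-- The recursion multiplies by 4 and adds at most (20 C + 4) q^(k+1). Induction closes for a
constant B with 4 B + (20 C + 4) q ≤ B q, which exists because q > 4; the summand 2 covers the base
case. -/
theorem ArithTree.elimCost_le {c : ℕ → ℕ} {C q : ℝ} (hC : 0 ≤ C) (hq : 4 < q)
    (h : ∀ k, (c k : ℝ) ≤ C * q ^ k) (k : ℕ) :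
    (elimCost c k : ℝ) ≤ ((20 * C + 4) * q / (q - 4) + 2) * q ^ k := by
  set B := (20 * C + 4) * q / (q - 4) + 2 with hB
  have hq4 : 0 < q - 4 := by linarith
  have hB2 : 0 ≤ (20 * C + 4) * q / (q - 4) :=
    div_nonneg (mul_nonneg (by linarith) (by linarith)) hq4.le
  have hBq : 4 * B + (20 * C + 4) * q ≤ B * q := by
    have : (20 * C + 4) * q / (q - 4) * (q - 4) = (20 * C + 4) * q := div_mul_cancel₀ _ hq4.ne'
    nlinarith
  induction k with
  | zero =>
    rw [elimCost, pow_zero, mul_one]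
    push_cast
    linarith
  | succ k ih =>
    rw [elimCost]
    push_cast
    have h1 := h (k + 1)
    have h4 : (2 : ℝ) ^ (k + 1) * 2 ^ (k + 1) ≤ q ^ (k + 1) := by
      rw [← mul_pow]
      exact pow_le_pow_left₀ (by norm_num) (by linarith) _
    have h5 := mul_le_mul_of_nonneg_right hBq (pow_nonneg (show 0 ≤ q by linarith) k)
    rw [pow_succ q] at h1 h4 ⊢
    nlinarith

theorem MatMulAdmissible.exists_elimCost_le {K : Type u} [Field K] {ω : ℝ}
    (h : MatMulAdmissible K ω) (hω : 2 < ω) :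
    ∃ (c : ℕ → ℕ) (B : ℝ), 0 ≤ B ∧ (∀ k, ArithTree.MatMulCost K (2 ^ k) (c k)) ∧
      ∀ k, ((ArithTree.elimCost c k + c k : ℕ) : ℝ) ≤ B * ((2 : ℝ) ^ k) ^ ω := by
  obtain ⟨C, hC⟩ := h
  choose P hPc hPv using fun k : ℕ => hC (2 ^ k)
  have hq : (4 : ℝ) < 2 ^ ω := by
    have := Real.rpow_lt_rpow_of_exponent_lt (x := 2) (by norm_num) hω
    rwa [Real.rpow_two, show (2 : ℝ) ^ 2 = 4 by norm_num] at this
  have hpow : ∀ k : ℕ, ((2 : ℝ) ^ k) ^ ω = ((2 : ℝ) ^ ω) ^ k := fun k => by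
    rw [← Real.rpow_natCast, ← Real.rpow_natCast, ← Real.rpow_mul (by norm_num),
      ← Real.rpow_mul (by norm_num), mul_comm]
  -- The constant of an admissible exponent is not assumed nonnegative, hence the absolute value.
  have hc : ∀ k, ((P k).cost : ℝ) ≤ |C| * ((2 : ℝ) ^ ω) ^ k := fun k => by
    have := hPc k
    rw [Nat.cast_pow, Nat.cast_ofNat, hpow] at this
    exact this.trans (mul_le_mul_of_nonneg_right (le_abs_self C) (by positivity))
  have hE := ArithTree.elimCost_le (abs_nonneg C) hq hc
  have hB : 0 ≤ (20 * |C| + 4) * 2 ^ ω / (2 ^ ω - 4) :=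
    div_nonneg (by positivity) (by linarith)
  refine ⟨fun k => (P k).cost, (20 * |C| + 4) * 2 ^ ω / (2 ^ ω - 4) + 2 + |C|,
    by positivity, fun k => ⟨P k, le_rfl, hPv k⟩, fun k => ?_⟩
  rw [hpow, Nat.cast_add, add_mul _ |C|]
  exact add_le_add (hE k) (hc k)

theorem exists_two_pow_between {N : ℕ} (hN : 0 < N) : ∃ k, 2 * N ≤ 2 ^ k ∧ 2 ^ k ≤ 4 * N := by
  refine ⟨Nat.clog 2 (2 * N), Nat.le_pow_clog (by norm_num) _, ?_⟩
  have h1 := Nat.pow_pred_clog_lt_self (b := 2) (by norm_num) (x := 2 * N) (by omega)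
  have h2 : 0 < Nat.clog 2 (2 * N) := Nat.clog_pos (by norm_num) (by omega)
  obtain ⟨j, hj⟩ := Nat.exists_eq_add_one.2 h2
  rw [hj] at h1 ⊢
  rw [Nat.pred_eq_sub_one, Nat.add_sub_cancel] at h1
  rw [pow_succ]
  omega

theorem MatMulAdmissible.exists_tree_macaulay {K : Type u} [Field K] {ω : ℝ}
    (h : MatMulAdmissible K ω) (hω : 2 < ω) (c : ℕ) :
    ∃ C : ℝ, ∀ (n m : ℕ) (d : Fin m → ℕ) (D : ℕ) (ord : MonomialOrder.{0, v} (Option (Fin n)))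
      (k : ℕ) (e : Fin k ≃ MacaulayRow (Option (Fin n)) d D), D ≤ c * n →
      ∃ P : ArithTree K (Fin k × MacaulayCol (Option (Fin n)) D) (CoeffIdx (Fin n) d),
        (P.cost : ℝ) ≤ C * (m * ((n + D).choose D : ℝ) ^ ω) ∧
        ∀ (L : Type u) [Field L] [Algebra K L] (F : Fin m → MvPolynomial (Fin n) L),
          (∀ i, (F i).totalDegree = d i) →
          IsRREFOf (colLeft ord) (ArithTree.toMatrix (P.eval (coeffList d F)))
            (macaulayMatrix (fun i => homogPoly (F i)) d D e) := by
  obtain ⟨cost, B, hB, hP, hcost⟩ := h.exists_elimCost_le hω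
  -- The factor 4 comes from rounding twice the number of columns up to a power of two, the factor c
  -- + 1 from the additional variable y.
  refine ⟨B * (4 * (c + 1)) ^ ω, fun n m d D ord l e hD => ?_⟩
  have hne : Nonempty (MacaulayCol (Option (Fin n)) D) := ⟨⟨0, by simp⟩⟩
  obtain ⟨k, hk1, hk2⟩ :=
    exists_two_pow_between (Nat.card_pos (α := MacaulayCol (Option (Fin n)) D))
  obtain ⟨P, hPc, hPv⟩ := ArithTree.exists_tree_macaulay hP d ord e hk1
  refine ⟨P, ?_, hPv⟩
  have hN : (2 : ℝ) ^ k ≤ 4 * (c + 1) * ((n + D).choose D : ℝ) := by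
    have h1 := card_macaulayCol_le (Option (Fin n)) D
    rw [Fintype.card_option, Fintype.card_fin] at h1
    have h2 := h1.trans (choose_succ_le hD)
    have h3 : 2 ^ k ≤ 4 * (c + 1) * (n + D).choose D := by
      rw [mul_assoc]
      omega
    exact_mod_cast h3
  have h4 : ((2 : ℝ) ^ k) ^ ω ≤ (4 * (c + 1)) ^ ω * ((n + D).choose D : ℝ) ^ ω := by
    rw [← Real.mul_rpow (by positivity) (by positivity)]
    exact Real.rpow_le_rpow (by positivity) hN (by linarith)
  calc (P.cost : ℝ) ≤ m * ((ArithTree.elimCost cost k + cost k : ℕ) : ℝ) := by exact_mod_cast hPc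
    _ ≤ m * (B * ((4 * (c + 1)) ^ ω * ((n + D).choose D : ℝ) ^ ω)) :=
      mul_le_mul_of_nonneg_left ((hcost k).trans (mul_le_mul_of_nonneg_left h4 hB))
        (Nat.cast_nonneg m)
    _ = _ := by ring

end Cost

/-! ### Pivots and the row space -/

section Pivots

variable {K : Type u} [Field K] {k : ℕ} {κ : Type} {left : κ → κ → Prop}
  {A : Matrix (Fin k) κ K}

/-- Row `i` of a matrix in reduced row echelon form has its pivot in column `q`. -/
structure IsPivot (left : κ → κ → Prop) (A : Matrix (Fin k) κ K) (i : Fin k) (q : κ) : Prop where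
  one : A i q = 1
  left : ∀ c, left c q → A i c = 0
  zero : ∀ i', i' ≠ i → A i' q = 0

/-- The first nonzero entry of an element of the row space stands in a pivot column. -/
theorem IsRREF.exists_isPivot [IsTrans κ left] (h : IsRREF left A) {w : κ → K}
    (hw : w ∈ Submodule.span K (Set.range fun i => A i)) (hw0 : w ≠ 0) :
    ∃ i q, IsPivot left A i q ∧ w q ≠ 0 ∧ ∀ c, left c q → w c = 0 := by
  obtain ⟨r, hr, p, hp, h1, hl, h0, hz⟩ := h
  obtain ⟨a, rfl⟩ := (Submodule.mem_span_range_iff_exists_fun K).1 hw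
  have happ : ∀ c, (∑ i, a i • A i) c = ∑ i, a i * A i c := fun c => by
    rw [Finset.sum_apply]
    rfl
  have hex : ∃ i : Fin r, a (Fin.castLE hr i) ≠ 0 := by
    by_contra! hall
    refine hw0 (funext fun c => ?_)
    rw [happ]
    refine Finset.sum_eq_zero fun i _ => ?_
    by_cases hi : (i : ℕ) < r
    · rw [show i = Fin.castLE hr ⟨i, hi⟩ from rfl, hall, zero_mul]
    · rw [hz i c (not_lt.1 hi), mul_zero]
  -- The first row with nonzero coefficient decides: later pivots are further to the right, and its
  -- own pivot column vanishes in the other rows.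
  obtain ⟨i, hi, hmin⟩ := (wellFounded_lt (α := Fin r)).has_min {i | a (Fin.castLE hr i) ≠ 0} hex
  refine ⟨Fin.castLE hr i, p i, ⟨h1 i, hl i, h0 i⟩, ?_, fun c hc => ?_⟩
  · rw [happ, Finset.sum_eq_single (Fin.castLE hr i), h1, mul_one]
    · exact hi
    · exact fun i' _ hne => by rw [h0 i i' hne, mul_zero]
    · exact fun hne => absurd (Finset.mem_univ _) hne
  · rw [happ]
    refine Finset.sum_eq_zero fun j _ => ?_
    by_cases hj : (j : ℕ) < r
    · obtain ⟨j, rfl⟩ : ∃ j' : Fin r, Fin.castLE hr j' = j := ⟨⟨j, hj⟩, rfl⟩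
      rcases lt_trichotomy j i with hji | rfl | hij
      · rw [not_not.1 fun hne => hmin j hne hji, zero_mul]
      · rw [hl j c hc, mul_zero]
      · rw [hl j c (_root_.trans hc (hp i j hij)), mul_zero]
    · rw [hz j c (not_lt.1 hj), mul_zero]

end Pivots

theorem IsRREFOf.row_mem_span {K : Type u} [Field K] {k : ℕ} {κ : Type} {left : κ → κ → Prop}
    {A B : Matrix (Fin k) κ K} (h : IsRREFOf left A B) (i : Fin k) :
    A i ∈ Submodule.span K (Set.range fun i => B i) :=
  h.2.le (Submodule.subset_span ⟨i, rfl⟩)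

theorem MvPolynomial.IsHomogeneous.degree_eq_of_mem_support {τ : Type} {K : Type u} [Field K]
    {f : MvPolynomial τ K} {a : ℕ} (hf : f.IsHomogeneous a) {s : τ →₀ ℕ} (hs : s ∈ f.support) :
    s.degree = a :=
  by_contra fun h => mem_support_iff.1 hs (hf.coeff_eq_zero h)

/-! ### From the echelon form to a homogeneous Gröbner basis -/

section MacaulayRows

variable {τ : Type} {K : Type u} [Field K]

/-- The coefficients of a polynomial in degrees at most `D`. -/
noncomputable def coeffVec (τ : Type) (K : Type u) [Field K] (D : ℕ) :
    MvPolynomial τ K →ₗ[K] MacaulayCol τ D → K :=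
  LinearMap.pi fun t => lcoeff K t.1

theorem coeffVec_apply {D : ℕ} (f : MvPolynomial τ K) (t : MacaulayCol τ D) :
    coeffVec τ K D f t = coeff t.1 f := rfl

theorem eq_of_coeffVec_eq {D : ℕ} {f g : MvPolynomial τ K} (hf : f.totalDegree ≤ D)
    (hg : g.totalDegree ≤ D) (h : coeffVec τ K D f = coeffVec τ K D g) : f = g := by
  ext t
  by_cases ht : t.degree ≤ D
  · exact congrFun h ⟨t, ht⟩
  · rw [coeff_eq_zero_of_totalDegree_lt, coeff_eq_zero_of_totalDegree_lt]
    · rw [← Finsupp.degree_apply]; omega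
    · rw [← Finsupp.degree_apply]; omega

variable {m k D : ℕ} {h : Fin m → MvPolynomial τ K} {d : Fin m → ℕ}
  {e : Fin k ≃ MacaulayRow τ d D}

theorem macaulayMatrix_row (r : Fin k) :
    macaulayMatrix h d D e r = coeffVec τ K D (monomial (e r).1.2 1 * h (e r).1.1) := rfl

theorem coeffVec_mul_mem_span (i : Fin m) {c : MvPolynomial τ K} {a : ℕ} (hc : c.IsHomogeneous a)
    (ha : a + d i ≤ D) :
    coeffVec τ K D (c * h i) ∈
      Submodule.span K (Set.range fun r => macaulayMatrix h d D e r) := by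
  rw [c.as_sum, Finset.sum_mul, map_sum]
  refine Submodule.sum_mem _ fun s hs => ?_
  have hsa : s.degree + d i ≤ D := by
    rwa [hc.degree_eq_of_mem_support hs]
  have hsc : monomial s (coeff s c) * h i = coeff s c • (monomial s 1 * h i) := by
    rw [← smul_mul_assoc, smul_monomial, smul_eq_mul, mul_one]
  rw [hsc, map_smul]
  refine Submodule.smul_mem _ _ (Submodule.subset_span ⟨e.symm ⟨(i, s), hsa⟩, ?_⟩)
  simp only [macaulayMatrix_row, Equiv.apply_symm_apply]

/-- For forms the cofactors in f = ∑ c_i h_i can be cut down to degree a - d_i, so no product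
exceeds the degree of f. Without homogeneity cancellation in high degrees could spoil this. -/
theorem coeffVec_mem_span (hh : ∀ i, (h i).IsHomogeneous (d i)) {f : MvPolynomial τ K}
    (hf : f ∈ Ideal.span (Set.range h)) {a : ℕ} (hfa : f.IsHomogeneous a) (ha : a ≤ D) :
    coeffVec τ K D f ∈ Submodule.span K (Set.range fun r => macaulayMatrix h d D e r) := by
  obtain ⟨c, rfl⟩ := Ideal.mem_span_range_iff_exists_fun.1 hf
  rw [← homogeneousComponent_eq_self hfa, map_sum, map_sum]
  refine Submodule.sum_mem _ fun i _ => ?_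
  rw [homogeneousComponent_mul_of_isHomogeneous (hh i)]
  split_ifs with hi
  · exact coeffVec_mul_mem_span i (homogeneousComponent_isHomogeneous _ _) (by omega)
  · rw [map_zero]
    exact Submodule.zero_mem _

theorem exists_coeffVec_eq (hh : ∀ i, (h i).IsHomogeneous (d i)) {w : MacaulayCol τ D → K}
    (hw : w ∈ Submodule.span K (Set.range fun r => macaulayMatrix h d D e r)) :
    ∃ f ∈ Ideal.span (Set.range h), f.totalDegree ≤ D ∧ coeffVec τ K D f = w := by
  have hle : Submodule.span K (Set.range fun r => macaulayMatrix h d D e r) ≤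
      ((Ideal.span (Set.range h)).restrictScalars K ⊓ restrictTotalDegree τ K D).map
        (coeffVec τ K D) := by
    rw [Submodule.span_le]
    rintro _ ⟨r, rfl⟩
    refine ⟨monomial (e r).1.2 1 * h (e r).1.1, ⟨Ideal.mul_mem_left _ _
      (Ideal.subset_span ⟨_, rfl⟩), ?_⟩, rfl⟩
    rw [SetLike.mem_coe, mem_restrictTotalDegree]
    exact ((isHomogeneous_monomial 1 rfl).mul (hh _)).totalDegree_le.trans (e r).2
  obtain ⟨f, ⟨hf, hfD⟩, rfl⟩ := hle hw
  rw [SetLike.mem_coe, mem_restrictTotalDegree] at hfD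
  exact ⟨f, hf, hfD, rfl⟩

instance {ord : MonomialOrder.{0, v} τ} {D : ℕ} : IsTrans (MacaulayCol τ D) (colLeft ord) :=
  ⟨fun _ _ _ hab hbc => lt_trans (α := ord.syn) hbc hab⟩

variable {ord : MonomialOrder.{0, v} τ} {A : Matrix (Fin k) (MacaulayCol τ D) K}

theorem exists_mem_rowPolys (hA : IsRREFOf (colLeft ord) A (macaulayMatrix h d D e))
    (hh : ∀ i, (h i).IsHomogeneous (d i)) {i : Fin k} {q : MacaulayCol τ D}
    (hq : IsPivot (colLeft ord) A i q) : ∃ g ∈ rowPolys A, ord.degree g = q.1 := by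
  obtain ⟨g, -, hgD, hg⟩ := exists_coeffVec_eq hh (hA.row_mem_span i)
  have hgq : coeff q.1 g = 1 := by rw [← hq.one, ← hg, coeffVec_apply]
  have hmem : q.1 ∈ g.support := by
    rw [mem_support_iff, hgq]
    exact one_ne_zero
  refine ⟨g, ⟨support_nonempty.1 ⟨_, hmem⟩, hgD, i, fun t => ?_⟩,
    MonomialOrder.degree_eq_of_forall_le hmem fun t ht => ?_⟩
  · rw [← hg, coeffVec_apply]
  · by_contra hlt
    have := hq.left ⟨t, (degree_le_totalDegree ht).trans hgD⟩ (not_le.1 hlt)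
    rw [← hg, coeffVec_apply] at this
    exact mem_support_iff.1 ht this

theorem mem_span_of_mem_rowPolys (hA : IsRREFOf (colLeft ord) A (macaulayMatrix h d D e))
    (hh : ∀ i, (h i).IsHomogeneous (d i)) {g : MvPolynomial τ K} (hg : g ∈ rowPolys A) :
    g ∈ Ideal.span (Set.range h) := by
  obtain ⟨-, hgD, r, hr⟩ := hg
  obtain ⟨f, hf, hfD, hfA⟩ := exists_coeffVec_eq hh (hA.row_mem_span r)
  rwa [eq_of_coeffVec_eq hgD hfD ((funext hr : coeffVec τ K D g = A r).trans hfA.symm)]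

/-- The component of the row in the degree of its pivot also lies in the row space. Its difference
to the row vanishes in every pivot column and is therefore zero. -/
theorem isHomogeneous_of_mem_rowPolys (hA : IsRREFOf (colLeft ord) A (macaulayMatrix h d D e))
    (hh : ∀ i, (h i).IsHomogeneous (d i)) {g : MvPolynomial τ K} (hg : g ∈ rowPolys A) :
    ∃ a, g.IsHomogeneous a := by
  have hgI := mem_span_of_mem_rowPolys hA hh hg
  have hI : HasHomogeneousComponents (Ideal.span (Set.range h)) :=
    hasHomogeneousComponents_span (by rintro _ ⟨i, rfl⟩; exact ⟨_, hh i⟩)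
  obtain ⟨hg0, hgD, r, hr⟩ := hg
  have hgr : coeffVec τ K D g = A r := funext hr
  have hgA : coeffVec τ K D g ∈ Submodule.span K (Set.range fun i => A i) :=
    Submodule.subset_span ⟨r, hgr.symm⟩
  have hgv : coeffVec τ K D g ≠ 0 := fun h0 =>
    hg0 (eq_of_coeffVec_eq hgD (by simp) (h0.trans (map_zero _).symm))
  obtain ⟨i, q, hq, hgq, -⟩ := hA.1.exists_isPivot hgA hgv
  obtain rfl : r = i := by
    by_contra hne
    rw [hgr, hq.zero r hne] at hgq
    exact hgq rfl
  set g' := homogeneousComponent q.1.degree g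
  have hg' : g'.IsHomogeneous q.1.degree := homogeneousComponent_isHomogeneous _ _
  have hg'A : coeffVec τ K D g' ∈ Submodule.span K (Set.range fun i => A i) :=
    hA.2.ge (coeffVec_mem_span hh (hI g hgI _) hg' q.2)
  refine ⟨q.1.degree, ?_⟩
  rw [eq_of_coeffVec_eq hgD (hg'.totalDegree_le.trans q.2) ?_]
  · exact hg'
  rw [← sub_eq_zero]
  by_contra hne
  -- In the pivot degree the difference is zero everywhere; in other degrees it agrees with row r,
  -- which vanishes in all pivot columns except its own.
  obtain ⟨i, p, hp, hw, -⟩ := hA.1.exists_isPivot (Submodule.sub_mem _ hgA hg'A) hne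
  refine hw ?_
  rw [Pi.sub_apply, coeffVec_apply, coeffVec_apply, coeff_homogeneousComponent]
  split_ifs with hdeg
  · exact sub_self _
  · rw [sub_zero, hr]
    refine hp.zero r ?_
    rintro rfl
    have hpq : p ≠ q := by rintro rfl; exact hdeg rfl
    rcases lt_or_gt_of_ne (fun h => hpq (Subtype.ext (ord.toSyn.injective h)) :
      ord.toSyn p.1 ≠ ord.toSyn q.1) with hlt | hlt
    · have := hp.left q hlt
      rw [hq.one] at this
      exact one_ne_zero this
    · have := hq.left p hlt
      rw [hp.one] at this
      exact one_ne_zero this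

theorem finite_rowPolys [Finite τ] (A : Matrix (Fin k) (MacaulayCol τ D) K) :
    (rowPolys A).Finite := by
  refine Set.Finite.of_finite_image (f := coeffVec τ K D)
    ((Set.finite_range fun i => A i).subset ?_) fun f hf g hg hfg =>
      eq_of_coeffVec_eq hf.2.1 hg.2.1 hfg
  rintro _ ⟨g, ⟨-, -, r, hr⟩, rfl⟩
  exact ⟨r, (funext hr).symm⟩

/-- The degree hypothesis puts a form with any given minimal lead into the row space. Its lead is
its first nonzero column, hence a pivot column, and the corresponding row has the same lead. -/
theorem isGroebnerBasis_rowPolys [Finite τ] (hord : ord.IsGraded)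
    (hA : IsRREFOf (colLeft ord) A (macaulayMatrix h d D e))
    (hh : ∀ i, (h i).IsHomogeneous (d i)) (hD : maxGBDeg ord (Ideal.span (Set.range h)) ≤ D) :
    IsGroebnerBasis ord (Ideal.span (Set.range h)) (rowPolys A) := by
  refine ⟨finite_rowPolys A, fun g hg => ⟨mem_span_of_mem_rowPolys hA hh hg, hg.1⟩,
    fun f hf hf0 => ?_⟩
  have hI : HasHomogeneousComponents (Ideal.span (Set.range h)) :=
    hasHomogeneousComponents_span (by rintro _ ⟨i, rfl⟩; exact ⟨_, hh i⟩)
  obtain ⟨s, hs, hle⟩ := exists_isMinimalLead_le ord hf hf0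
  have hsD := (hs.degree_le_maxGBDeg hord).trans hD
  obtain ⟨⟨f₁, hf₁, hf₁0, rfl⟩, -⟩ := hs
  obtain ⟨f', hf', hf'0, hfh, hfs⟩ := hI.exists_isHomogeneous (ord := ord) hf₁ hf₁0
  have hf'D : f'.totalDegree ≤ D := hfh.totalDegree_le.trans hsD
  have hmem : coeffVec τ K D f' ∈ Submodule.span K (Set.range fun i => A i) :=
    hA.2.ge (coeffVec_mem_span hh hf' hfh hsD)
  obtain ⟨i, q, hq, hne, hleft⟩ := hA.1.exists_isPivot hmem fun h0 =>
    hf'0 (eq_of_coeffVec_eq hf'D (by simp) (h0.trans (map_zero _).symm))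
  obtain ⟨g, hg, hgq⟩ := exists_mem_rowPolys hA hh hq
  refine ⟨g, hg, ?_⟩
  rw [hgq, ← MonomialOrder.degree_eq_of_forall_le (mem_support_iff.2 hne) (ord := ord), hfs]
  · exact hle
  · intro t ht
    by_contra hlt
    exact mem_support_iff.1 ht
      (hleft ⟨t, (degree_le_totalDegree ht).trans hf'D⟩ (not_le.1 hlt))

end MacaulayRows

/-! ### Setting y = 1 -/

section Dehomogenization

variable {σ : Type} {K : Type u} [Field K]

theorem dehomog_monomial (s : Option σ →₀ ℕ) (a : K) :
    dehomog (monomial s a) = monomial s.some a := by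
  rw [dehomog, aeval_monomial, Finsupp.prod_option_index _ _ (fun _ => pow_zero _)
    (fun _ _ _ => pow_add _ _ _)]
  simp only [Option.elim_none, one_pow, one_mul, Option.elim_some]
  exact monomial_eq.symm

theorem dehomog_eq_sum (g : MvPolynomial (Option σ) K) :
    dehomog g = ∑ s ∈ g.support, monomial s.some (coeff s g) := by
  conv_lhs => rw [g.as_sum, dehomog, map_sum]
  exact Finset.sum_congr rfl fun s _ => dehomog_monomial s _

theorem dehomog_homogPoly (f : MvPolynomial σ K) : dehomog (homogPoly f) = f := by
  rw [homogPoly, dehomog, map_sum]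
  conv_rhs => rw [f.as_sum]
  refine Finset.sum_congr rfl fun s _ => ?_
  exact (dehomog_monomial _ _).trans (by rw [Finsupp.some_optionElim])

theorem eq_of_some_eq {s t : Option σ →₀ ℕ} (h : s.some = t.some) (hd : s.degree = t.degree) :
    s = t := by
  have hs := degree_eq_none_add_degree_some s
  have ht := degree_eq_none_add_degree_some t
  rw [h] at hs
  ext o
  cases o with
  | none => omega
  | some i => simpa using DFunLike.congr_fun h i

/-- The monomials of a form are determined by their x-parts, so no two terms merge at y = 1. -/
theorem MvPolynomial.IsHomogeneous.coeff_dehomog {g : MvPolynomial (Option σ) K} {a : ℕ}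
    (hg : g.IsHomogeneous a) {s : Option σ →₀ ℕ} (hs : s ∈ g.support) :
    coeff s.some (dehomog g) = coeff s g := by
  classical
  rw [dehomog_eq_sum, coeff_sum, Finset.sum_eq_single s]
  · rw [coeff_monomial, if_pos rfl]
  · intro t ht hts
    rw [coeff_monomial, if_neg]
    exact fun h => hts (eq_of_some_eq h
      ((hg.degree_eq_of_mem_support ht).trans (hg.degree_eq_of_mem_support hs).symm))
  · exact fun h => absurd hs h

theorem exists_mem_support_of_dehomog {g : MvPolynomial (Option σ) K} {t : σ →₀ ℕ}
    (ht : t ∈ (dehomog g).support) : ∃ s ∈ g.support, s.some = t := by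
  classical
  by_contra! hne
  rw [mem_support_iff, dehomog_eq_sum, coeff_sum] at ht
  exact ht (Finset.sum_eq_zero fun s hs => by rw [coeff_monomial, if_neg (hne s hs)])

/-- Within one total degree the homogenized order is the order of the x-parts. -/
theorem MvPolynomial.IsHomogeneous.degree_dehomog (ord : MonomialOrder.{0, v} σ)
    {g : MvPolynomial (Option σ) K} {a : ℕ} (hg : g.IsHomogeneous a) (h0 : g ≠ 0) :
    dehomog g ≠ 0 ∧ ord.degree (dehomog g) = (ord.homogenization.degree g).some := by
  have hmem := ord.homogenization.degree_mem_support h0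
  have hmem' : (ord.homogenization.degree g).some ∈ (dehomog g).support := by
    rw [mem_support_iff, hg.coeff_dehomog hmem]
    exact mem_support_iff.1 hmem
  refine ⟨support_nonempty.1 ⟨_, hmem'⟩,
    MonomialOrder.degree_eq_of_forall_le hmem' fun t ht => ?_⟩
  obtain ⟨s, hs, rfl⟩ := exists_mem_support_of_dehomog ht
  by_contra hlt
  refine (ord.homogenization.le_degree hs).not_gt
    ((ord.homogenization_lt_iff _ _).2 (Or.inr ⟨?_, not_le.1 hlt⟩))
  exact (hg.degree_eq_of_mem_support hmem).trans (hg.degree_eq_of_mem_support hs).symm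

/-- Every element of an ideal with homogeneous components has the dehomogenization of a form. -/
theorem HasHomogeneousComponents.exists_dehomog_eq {I : Ideal (MvPolynomial (Option σ) K)}
    (hI : HasHomogeneousComponents I) {f : MvPolynomial (Option σ) K} (hf : f ∈ I) :
    ∃ g ∈ I, g.IsHomogeneous f.totalDegree ∧ dehomog g = dehomog f := by
  -- The components are raised to a common degree by powers of y, which become 1.
  refine ⟨∑ i ∈ Finset.range (f.totalDegree + 1),
    X none ^ (f.totalDegree - i) * homogeneousComponent i f,
    Ideal.sum_mem _ fun i _ => I.mul_mem_left _ (hI f hf i),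
    IsHomogeneous.sum _ _ _ fun i hi => ?_, ?_⟩
  · have h1 := ((isHomogeneous_X K (none : Option σ)).pow (f.totalDegree - i)).mul
      (homogeneousComponent_isHomogeneous i f)
    rwa [one_mul, Nat.sub_add_cancel (Finset.mem_range_succ_iff.1 hi)] at h1
  · conv_rhs => rw [← sum_homogeneousComponent f]
    simp [dehomog]

variable {m : ℕ} {F : Fin m → MvPolynomial σ K}

theorem dehomog_mem_span {g : MvPolynomial (Option σ) K}
    (hg : g ∈ Ideal.span (Set.range fun i => homogPoly (F i))) :
    dehomog g ∈ Ideal.span (Set.range F) := by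
  have hle : Ideal.span (Set.range fun i => homogPoly (F i)) ≤ (Ideal.span (Set.range F)).comap
      (aeval (R := K) fun o : Option σ => o.elim (1 : MvPolynomial σ K) X) := by
    rw [Ideal.span_le]
    rintro _ ⟨i, rfl⟩
    change dehomog (homogPoly (F i)) ∈ Ideal.span (Set.range F)
    rw [dehomog_homogPoly]
    exact Ideal.subset_span ⟨i, rfl⟩
  exact hle hg

theorem exists_dehomog_eq_of_mem_span {f : MvPolynomial σ K} (hf : f ∈ Ideal.span (Set.range F)) :
    ∃ g ∈ Ideal.span (Set.range fun i => homogPoly (F i)), dehomog g = f := by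
  obtain ⟨c, rfl⟩ := Ideal.mem_span_range_iff_exists_fun.1 hf
  refine ⟨∑ i, homogPoly (c i) * homogPoly (F i), Ideal.sum_mem _ fun i _ =>
    Ideal.mul_mem_left _ _ (Ideal.subset_span ⟨i, rfl⟩), ?_⟩
  rw [dehomog, map_sum]
  refine Finset.sum_congr rfl fun i _ => ?_
  rw [map_mul]
  exact congrArg₂ _ (dehomog_homogPoly _) (dehomog_homogPoly _)

/-- Each element of ⟨F⟩ is the value at y = 1 of a form of ⟨F^h⟩, and divisibility of leads survives
dropping the exponent of y. Homogeneity of `G` ensures that the leads of its elements are respected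
as well. -/
theorem IsGroebnerBasis.dehomog {ord : MonomialOrder.{0, v} σ}
    {G : Set (MvPolynomial (Option σ) K)}
    (hG : IsGroebnerBasis ord.homogenization (Ideal.span (Set.range fun i => homogPoly (F i))) G)
    (hhom : ∀ g ∈ G, ∃ a, g.IsHomogeneous a) :
    IsGroebnerBasis ord (Ideal.span (Set.range F)) (dehomog '' G) := by
  obtain ⟨hfin, hmem, hlead⟩ := hG
  refine ⟨hfin.image _, ?_, fun f hf hf0 => ?_⟩
  · rintro _ ⟨g, hg, rfl⟩
    obtain ⟨a, ha⟩ := hhom g hg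
    exact ⟨dehomog_mem_span (hmem g hg).1, (ha.degree_dehomog ord (hmem g hg).2).1⟩
  · have hI : HasHomogeneousComponents (Ideal.span (Set.range fun i => homogPoly (F i))) :=
      hasHomogeneousComponents_span (by rintro _ ⟨i, rfl⟩; exact ⟨_, isHomogeneous_homogPoly _⟩)
    obtain ⟨p, hp, rfl⟩ := exists_dehomog_eq_of_mem_span hf
    obtain ⟨q, hq, hqh, hqp⟩ := hI.exists_dehomog_eq hp
    rw [← hqp] at hf0 ⊢
    have hq0 : q ≠ 0 := by
      rintro rfl
      exact hf0 (by rw [_root_.dehomog, map_zero])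
    obtain ⟨g, hg, hle⟩ := hlead q hq hq0
    obtain ⟨a, ha⟩ := hhom g hg
    refine ⟨_, ⟨g, hg, rfl⟩, ?_⟩
    rw [(ha.degree_dehomog ord (hmem g hg).2).2, (hqh.degree_dehomog ord hq0).2]
    exact fun i => hle (some i)

end Dehomogenization
-- The main theorem
theorem mainTheorem5 {K : Type u} [Field K] :
    -- complexity
    (∀ ω : ℝ, 2 < ω → MatMulAdmissible K ω → ∀ c : ℕ, ∃ C : ℝ,
      ∀ (n m : ℕ) (d : Fin m → ℕ) (D : ℕ) (ord : MonomialOrder.{0, v} (Fin n))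
        (k : ℕ) (e : Fin k ≃ MacaulayRow (Option (Fin n)) d D),
        ord.IsGraded → D ≤ c * n →
        ∃ P : ArithTree K (Fin k × MacaulayCol (Option (Fin n)) D) (CoeffIdx (Fin n) d),
          (P.cost : ℝ) ≤ C * (m * ((n + D).choose D : ℝ) ^ ω) ∧
          ∀ (L : Type u) [Field L] [Algebra K L] (F : Fin m → MvPolynomial (Fin n) L)
            (A : Matrix (Fin k) (MacaulayCol (Option (Fin n)) D) L),
            (∀ i, F i ≠ 0 ∧ (F i).totalDegree = d i) →
            (∀ r t, A r t = P.eval (coeffList d F) (r, t)) →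
            IsRREFOf (colLeft ord.homogenization) A
              (macaulayMatrix (fun i => homogPoly (F i)) d D e) ∧
            (maxGBDeg ord.homogenization (Ideal.span (Set.range fun i => homogPoly (F i))) ≤ D →
              IsGroebnerBasis ord.homogenization
                (Ideal.span (Set.range fun i => homogPoly (F i))) (rowPolys A) ∧
              IsGroebnerBasis ord (Ideal.span (Set.range F)) (dehomog '' rowPolys A))) ∧
    -- the case `m = n`
    (∀ (n : ℕ) (F : Fin n → MvPolynomial (Fin n) K),
      (∀ i, 0 < (F i).totalDegree) →
      IsArtinianQuotient (Ideal.span (Set.range fun i => topPart (F i))) →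
      IsCryptoSemiRegular (fun i => topPart (F i)) →
      genDReg (Ideal.span (Set.range fun i => homogPoly (F i))) + 1 =
          dReg (Ideal.span (Set.range fun i => topPart (F i))) ∧
        dReg (Ideal.span (Set.range fun i => topPart (F i))) + n =
          ((∑ i, (F i).totalDegree + 1 : ℕ) : ℕ∞)) ∧
    -- the case `m > n`
    (∀ (n m : ℕ) (F : Fin m → MvPolynomial (Fin n) K), n < m →
      (∀ i, 0 < (F i).totalDegree) →
      IsGenCryptoSemiRegular (fun i => homogPoly (F i)) →
      genDReg (Ideal.span (Set.range fun i => homogPoly (F i))) ≤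
        psDegree (truncPos (hilbertSeriesQuot (fun i => (F i).totalDegree) (n + 1))) + 1) ∧
    -- bounds on the maximal Gröbner basis degree; it is `O(n)` for bounded degrees
    (∀ (n m : ℕ) (F : Fin m → MvPolynomial (Fin n) K) (ord : MonomialOrder.{0, v} (Fin n)),
      ord.IsGraded → (∀ i, 0 < (F i).totalDegree) →
      IsArtinianQuotient (Ideal.span (Set.range fun i => topPart (F i))) →
      IsCryptoSemiRegular (fun i => topPart (F i)) →
      (maxGBDeg ord.homogenization (Ideal.span (Set.range fun i => homogPoly (F i))) : ℕ∞) ≤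
          max (dReg (Ideal.span (Set.range fun i => topPart (F i))))
            (genDReg (Ideal.span (Set.range fun i => homogPoly (F i)))) ∧
        ∀ δ : ℕ, (∀ i, (F i).totalDegree ≤ δ) →
          (m = n ∨ n < m ∧ IsGenCryptoSemiRegular (fun i => homogPoly (F i))) →
          maxGBDeg ord.homogenization (Ideal.span (Set.range fun i => homogPoly (F i))) ≤
            (n + 1) * (δ - 1) + 1) := by
  refine ⟨fun ω hω h c => ?_, dReg_genDReg_of_square,
    fun n m F _ hd h => genDReg_homogPoly_le_psDegree n m F hd h,
    fun n m F ord hord hd hA h => ⟨maxGBDeg_homogenization_le hord hA,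
      maxGBDeg_homogenization_le_of_le n m F ord hord hd hA h⟩⟩
  obtain ⟨C, hC⟩ := h.exists_tree_macaulay hω c
  refine ⟨C, fun n m d D ord k e _ hD => ?_⟩
  obtain ⟨P, hPc, hP⟩ := hC n m d D ord.homogenization k e hD
  refine ⟨P, hPc, fun L _ _ F A hF hA => ?_⟩
  have hrref : IsRREFOf (colLeft ord.homogenization) A
      (macaulayMatrix (fun i => homogPoly (F i)) d D e) := by
    rw [show A = ArithTree.toMatrix (P.eval (coeffList d F)) from
      funext fun r => funext fun t => hA r t]
    exact hP L F fun i => (hF i).2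
  have hh : ∀ i, (homogPoly (F i)).IsHomogeneous (d i) := fun i =>
    (hF i).2 ▸ isHomogeneous_homogPoly (F i)
  refine ⟨hrref, fun hmax => ?_⟩
  have hG := isGroebnerBasis_rowPolys ord.isGraded_homogenization hrref hh hmax
  exact ⟨hG, hG.dehomog fun g hg => isHomogeneous_of_mem_rowPolys hrref hh hg⟩
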